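/- **Conventions.** A *disk* in the plane $\mathbb C\cong\mathbb R^2$ is the inside of a circle (curvature $1/r>0$), the outside of a circle (signed radius $r<0$, curvature $1/r<0$) or a half-plane (curvature $0$). A *Descartes configuration* consists of four mutually tangent, non-overlapping disks (two disjoint parallel half-planes count as tangent at infinity). Its *completion* is the Apollonian packing of all disks obtained by repeatedly exchanging a disk of a configuration for the other disk tangent to the remaining three. A packing is *integral* if all its curvatures are integers and *irreducible* if these have no common factor. A *major disk* $d_0$ is a disk of the packing of curvature $\le 0$; its *major corona* is the set of disks of the packing tangent to $d_0$. A *tangency spinor* of tangent disks $d,e$ with centres $C_d,C_e$ and signed radii $r_d,r_e$ is $\mathbf u=\pm\sqrt{(C_e-C_d)/(r_dr_e)}\in\mathbb C$ (extended by continuity to half-planes). The *spinor lattice* of the major corona is the group generated by the spinors from $d_0$ to the disks of its corona. A Descartes configuration is *maximal* if its completion contains no further disk of curvature smaller than one in the configuration. Write $L(\mathbf v,\mathbf w)=\mathbb Z\mathbf v+\mathbb Z\mathbf w$. An *integral lattice* is a nonzero subgroup $L\subset\mathbb Z^2$, of rank two or (degenerate case) of rank one. Two lattices are *similar* if a composition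 of rotations, reflections and dilations carries one onto the other; $L$ is *irreducible* if it is not the image of an integral lattice under a similarity of ratio $>1$. A pair $(\mathbf a,\mathbf b)$ is *reduced* if $\|\mathbf a\|\le\|\mathbf b\|\le\|\mathbf a\pm\mathbf b\|$ and $\mathbf a\cdot\mathbf b\ge0$; it is a *principal basis* of $L$ if moreover $L=L(\mathbf a,\mathbf b)$ (in rank one this means a generating pair $(0,\mathbf b)$). **Theorem.** (1) There are one-to-one correspondences between * irreducible integral Apollonian packings up to Euclidean isometry, * irreducible integral lattices up to similarity, * reduced pairs of integral vectors spanning an irreducible lattice, up to a common rotation or reflection. A packing corresponds to the class of an irreducible integral lattice $L$ if and only if the spinor lattice of its major corona (at any major disk $d_0$) is carried onto $L$ by a rotation or reflection; then, for every $\mathbf v,\mathbf w$ with $L=L(\mathbf v,\mathbf w)$, the curvature of $d_0$ is $-|\mathbf v\times\mathbf w|$. (So rank-two lattices correspond to packings bounded by a circle, and rank one to the Apollonian strip.) A reduced pair $(\mathbf a,\mathbf b)$ corresponds to the class of $L(\mathbf a,\mathbf b)$. (2) Every integral Apollonian packing $P$ has a major disk. For each major disk $d_0$ the spinor lattice of its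 corona has a principal basis, and for every principal basis $(\mathbf a,\mathbf b)$: there are disks in the corona with spinors $\mathbf a$ and $\mathbf b$ from $d_0$; and for any disks $d_1,d_2$ of the corona with spinors $\mathbf a,\mathbf b$ there is a disk $d_3$ of the corona with spinor $\mathbf a-\mathbf b$ such that $(d_0,d_1,d_2,d_3)$ is a maximal Descartes configuration whose completion is $P$, with curvatures $$-|\mathbf a\times\mathbf b|,\quad |\mathbf a\times\mathbf b|+\|\mathbf a\|^2,\quad |\mathbf a\times\mathbf b|+\|\mathbf b\|^2,\quad |\mathbf a\times\mathbf b|+\|\mathbf a-\mathbf b\|^2 .$$ Conversely, every maximal Descartes configuration with completion $P$ is, after reordering, of the form $(d_0,d_1,d_2,d_3)$ with $d_0$ major and with spinors $\mathbf a,\mathbf b,\mathbf a-\mathbf b$ from $d_0$ to $d_1,d_2,d_3$, for some principal basis $(\mathbf a,\mathbf b)$ of the spinor lattice of the corona of $d_0$. -/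

import Mathlib

namespace Apollonian

/-! ### Disks in the plane -/

/-- An oriented generalized disk in the plane `ℂ`: the inside of a circle (`curv > 0`), the outside
of a circle (`curv < 0`), or a half-plane (`curv = 0`).  For a circle of signed radius `r` and
centre `z`, `curv = 1 / r`, `cen = z / r` (the reduced centre) and `cocurv = (|z|² - r²) / r`.  For
a half-plane, `cen` is the unit normal pointing into it. -/
@[ext]
structure Disk where
  curv : ℝ
  cen : ℂ
  cocurv : ℝ
  norm_eq : ‖cen‖ ^ 2 - curv * cocurv = 1

/-- The symplectic product `x y' - x' y`. -/
def cross (a b : ℂ) : ℝ := a.re * b.im - b.re * a.im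

/-- The dot product `x x' + y y'`. -/
def dot (a b : ℂ) : ℝ := a.re * b.re + a.im * b.im

/-- The closed region of the plane occupied by a disk. -/
def Disk.carrier (d : Disk) : Set ℂ :=
  {z | d.curv * ‖z‖ ^ 2 - 2 * dot d.cen z + d.cocurv ≤ 0}

/-- The inversive product; for circles with signed radii `r, r'` and centres at distance `δ` it is
`(r² + r'² - δ²) / (2 r r')`. -/
noncomputable def inversive (d d' : Disk) : ℝ :=
  dot d.cen d'.cen - (d.curv * d'.cocurv + d'.curv * d.cocurv) / 2

/-- Two disks are tangent and do not overlap.  The first condition says that the boundary circles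
are tangent (`δ² = (r + r')²` for signed radii), the second one that the disks lie on opposite
sides of the common tangent and are not complementary; see `tangent_iff` for circles.  Two disjoint
parallel half-planes count as tangent (at infinity). -/
def Tangent (d d' : Disk) : Prop :=
  inversive d d' = -1 ∧ 0 < (d.curv + d'.curv) + (d.cocurv + d'.cocurv)

theorem carrier_aux (d : Disk) (z : ℂ) (h : d.curv ≠ 0) :
    d.curv * ‖z‖ ^ 2 - 2 * dot d.cen z + d.cocurv =
      d.curv * (‖z - (1 / d.curv : ℝ) * d.cen‖ ^ 2 - (1 / d.curv) ^ 2) := by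
  have hn := d.norm_eq
  simp only [dot, Complex.sq_norm, Complex.normSq_apply, Complex.sub_re,
    Complex.sub_im, Complex.re_ofReal_mul, Complex.im_ofReal_mul] at hn ⊢
  field_simp
  linear_combination -hn

theorem carrier_of_curv_pos (d : Disk) (h : 0 < d.curv) :
    d.carrier = Metric.closedBall ((1 / d.curv : ℝ) * d.cen) (1 / d.curv) := by
  ext z
  have key := carrier_aux d z h.ne'
  rw [Metric.mem_closedBall, Complex.dist_eq,
    ← sq_le_sq₀ (norm_nonneg _) (one_div_pos.mpr h).le]
  simp only [Disk.carrier, Set.mem_ofPred_eq]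
  rw [key]
  constructor
  · intro hz
    have := nonpos_of_mul_nonpos_right hz h
    linarith
  · intro hz
    exact mul_nonpos_of_nonneg_of_nonpos h.le (by linarith)

theorem carrier_of_curv_neg (d : Disk) (h : d.curv < 0) :
    d.carrier = (Metric.ball ((1 / d.curv : ℝ) * d.cen) (-(1 / d.curv)))ᶜ := by
  ext z
  have key := carrier_aux d z h.ne
  have hr : 0 < -(1 / d.curv) := neg_pos.mpr (one_div_neg.mpr h)
  rw [Set.mem_compl_iff, Metric.mem_ball, Complex.dist_eq, not_lt,
    ← sq_le_sq₀ hr.le (norm_nonneg _), neg_sq]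
  simp only [Disk.carrier, Set.mem_ofPred_eq]
  rw [key]
  constructor
  · intro hz
    by_contra hc
    have := mul_pos_of_neg_of_neg h (sub_neg.mpr (not_le.mp hc))
    linarith
  · intro hz
    exact mul_nonpos_of_nonpos_of_nonneg h.le (by linarith)

theorem tangent_iff (d d' : Disk) (h : d.curv ≠ 0) (h' : d'.curv ≠ 0) :
    Tangent d d' ↔
      dist ((1 / d.curv : ℝ) * d.cen) ((1 / d'.curv : ℝ) * d'.cen) = |1 / d.curv + 1 / d'.curv| ∧
        0 < d.curv + d'.curv := by
  have h1 := d.norm_eq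
  have h2 := d'.norm_eq
  rw [Complex.dist_eq, ← abs_of_nonneg (norm_nonneg _), ← sq_eq_sq_iff_abs_eq_abs]
  simp only [Tangent, inversive, dot, Complex.sq_norm, Complex.normSq_apply, Complex.sub_re,
    Complex.sub_im, Complex.re_ofReal_mul, Complex.im_ofReal_mul] at h1 h2 ⊢
  generalize d.curv = b, d'.curv = b', d.cen.re = x, d.cen.im = y, d'.cen.re = x',
    d'.cen.im = y', d.cocurv = e, d'.cocurv = e' at *
  have hprod : (1 / b * x - 1 / b' * x') * (1 / b * x - 1 / b' * x') +
      (1 / b * y - 1 / b' * y') * (1 / b * y - 1 / b' * y') = (1 / b + 1 / b') ^ 2 ↔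
      x * x' + y * y' - (b * e' + b' * e) / 2 = -1 := by
    have hid : (1 / b * x - 1 / b' * x') * (1 / b * x - 1 / b' * x') +
      (1 / b * y - 1 / b' * y') * (1 / b * y - 1 / b' * y') - (1 / b + 1 / b') ^ 2 =
      -2 / (b * b') * (x * x' + y * y' - (b * e' + b' * e) / 2 + 1) := by
      have hx : x * x = 1 + b * e - y * y := by linarith
      have hx' : x' * x' = 1 + b' * e' - y' * y' := by linarith
      field_simp
      linear_combination b' ^ 2 * hx + b ^ 2 * hx'
    have hne : -2 / (b * b') ≠ 0 := div_ne_zero (by norm_num) (mul_ne_zero h h')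
    rw [← sub_eq_zero, hid, mul_eq_zero, or_iff_right hne]
    constructor <;> intro H <;> linarith
  rw [hprod]
  refine and_congr_right fun H => ?_
  -- the sum of the two disks is a null vector
  have hnull : (x + x') ^ 2 + (y + y') ^ 2 = (b + b') * (e + e') := by nlinarith
  constructor
  · intro hp
    have hge : 0 ≤ (b + b') * (e + e') := hnull ▸ by positivity
    by_contra hneg
    rcases (not_lt.mp hneg).lt_or_eq with hlt | heq
    · have : e + e' ≤ 0 := by
        by_contra hc
        have := mul_neg_of_neg_of_pos hlt (not_le.mp hc)
        linarith
      linarith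
    · rw [heq, zero_mul] at hnull
      have hxs : x + x' = 0 := by nlinarith [sq_nonneg (x + x'), sq_nonneg (y + y')]
      have hys : y + y' = 0 := by nlinarith [sq_nonneg (x + x'), sq_nonneg (y + y')]
      have hx : x' = -x := by linarith
      have hy : y' = -y := by linarith
      have hb : b' = -b := by linarith
      subst hx hy hb
      have : b * (e + e') = 0 := by linarith
      rcases mul_eq_zero.mp this with h0 | h0
      · exact h h0
      · linarith
  · intro hp
    have : 0 ≤ e + e' := by
      by_contra hc
      have := mul_neg_of_pos_of_neg hp (not_le.mp hc)
      nlinarith [sq_nonneg (x + x'), sq_nonneg (y + y')]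
    linarith

/-! ### Descartes configurations and Apollonian packings -/

/-- Four mutually tangent, non-overlapping disks. -/
def IsDescartes (D : Fin 4 → Disk) : Prop := ∀ i j, i ≠ j → Tangent (D i) (D j)

/-- Descartes configurations obtained from `D` by repeatedly exchanging one disk for a disk tangent
to the three others. -/
inductive Reach (D : Fin 4 → Disk) : (Fin 4 → Disk) → Prop
  | base : Reach D D
  | step (E E' : Fin 4 → Disk) (i : Fin 4) (hE : Reach D E) (hD : IsDescartes E')
      (h : ∀ j, j ≠ i → E' j = E j) : Reach D E'

/-- The completion of `D`: all disks obtained by recursively inscribing disks tangent to three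
disks of a configuration. -/
def packing (D : Fin 4 → Disk) : Set Disk := {d | ∃ E, Reach D E ∧ ∃ i, d = E i}

def IsPacking (P : Set Disk) : Prop := ∃ D, IsDescartes D ∧ P = packing D

/-- All curvatures are integers. -/
def IsIntegralPacking (P : Set Disk) : Prop := ∀ d ∈ P, ∃ k : ℤ, d.curv = k

/-- The (integral) curvatures have no common factor. -/
def IsCoprimePacking (P : Set Disk) : Prop :=
  ∀ m : ℕ, (∀ d ∈ P, ∃ k : ℤ, d.curv = (m : ℝ) * k) → m = 1

/-- The completion of the configuration has no further disk of curvature smaller than one in the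
configuration. -/
def IsMaximal (D : Fin 4 → Disk) : Prop :=
  ∀ d ∈ packing D, d ∉ Set.range D → ∀ i, (D i).curv ≤ d.curv

/-- A disk of the packing of negative or zero curvature. -/
def IsMajor (P : Set Disk) (d : Disk) : Prop := d ∈ P ∧ d.curv ≤ 0

/-- The disks of the packing that are tangent to `d`. -/
def corona (P : Set Disk) (d : Disk) : Set Disk := {e | e ∈ P ∧ Tangent d e}

/-- A Euclidean isometry of the plane carries the disks of `P` onto the disks of `Q`. -/
def Congruent (P Q : Set Disk) : Prop :=
  ∃ g : ℂ ≃ᵢ ℂ, (fun d : Disk => g '' d.carrier) '' P = Disk.carrier '' Q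

/-! ### Spinors and lattices -/

/-- `u` is a tangency spinor of the ordered pair `(d, e)`: `u² = z / (r r')`, where `z` is the
vector from the centre of `d` to the centre of `e` and `r, r'` are the signed radii.  Written with
reduced centres this is `u² = curv d * cen e - curv e * cen d`, which also covers half-planes. -/
def IsSpinor (d e : Disk) (u : ℂ) : Prop := u ^ 2 = d.curv * e.cen - e.curv * d.cen

/-- The lattice `L(v, w)` of integral combinations of `v` and `w`. -/
def lat (v w : ℂ) : AddSubgroup ℂ := AddSubgroup.closure {v, w}

/-- The lattice generated by the tangency spinors from `d` to the disks of its corona. -/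
def coronaLattice (P : Set Disk) (d : Disk) : AddSubgroup ℂ :=
  AddSubgroup.closure {u | ∃ e ∈ corona P d, IsSpinor d e u}

/-- The vector has integral coordinates. -/
def IsInt (v : ℂ) : Prop := ∃ m n : ℤ, v = ⟨m, n⟩

/-- A nonzero sublattice of `ℤ²`, of rank two or (degenerate) of rank one. -/
def IsIntegralLattice (L : AddSubgroup ℂ) : Prop :=
  L ≠ ⊥ ∧ ∃ v w : ℂ, IsInt v ∧ IsInt w ∧ L = lat v w

/-- `L'` is the image of `L` under a rotation or reflection followed by the dilation by `r`. -/
def SimilarBy (r : ℝ) (L L' : AddSubgroup ℂ) : Prop :=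
  ∃ g : ℂ ≃ₗᵢ[ℝ] ℂ, (L' : Set ℂ) = (fun z => r • g z) '' (L : Set ℂ)

def Similar (L L' : AddSubgroup ℂ) : Prop := ∃ r : ℝ, 0 < r ∧ SimilarBy r L L'

/-- An integral lattice is irreducible if it is not an enlarged copy of an integral lattice. -/
def IsIrreducibleLattice (L : AddSubgroup ℂ) : Prop :=
  IsIntegralLattice L ∧
    ¬ ∃ (r : ℝ) (L' : AddSubgroup ℂ), 1 < r ∧ IsIntegralLattice L' ∧ SimilarBy r L' L

/-- The pair `(a, b)` is reduced, with right or acute angle. -/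
def IsReduced (a b : ℂ) : Prop :=
  ‖a‖ ≤ ‖b‖ ∧ ‖b‖ ≤ ‖a + b‖ ∧ ‖b‖ ≤ ‖a - b‖ ∧ 0 ≤ dot a b

/-- `(a, b)` is a principal basis of `L` (a principal generating pair `(0, b)` if `L` has rank
one). -/
def IsPrincipalBasis (L : AddSubgroup ℂ) (a b : ℂ) : Prop := L = lat a b ∧ IsReduced a b

/-! ### The classes to be compared -/

/-- Irreducible integral Apollonian packings. -/
abbrev IrrPacking : Type := {P : Set Disk // IsPacking P ∧ IsIntegralPacking P ∧ IsCoprimePacking P}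

/-- Irreducible integral lattices. -/
abbrev IrrLattice : Type := {L : AddSubgroup ℂ // IsIrreducibleLattice L}

/-- Reduced pairs of integral vectors that span an irreducible lattice. -/
abbrev ReducedPair : Type :=
  {p : ℂ × ℂ // IsInt p.1 ∧ IsInt p.2 ∧ IsReduced p.1 p.2 ∧ IsIrreducibleLattice (lat p.1 p.2)}

theorem congruent_equivalence : Equivalence Congruent := by
  refine ⟨fun P => ⟨IsometryEquiv.refl ℂ, ?_⟩, ?_, ?_⟩
  · exact Set.image_congr fun d _ => Set.image_id d.carrier
  · rintro P Q ⟨g, hg⟩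
    refine ⟨g.symm, ?_⟩
    have h := congrArg (fun T : Set (Set ℂ) => (fun s : Set ℂ => g.symm '' s) '' T) hg
    simpa [Set.image_image] using h.symm
  · rintro P Q R ⟨g, hg⟩ ⟨k, hk⟩
    refine ⟨g.trans k, ?_⟩
    have h := congrArg (fun T : Set (Set ℂ) => (fun s : Set ℂ => k '' s) '' T) hg
    simp only [Set.image_image] at h
    rw [← hk]
    refine Eq.trans ?_ h
    rfl

theorem similar_equivalence : Equivalence Similar := by
  refine ⟨fun L => ⟨1, one_pos, LinearIsometryEquiv.refl ℝ ℂ, by simp⟩, ?_, ?_⟩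
  · rintro L M ⟨r, hr, g, hg⟩
    refine ⟨r⁻¹, inv_pos.mpr hr, g.symm, ?_⟩
    rw [hg, Set.image_image]
    have h : (fun z => r⁻¹ • g.symm (r • g z)) = id := by
      funext z
      rw [map_smul, smul_smul, inv_mul_cancel₀ hr.ne', one_smul, g.symm_apply_apply, id]
    rw [h, Set.image_id]
  · rintro L M N ⟨r, hr, g, hg⟩ ⟨s, hs, k, hk⟩
    refine ⟨s * r, mul_pos hs hr, g.trans k, ?_⟩
    rw [hk, hg, Set.image_image]
    congr 1
    funext z
    rw [map_smul, smul_smul, LinearIsometryEquiv.trans_apply]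

/-- Packings up to Euclidean isometry. -/
instance packingSetoid : Setoid IrrPacking where
  r P Q := Congruent P.1 Q.1
  iseqv := ⟨fun _ => congruent_equivalence.refl _, fun h => congruent_equivalence.symm h,
    fun h k => congruent_equivalence.trans h k⟩

/-- Lattices up to similarity. -/
instance latticeSetoid : Setoid IrrLattice where
  r L M := Similar L.1 M.1
  iseqv := ⟨fun _ => similar_equivalence.refl _, fun h => similar_equivalence.symm h,
    fun h k => similar_equivalence.trans h k⟩

/-- Pairs of vectors up to a common rotation or reflection. -/
instance pairSetoid : Setoid ReducedPair where
  r p q := ∃ g : ℂ ≃ₗᵢ[ℝ] ℂ, g p.1.1 = q.1.1 ∧ g p.1.2 = q.1.2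
  iseqv := by
    refine ⟨fun p => ⟨LinearIsometryEquiv.refl ℝ ℂ, rfl, rfl⟩, ?_, ?_⟩
    · rintro p q ⟨g, h1, h2⟩
      exact ⟨g.symm, by simp [← h1], by simp [← h2]⟩
    · rintro p q r ⟨g, h1, h2⟩ ⟨k, h3, h4⟩
      exact ⟨g.trans k, by simp [h1, h3], by simp [h2, h4]⟩

/-- The lattice spanned by a reduced pair. -/
def ReducedPair.lattice (p : ReducedPair) : IrrLattice := ⟨lat p.1.1 p.1.2, p.2.2.2.2⟩

end Apollonian

open Apollonian

/-! A disk is a unit vector (curvature, reduced centre, cocurvature) in Minkowski space, and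
tangency means inner product -1. Four mutually tangent disks have Gram matrix G = 2I - J, with J the
all-ones matrix, and G² = 4I. This yields Descartes' theorem in matrix form
(`IsDescartes.relations`). It also shows that the other disk tangent to three given ones is 2Σ - 3Eᵢ
(`IsDescartes.eq_or_isSwap`), so a packing is an orbit of linear exchanges.

Fix a disk E₀ of a configuration. The squares of the spinors to the other three satisfy Descartes'
relation with a zero entry, which factors; up to signs the spinors are a, b, a - b. Exchanges of the
other disks obey the parallelogram law for a quadratic map `cone` from ℤ² to the light cone. By
Euclid's algorithm every pair in ℤ² of determinant ±1 is therefore realized by a configuration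
containing E₀ (`exists_fan`). Once E₀ itself is exchanged, inversive products with it keep
decreasing, so no further tangent disks arise (`corona_aux`). Hence the spinor lattice of the corona
is L(a, b).

The norms of a, b and a - b are the curvatures of the three disks shifted by that of E₀, and |a × b|
is the absolute curvature of E₀. So sorted curvatures that no exchange decreases are the same as a
reduced basis (a, b), and such configurations are the maximal ones because curvatures grow along
words without immediate repetition (`IsRoot.growth`). They exist in an integral packing, since the
positive integer Σ curv can be minimized.

For the correspondence, a lattice determines the Gram matrix of its reduced bases
(`gram_eq_of_lat_eq`), this determines the four curvatures, and these determine the configuration up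
to isometry (`exists_move_of_curv_eq`). Coprimality of the curvatures matches irreducibility of the
lattice through gcds in ℤ[i]: `exists_int_of_gram` realizes the Gram matrix of a packing by integral
vectors. Conversely, `exists_descartes_of_reduced` writes down a configuration for a given reduced
basis. -/

namespace Apollonian

/-! ### Minkowski geometry and Descartes' theorem -/

/-- The coordinate vector of a disk in Minkowski space. -/
def Disk.vec (d : Disk) : ℝ × ℂ × ℝ := (d.curv, d.cen, d.cocurv)

theorem Disk.vec_injective : Function.Injective Disk.vec := by
  intro d d' h
  simp only [Disk.vec, Prod.mk.injEq] at h
  exact Disk.ext h.1 h.2.1 h.2.2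

/-- The Minkowski form of which `inversive` is the restriction to disks. -/
noncomputable def mink (v w : ℝ × ℂ × ℝ) : ℝ :=
  dot v.2.1 w.2.1 - (v.1 * w.2.2 + w.1 * v.2.2) / 2

theorem inversive_eq_mink (d d' : Disk) : inversive d d' = mink d.vec d'.vec := rfl

theorem inversive_comm (d d' : Disk) : inversive d d' = inversive d' d := by
  simp only [inversive, dot]; ring

theorem inversive_self (d : Disk) : inversive d d = 1 := by
  have h := d.norm_eq
  simp only [inversive, dot, Complex.sq_norm, Complex.normSq_apply] at h ⊢
  linarith

theorem mink_add (u v w : ℝ × ℂ × ℝ) : mink u (v + w) = mink u v + mink u w := by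
  simp only [mink, dot, Prod.snd_add, Prod.fst_add, Complex.add_re, Complex.add_im]; ring

theorem mink_smul (c : ℝ) (u v : ℝ × ℂ × ℝ) : mink u (c • v) = c * mink u v := by
  simp only [mink, dot, Prod.smul_snd, Prod.smul_fst, Complex.smul_re, Complex.smul_im,
    smul_eq_mul]; ring

theorem Tangent.symm {d d' : Disk} (h : Tangent d d') : Tangent d' d :=
  ⟨inversive_comm d d' ▸ h.1, by linarith [h.2]⟩

theorem tangent_null {d d' : Disk} (h : inversive d d' = -1) :
    ‖d.cen + d'.cen‖ ^ 2 = (d.curv + d'.curv) * (d.cocurv + d'.cocurv) := by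
  have h1 := d.norm_eq
  have h2 := d'.norm_eq
  simp only [inversive, dot, Complex.sq_norm, Complex.normSq_apply, Complex.add_re,
    Complex.add_im] at h h1 h2 ⊢
  linarith

/-- For two disks with inversive product `-1` the orientation condition can be read off from the
curvatures, except for parallel half-planes. -/
theorem tangent_iff_of_inversive {d d' : Disk} (h : inversive d d' = -1) :
    Tangent d d' ↔ 0 < d.curv + d'.curv ∨
      (d.curv + d'.curv = 0 ∧ 0 < d.cocurv + d'.cocurv) := by
  have hn := tangent_null h
  have h0 : 0 ≤ (d.curv + d'.curv) * (d.cocurv + d'.cocurv) := hn ▸ by positivity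
  constructor
  · rintro ⟨-, hp⟩
    rcases lt_trichotomy (d.curv + d'.curv) 0 with hlt | heq | hgt
    · exact absurd h0 (not_le.mpr (mul_neg_of_neg_of_pos hlt (by linarith)))
    · exact Or.inr ⟨heq, by linarith⟩
    · exact Or.inl hgt
  · rintro (hp | ⟨h1, h2⟩)
    · exact ⟨h, by linarith [nonneg_of_mul_nonneg_right h0 hp]⟩
    · exact ⟨h, by linarith⟩

theorem Tangent.curv_add_nonneg {d d' : Disk} (h : Tangent d d') : 0 ≤ d.curv + d'.curv := by
  rcases (tangent_iff_of_inversive h.1).mp h with h | h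
  · exact h.le
  · exact h.1.ge

/-- The matrix form of Descartes' theorem. -/
theorem descartes_aux (m : Matrix (Fin 4) (Fin 4) ℝ)
    (h : ∀ i j, m i 1 * m j 1 + m i 2 * m j 2 - (m i 0 * m j 3 + m j 0 * m i 3) / 2
      = if i = j then 1 else -1) :
    ∀ k l, (∑ i, m i k * m i l) / 2 - (∑ i, m i k) * (∑ i, m i l) / 4 =
      (!![0, 0, 0, -2; 0, 1, 0, 0; 0, 0, 1, 0; -2, 0, 0, 0] : Matrix (Fin 4) (Fin 4) ℝ) k l := by
  set Q : Matrix (Fin 4) (Fin 4) ℝ :=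
    !![0, 0, 0, -(1 / 2); 0, 1, 0, 0; 0, 0, 1, 0; -(1 / 2), 0, 0, 0] with hQ
  set R : Matrix (Fin 4) (Fin 4) ℝ :=
    !![0, 0, 0, -2; 0, 1, 0, 0; 0, 0, 1, 0; -2, 0, 0, 0] with hR
  set G : Matrix (Fin 4) (Fin 4) ℝ := Matrix.of fun i j => if i = j then 1 else -1 with hG
  set H : Matrix (Fin 4) (Fin 4) ℝ := Matrix.of fun i j => if i = j then 1 / 4 else -(1 / 4)
    with hH
  -- With J the all-ones matrix, G = 2I - J and J² = 4J, so G² = 4I and the inverse of G is G/4.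
  have hGH : G * H = 1 := by
    ext i j
    fin_cases i <;> fin_cases j <;>
      simp [hG, hH, Matrix.mul_apply, Fin.sum_univ_four] <;> norm_num
  have hQR : Q * R = 1 := by
    ext i j
    fin_cases i <;> fin_cases j <;>
      simp [hQ, hR, Matrix.mul_apply, Fin.sum_univ_four]
  have hm : m * (Q * m.transpose) = G := by
    ext i j
    have := h i j
    simp only [Matrix.mul_apply, Fin.sum_univ_four, hQ, hG, Matrix.transpose_apply,
      Matrix.of_apply, ← this]
    simp
    ring
  have h1 : m * (Q * m.transpose * H) = 1 := by
    rw [← Matrix.mul_assoc, hm, hGH]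
  -- For square matrices a right inverse is a left inverse; this turns the relations between rows
  -- into relations between columns.
  have h2 : Q * (m.transpose * H * m) = 1 := by
    rw [← mul_eq_one_comm.mp h1]
    simp only [Matrix.mul_assoc]
  have h3 : m.transpose * H * m = R := by
    have hRQ := mul_eq_one_comm.mp hQR
    calc m.transpose * H * m = R * Q * (m.transpose * H * m) := by rw [hRQ, one_mul]
      _ = R := by rw [Matrix.mul_assoc, h2, mul_one]
  intro k l
  rw [← h3]
  simp [Matrix.mul_apply, Fin.sum_univ_four, hH]
  ring

/-- Descartes' circle theorem for the coordinates of four mutually tangent disks. -/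
structure Relations (E : Fin 4 → Disk) : Prop where
  bb : 2 * ∑ i, (E i).curv ^ 2 = (∑ i, (E i).curv) ^ 2
  bx : 2 * ∑ i, (E i).curv * (E i).cen.re = (∑ i, (E i).curv) * ∑ i, (E i).cen.re
  yb : 2 * ∑ i, (E i).curv * (E i).cen.im = (∑ i, (E i).curv) * ∑ i, (E i).cen.im
  be : 2 * ∑ i, (E i).curv * (E i).cocurv = (∑ i, (E i).curv) * (∑ i, (E i).cocurv) - 8
  xx : 2 * ∑ i, (E i).cen.re ^ 2 = (∑ i, (E i).cen.re) ^ 2 + 4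
  xy : 2 * ∑ i, (E i).cen.re * (E i).cen.im = (∑ i, (E i).cen.re) * ∑ i, (E i).cen.im
  yy : 2 * ∑ i, (E i).cen.im ^ 2 = (∑ i, (E i).cen.im) ^ 2 + 4
  xe : 2 * ∑ i, (E i).cen.re * (E i).cocurv = (∑ i, (E i).cen.re) * ∑ i, (E i).cocurv
  ye : 2 * ∑ i, (E i).cen.im * (E i).cocurv = (∑ i, (E i).cen.im) * ∑ i, (E i).cocurv
  ee : 2 * ∑ i, (E i).cocurv ^ 2 = (∑ i, (E i).cocurv) ^ 2

theorem IsDescartes.relations {E : Fin 4 → Disk} (hE : IsDescartes E) : Relations E := by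
  have key := descartes_aux
    (Matrix.of fun i => ![(E i).curv, (E i).cen.re, (E i).cen.im, (E i).cocurv]) (by
      intro i j
      have : inversive (E i) (E j) = if i = j then 1 else -1 := by
        split_ifs with h
        · rw [h, inversive_self]
        · exact (hE i j h).1
      rw [← this]
      simp [inversive, dot])
  have k00 := key 0 0
  have k01 := key 0 1
  have k02 := key 0 2
  have k03 := key 0 3
  have k11 := key 1 1
  have k12 := key 1 2
  have k13 := key 1 3
  have k22 := key 2 2
  have k23 := key 2 3
  have k33 := key 3 3
  simp only [Matrix.of_apply, Matrix.cons_val, Matrix.cons_val_zero,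
    Matrix.cons_val_one] at k00 k01 k02 k03 k11 k12 k13 k22 k23 k33
  constructor <;> (try simp only [pow_two]) <;> linarith

/-- Expansion of a vector in a Descartes configuration. -/
theorem IsDescartes.expand {E : Fin 4 → Disk} (hE : IsDescartes E) (v : ℝ × ℂ × ℝ) :
    v = ∑ j, (mink v (E j).vec / 2 - (∑ k, mink v (E k).vec) / 4) • (E j).vec := by
  obtain ⟨bb, bx, yb, be, xx, xy, yy, xe, ye, ee⟩ := hE.relations
  obtain ⟨b, z, e⟩ := v
  simp only [Fin.sum_univ_four] at *
  have hz : ∀ w : ℂ, z = w ↔ z.re = w.re ∧ z.im = w.im := fun w => Complex.ext_iff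
  simp only [mink, dot, Disk.vec, Prod.ext_iff, Prod.fst_add, Prod.snd_add, Prod.smul_fst,
    Prod.smul_snd, smul_eq_mul, hz, Complex.add_re, Complex.add_im, Complex.smul_re,
    Complex.smul_im]
  refine ⟨?_, ⟨?_, ?_⟩, ?_⟩
  · linear_combination (-z.re / 4) * bx - z.im / 4 * yb + b / 8 * be + e / 8 * bb
  · linear_combination (-z.re / 4) * xx - z.im / 4 * xy + b / 8 * xe + e / 8 * bx
  · linear_combination (-z.re / 4) * xy - z.im / 4 * yy + b / 8 * ye + e / 8 * yb
  · linear_combination (-z.re / 4) * xe - z.im / 4 * ye + b / 8 * ee + e / 8 * be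

/-! ### Exchanging a disk -/

/-- `E'` is obtained from the Descartes configuration `E` by exchanging the `i`-th disk for the
other disk tangent to the remaining three. -/
def IsSwap (i : Fin 4) (E E' : Fin 4 → Disk) : Prop :=
  (∀ j, j ≠ i → E' j = E j) ∧ (E' i).vec = (2 : ℝ) • ∑ j, (E j).vec - (3 : ℝ) • (E i).vec

theorem sum_eq_add_of_ne {M : Type*} [AddCommMonoid M] {f g : Fin 4 → M} {i : Fin 4}
    (h : ∀ j, j ≠ i → f j = g j) : ∑ j, f j + g i = ∑ j, g j + f i := by
  rw [← Finset.add_sum_erase _ f (Finset.mem_univ i),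
    ← Finset.add_sum_erase _ g (Finset.mem_univ i),
    Finset.sum_congr rfl fun j hj => h j (Finset.ne_of_mem_erase hj)]
  abel

theorem IsSwap.symm {i : Fin 4} {E E' : Fin 4 → Disk} (h : IsSwap i E E') : IsSwap i E' E := by
  refine ⟨fun j hj => (h.1 j hj).symm, ?_⟩
  have hs := sum_eq_add_of_ne (f := fun j => (E' j).vec) (g := fun j => (E j).vec) (i := i)
    fun j hj => by rw [h.1 j hj]
  have hs' : ∑ j, (E' j).vec = ∑ j, (E j).vec + (E' i).vec - (E i).vec := by
    rw [← hs]; abel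
  rw [hs', h.2]
  module

theorem IsSwap.unique {i : Fin 4} {E E' E'' : Fin 4 → Disk} (h : IsSwap i E E')
    (h' : IsSwap i E E'') : E' = E'' := by
  funext j
  by_cases hj : j = i
  · subst hj
    exact Disk.vec_injective (h.2.trans h'.2.symm)
  · rw [h.1 j hj, h'.1 j hj]

theorem mink_swap {i : Fin 4} {E E' : Fin 4 → Disk} (h : IsSwap i E E') (v : ℝ × ℂ × ℝ) :
    mink v (E' i).vec = 2 * ∑ j, mink v (E j).vec - 3 * mink v (E i).vec := by
  rw [h.2, sub_eq_add_neg, ← neg_smul]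
  simp only [mink_add, mink_smul, Fin.sum_univ_four]
  ring

theorem IsDescartes.inversive_eq {E : Fin 4 → Disk} (hE : IsDescartes E) (i j : Fin 4) :
    inversive (E i) (E j) = if i = j then 1 else -1 := by
  split_ifs with h
  · rw [h, inversive_self]
  · exact (hE i j h).1

theorem IsDescartes.sum_inversive {E : Fin 4 → Disk} (hE : IsDescartes E) (i : Fin 4) :
    ∑ j, inversive (E i) (E j) = -2 := by
  simp only [hE.inversive_eq, Fin.sum_univ_four]
  fin_cases i <;> simp <;> norm_num

theorem mink_comm (v w : ℝ × ℂ × ℝ) : mink v w = mink w v := by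
  simp only [mink, dot]; ring

theorem IsSwap.curv {i : Fin 4} {E E' : Fin 4 → Disk} (h : IsSwap i E E') :
    (E' i).curv = 2 * ∑ j, (E j).curv - 3 * (E i).curv := by
  have := congrArg Prod.fst h.2
  simpa [Disk.vec, Prod.fst_sum] using this

/-- The sum of a row of the Gram matrix is -2, so the product is 2(-2) - 3 = -7. Being different
from 1, it later shows that the new disk differs from the old one. -/
theorem IsSwap.inversive_self {i : Fin 4} {E E' : Fin 4 → Disk} (hE : IsDescartes E)
    (h : IsSwap i E E') : inversive (E' i) (E i) = -7 := by
  rw [inversive_comm, inversive_eq_mink, mink_swap h]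
  have := hE.sum_inversive i
  simp only [inversive_eq_mink] at this
  rw [this, ← inversive_eq_mink, Apollonian.inversive_self]
  norm_num

theorem IsSwap.inversive_of_ne {i j : Fin 4} {E E' : Fin 4 → Disk} (hE : IsDescartes E)
    (h : IsSwap i E E') (hj : j ≠ i) : inversive (E j) (E' i) = -1 := by
  rw [inversive_eq_mink, mink_swap h]
  have := hE.sum_inversive j
  simp only [inversive_eq_mink] at this
  rw [this, ← inversive_eq_mink, (hE j i hj).1]
  norm_num

/-- Null vectors with negative product lie in the same light cone. -/
theorem null_orientation {b x y e b' x' y' e' : ℝ} (h : x ^ 2 + y ^ 2 = b * e)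
    (h' : x' ^ 2 + y' ^ 2 = b' * e') (hp : 0 < b + e)
    (hneg : x * x' + y * y' - (b * e' + b' * e) / 2 < 0) : 0 < b' + e' := by
  by_contra hc
  have hbe : 0 ≤ b * e := h ▸ by positivity
  have hbe' : 0 ≤ b' * e' := h' ▸ by positivity
  have hb : 0 ≤ b := by by_contra hb; nlinarith
  have he : 0 ≤ e := by by_contra he; nlinarith
  have hb' : b' ≤ 0 := by by_contra hb; nlinarith
  have he' : e' ≤ 0 := by by_contra he; nlinarith
  have h0 : 0 ≤ -((b * e' + b' * e) / 2) := by nlinarith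
  -- If the cones were opposite, Cauchy–Schwarz followed by the inequality of arithmetic and
  -- geometric means would make the product nonnegative.
  have hsq : (x * x' + y * y') ^ 2 ≤ (-((b * e' + b' * e) / 2)) ^ 2 := by
    have h1 : (x * x' + y * y') ^ 2 ≤ (x ^ 2 + y ^ 2) * (x' ^ 2 + y' ^ 2) := by
      nlinarith [sq_nonneg (x * y' - y * x')]
    rw [h, h'] at h1
    nlinarith [sq_nonneg (b * e' - b' * e)]
  linarith [(abs_le.mp (abs_le_of_sq_le_sq hsq h0)).1]

/-- Both d + e and d + e' are null vectors, with product 1 - 1 - 1 + ⟨e, e'⟩ < 0. They therefore lie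
in the same light cone, and the orientation condition passes from one to the other. -/
theorem tangent_of_inversive_lt {d e e' : Disk} (h : Tangent d e) (h' : inversive d e' = -1)
    (hlt : inversive e e' < 1) : Tangent d e' := by
  refine ⟨h', ?_⟩
  have hn := tangent_null h.1
  have hn' := tangent_null h'
  have hd := inversive_self d
  have h1 := h.1
  simp only [inversive, dot, Complex.sq_norm, Complex.normSq_apply, Complex.add_re,
    Complex.add_im] at hn hn' hlt h' hd h1
  have := null_orientation (b := d.curv + e.curv) (e := d.cocurv + e.cocurv)
    (b' := d.curv + e'.curv) (e' := d.cocurv + e'.cocurv) (x := d.cen.re + e.cen.re)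
    (y := d.cen.im + e.cen.im) (x' := d.cen.re + e'.cen.re) (y' := d.cen.im + e'.cen.im)
    (by linarith) (by linarith) (by linarith [h.2]) (by linarith)
  linarith

/-- Exchanging a disk yields a Descartes configuration. -/
theorem IsSwap.isDescartes {i : Fin 4} {E E' : Fin 4 → Disk} (hE : IsDescartes E)
    (h : IsSwap i E E') : IsDescartes E' := by
  have key : ∀ j, j ≠ i → Tangent (E j) (E' i) := fun j hj =>
    tangent_of_inversive_lt (hE j i hj) (h.inversive_of_ne hE hj)
      (by rw [inversive_comm, h.inversive_self hE]; norm_num)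
  intro j k hjk
  by_cases hj : j = i
  · subst hj
    rw [h.1 k hjk.symm]
    exact (key k hjk.symm).symm
  · rw [h.1 j hj]
    by_cases hk : k = i
    · subst hk
      exact key j hjk
    · rw [h.1 k hk]
      exact hE j k hjk


/-- Any unit vector is a disk, so it suffices to compute the norm of 2Σ - 3Eᵢ from the Gram matrix.
-/
theorem IsDescartes.exists_swap {E : Fin 4 → Disk} (hE : IsDescartes E) (i : Fin 4) :
    ∃ E', IsSwap i E E' := by
  set v : ℝ × ℂ × ℝ := (2 : ℝ) • ∑ j, (E j).vec - (3 : ℝ) • (E i).vec with hv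
  have hm : ∀ w, mink w v = 2 * ∑ j, mink w (E j).vec - 3 * mink w (E i).vec := by
    intro w
    rw [hv, sub_eq_add_neg, ← neg_smul]
    simp only [mink_add, mink_smul, Fin.sum_univ_four]
    ring
  have hmj : ∀ j, mink v (E j).vec = -4 - 3 * inversive (E i) (E j) := by
    intro j
    have := hE.sum_inversive j
    simp only [inversive_eq_mink] at this
    rw [mink_comm, hm, this, inversive_comm (E i), inversive_eq_mink]
    norm_num
  have hvv : mink v v = 1 := by
    rw [hm]
    simp only [hmj]
    rw [Finset.sum_sub_distrib, ← Finset.mul_sum, hE.sum_inversive, Apollonian.inversive_self]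
    norm_num
  have hn : ‖v.2.1‖ ^ 2 - v.1 * v.2.2 = 1 := by
    rw [← hvv, Complex.sq_norm, Complex.normSq_apply]
    simp only [mink, dot]
    ring
  refine ⟨Function.update E i ⟨v.1, v.2.1, v.2.2, hn⟩, fun j hj => Function.update_of_ne hj _ _, ?_⟩
  rw [Function.update_self]
  rfl

/-- Three mutually tangent disks are tangent to exactly two further disks. -/
theorem IsDescartes.eq_or_isSwap {E E' : Fin 4 → Disk} {i : Fin 4} (hE : IsDescartes E)
    (hE' : IsDescartes E') (h : ∀ j, j ≠ i → E' j = E j) : E' = E ∨ IsSwap i E E' := by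
  -- The product with the old disk is the only unknown: the expansion in the basis E expresses the
  -- new disk through it, and the unit norm becomes (t - 1)(t + 7) = 0.
  set t := mink (E' i).vec (E i).vec with ht
  have hj : ∀ j, mink (E' i).vec (E j).vec = -1 + if j = i then t + 1 else 0 := by
    intro j
    split_ifs with hji
    · rw [hji]; ring
    · rw [← h j hji, ← inversive_eq_mink, (hE' i j (Ne.symm hji)).1]; ring
  have hsum : ∑ j, mink (E' i).vec (E j).vec = t - 3 := by
    simp only [hj, Finset.sum_add_distrib, Finset.sum_ite_eq', Finset.mem_univ, if_true]
    simp; ring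
  have hexp := hE.expand (E' i).vec
  have hexp' : (E' i).vec =
      ((1 - t) / 4) • ∑ j, (E j).vec + ((t + 1) / 2) • (E i).vec := by
    rw [hexp, hsum]
    simp only [hj]
    have : ∀ j, ((-1 + if j = i then t + 1 else 0) / 2 - (t - 3) / 4) • (E j).vec =
        ((1 - t) / 4) • (E j).vec + if j = i then ((t + 1) / 2) • (E j).vec else 0 := by
      intro j
      split_ifs <;> module
    simp only [this, Finset.sum_add_distrib, Finset.sum_ite_eq', Finset.mem_univ, if_true,
      Finset.smul_sum]
  have hnorm : 1 = (1 - t) / 4 * (t - 3) + (t + 1) / 2 * t := by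
    have h1 := Apollonian.inversive_self (E' i)
    rw [inversive_eq_mink] at h1
    have h2 : mink (E' i).vec (((1 - t) / 4) • ∑ j, (E j).vec + ((t + 1) / 2) • (E i).vec) =
        (1 - t) / 4 * (t - 3) + (t + 1) / 2 * t := by
      rw [mink_add, mink_smul, mink_smul, ← hsum, ← ht]
      simp only [Fin.sum_univ_four, mink_add]
    rw [← hexp', h1] at h2
    exact h2
  have ht : (t - 1) * (t + 7) = 0 := by linarith
  rcases mul_eq_zero.mp ht with h1 | h1
  · left
    have ht1 : t = 1 := by linarith
    funext j
    by_cases hji : j = i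
    · subst hji
      apply Disk.vec_injective
      rw [hexp', ht1]
      module
    · exact h j hji
  · right
    have ht1 : t = -7 := by linarith
    refine ⟨h, ?_⟩
    rw [hexp', ht1]
    module

/-! ### Words of exchanges and completions -/

/-- Configurations obtained from `D` by exchanges without immediate repetitions; `o` records the
last disk that was exchanged. -/
inductive Reduced (D : Fin 4 → Disk) : Option (Fin 4) → (Fin 4 → Disk) → Prop
  | base : Reduced D none D
  | step (o : Option (Fin 4)) (i : Fin 4) (E E' : Fin 4 → Disk) (h : Reduced D o E)
      (hi : o ≠ some i) (hs : IsSwap i E E') : Reduced D (some i) E'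

theorem Reach.isDescartes {D E : Fin 4 → Disk} (hD : IsDescartes D) (h : Reach D E) :
    IsDescartes E := by
  cases h
  · exact hD
  · assumption

theorem Reduced.isDescartes {D E : Fin 4 → Disk} {o : Option (Fin 4)} (hD : IsDescartes D)
    (h : Reduced D o E) : IsDescartes E := by
  induction h with
  | base => exact hD
  | step o _ E E' h hi hs ih => exact hs.isDescartes ih

theorem Reach.swap {D E E' : Fin 4 → Disk} {i : Fin 4} (hD : IsDescartes D) (h : Reach D E)
    (hs : IsSwap i E E') : Reach D E' :=
  .step E E' i h (hs.isDescartes (h.isDescartes hD)) hs.1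

/-- An exchange repeating the last one cancels it, since exchanges are involutions; any other one
prolongs the word. -/
theorem Reduced.swap {D E E' : Fin 4 → Disk} {o : Option (Fin 4)} {i : Fin 4}
    (h : Reduced D o E) (hs : IsSwap i E E') : ∃ o', Reduced D o' E' := by
  by_cases hi : o = some i
  · cases h with
    | base => cases hi
    | step o' j E₀ _ h' hj hs' =>
      obtain rfl : j = i := Option.some.inj hi
      exact ⟨o', hs'.symm.unique hs ▸ h'⟩
  · exact ⟨some i, .step o i E E' h hi hs⟩

/-- Allows inductions over a packing to assume that no exchange undoes its predecessor, which the
growth arguments require. -/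
theorem Reach.reduced {D E : Fin 4 → Disk} (hD : IsDescartes D) (h : Reach D E) :
    ∃ o, Reduced D o E := by
  induction h with
  | base => exact ⟨none, .base⟩
  | step E E' i hE hE' heq ih =>
    obtain ⟨o, ho⟩ := ih
    rcases (ho.isDescartes hD).eq_or_isSwap hE' heq with rfl | hs
    · exact ⟨o, ho⟩
    · exact ho.swap hs

theorem Reach.trans {D E F : Fin 4 → Disk} (h : Reach D E) (h' : Reach E F) : Reach D F := by
  induction h' with
  | base => exact h
  | step F F' i _ hF' heq ih => exact .step F F' i ih hF' heq

theorem Reach.symm {D E : Fin 4 → Disk} (hD : IsDescartes D) (h : Reach D E) : Reach E D := by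
  induction h with
  | base => exact .base
  | step E E' i hE _ heq ih =>
    exact Reach.trans (.step E' E i .base (hE.isDescartes hD) fun j hj => (heq j hj).symm) ih

theorem packing_eq_of_reach {D E : Fin 4 → Disk} (hD : IsDescartes D) (h : Reach D E) :
    packing E = packing D := by
  ext d
  exact ⟨fun ⟨F, hF, hi⟩ => ⟨F, h.trans hF, hi⟩, fun ⟨F, hF, hi⟩ => ⟨F, (h.symm hD).trans hF, hi⟩⟩

theorem packing_swap {E E' : Fin 4 → Disk} {i : Fin 4} (hE : IsDescartes E)
    (hs : IsSwap i E E') : packing E' = packing E :=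
  packing_eq_of_reach hE (Reach.base.swap hE hs)

theorem IsDescartes.perm {E : Fin 4 → Disk} (hE : IsDescartes E) (σ : Equiv.Perm (Fin 4)) :
    IsDescartes (E ∘ σ) :=
  fun _ _ hij => hE _ _ fun h => hij (σ.injective h)

theorem Reach.perm {D E : Fin 4 → Disk} (h : Reach D E) (σ : Equiv.Perm (Fin 4)) :
    Reach (D ∘ σ) (E ∘ σ) := by
  induction h with
  | base => exact .base
  | step E E' i hE hE' heq ih =>
    exact .step (E ∘ σ) (E' ∘ σ) (σ.symm i) ih (hE'.perm σ) fun j hj =>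
      heq (σ j) fun h => hj (by rw [← h, σ.symm_apply_apply])

theorem packing_perm (D : Fin 4 → Disk) (σ : Equiv.Perm (Fin 4)) :
    packing (D ∘ σ) = packing D := by
  have key : ∀ (D : Fin 4 → Disk) (σ : Equiv.Perm (Fin 4)), packing D ⊆ packing (D ∘ σ) := by
    rintro D σ d ⟨E, hE, i, rfl⟩
    exact ⟨E ∘ σ, hE.perm σ, σ.symm i, by simp⟩
  refine Set.Subset.antisymm ?_ (key D σ)
  have := key (D ∘ σ) σ.symm
  rwa [Function.comp_assoc, Equiv.self_comp_symm, Function.comp_id] at this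

theorem mem_packing (D : Fin 4 → Disk) (i : Fin 4) : D i ∈ packing D := ⟨D, .base, i, rfl⟩

/-! ### Growth of curvatures and root configurations -/

theorem exists_three (i j : Fin 4) (hj : j ≠ i) :
    ∃ k l : Fin 4, k ≠ i ∧ l ≠ i ∧ k ≠ j ∧ l ≠ j ∧ k ≠ l ∧
      ∀ f : Fin 4 → ℝ, ∑ m, f m = f i + f j + f k + f l := by
  have : ∃ k l : Fin 4, k ≠ i ∧ l ≠ i ∧ k ≠ j ∧ l ≠ j ∧ k ≠ l ∧
      (Finset.univ : Finset (Fin 4)) = {i, j, k, l} := by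
    revert i j; decide
  obtain ⟨k, l, h1, h2, h3, h4, h5, h6⟩ := this
  refine ⟨k, l, h1, h2, h3, h4, h5, fun f => ?_⟩
  rw [h6, Finset.sum_insert, Finset.sum_insert, Finset.sum_insert, Finset.sum_singleton]
  · ring
  all_goals simp [*, Ne.symm, hj.symm, h1.symm, h2.symm, h3.symm, h4.symm]

/-- No exchange decreases the curvatures. -/
def IsRoot (E : Fin 4 → Disk) : Prop := ∀ i, 2 * (E i).curv ≤ ∑ j, (E j).curv

/-- The disk k exchanged last has the largest curvature. Exchanging i ≠ k next gives curvature bₖ +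
(bₖ - bᵢ) + 2(bₗ + bₘ) ≥ bₖ, because bₗ + bₘ ≥ 0 for tangent disks. The root condition is needed
only for the first exchange, where 2Σ - 3bᵢ ≥ Σ/2. -/
theorem IsRoot.growth {D E : Fin 4 → Disk} {o : Option (Fin 4)} (hD : IsDescartes D)
    (hr : IsRoot D) (h : Reduced D o E) :
    (∀ i, o = some i → ∀ j, (E j).curv ≤ (E i).curv ∧ (D j).curv ≤ (E i).curv) ∧
      ∀ j, E j ∈ Set.range D ∨ ∀ k, (D k).curv ≤ (E j).curv := by
  induction h with
  | base => exact ⟨fun i hi => (by cases hi), fun j => Or.inl ⟨j, rfl⟩⟩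
  | step o i E E' h hi hs ih =>
    have hE := h.isDescartes hD
    have hc := hs.curv
    have main : ∀ j, (E j).curv ≤ (E' i).curv ∧ (D j).curv ≤ (E' i).curv := by
      rcases o with _ | k
      · cases h
        intro j
        have h1 := hr i
        have h2 := hr j
        constructor <;> linarith
      · have hik : i ≠ k := fun hik => hi (by rw [hik])
        obtain ⟨l, m, hl, hm, hl', hm', hlm, hsum⟩ := exists_three k i hik
        rw [hsum] at hc
        have hlm' := (hE l m hlm).curv_add_nonneg
        intro j
        have h1 := ih.1 k rfl
        have h2 := (h1 i).1
        have h3 := h1 j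
        constructor <;> linarith
    refine ⟨?_, ?_⟩
    · rintro i' hi' j
      obtain rfl : i = i' := Option.some.inj hi'
      refine ⟨?_, (main j).2⟩
      by_cases hj : j = i
      · rw [hj]
      · rw [hs.1 j hj]; exact (main j).1
    · intro j
      by_cases hj : j = i
      · rw [hj]; exact Or.inr fun k => (main k).2
      · rw [hs.1 j hj]; exact ih.2 j

/-- A configuration in which no exchange decreases the curvatures is maximal. -/
theorem IsRoot.isMaximal {D : Fin 4 → Disk} (hD : IsDescartes D) (hr : IsRoot D) :
    IsMaximal D := by
  rintro d ⟨E, hE, j, rfl⟩ hd i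
  obtain ⟨o, ho⟩ := hE.reduced hD
  exact ((hr.growth hD ho).2 j).resolve_left hd i

/-- A disk obtained by one exchange has inversive products -7 and -1 with the disks of D, never 1,
so it is a further disk and maximality applies to it. -/
theorem IsMaximal.isRoot {D : Fin 4 → Disk} (hD : IsDescartes D) (hm : IsMaximal D) :
    IsRoot D := by
  intro i
  obtain ⟨E, hs⟩ := hD.exists_swap i
  have hmem : E i ∈ packing D := packing_swap hD hs ▸ mem_packing E i
  have hnot : E i ∉ Set.range D := by
    rintro ⟨j, hj⟩
    by_cases hji : j = i
    · have := hs.inversive_self hD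
      rw [← hj, hji, inversive_self] at this
      norm_num at this
    · have := hs.inversive_of_ne hD hji
      rw [← hj, inversive_self] at this
      norm_num at this
  have := hm _ hmem hnot i
  linarith [hs.curv]

/-- Tangency gives Σ ≥ 0. If Σ = 0, Descartes' relation makes all curvatures vanish, which
contradicts the term -8 in the mixed relation `be`. -/
theorem IsDescartes.exists_pos {D : Fin 4 → Disk} (hD : IsDescartes D) : 0 < ∑ i, (D i).curv := by
  have h01 := (hD 0 1 (by decide)).curv_add_nonneg
  have h23 := (hD 2 3 (by decide)).curv_add_nonneg
  have h02 := (hD 0 2 (by decide)).curv_add_nonneg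
  have hbb := hD.relations.bb
  have hbe := hD.relations.be
  simp only [Fin.sum_univ_four] at *
  rcases (show 0 ≤ (D 0).curv + (D 1).curv + (D 2).curv + (D 3).curv by linarith).lt_or_eq
    with h | h
  · exact h
  · exfalso
    rw [← h] at hbb
    have h0 : ∀ i, (D i).curv = 0 := by
      intro i
      fin_cases i <;> simp <;> nlinarith
    simp only [h0] at hbe
    norm_num at hbe

/-- A configuration in which no exchange decreases the curvatures contains a major disk. -/
theorem IsRoot.exists_nonpos {D : Fin 4 → Disk} (hD : IsDescartes D) (hr : IsRoot D) :
    ∃ i, (D i).curv ≤ 0 := by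
  by_contra! hc
  have hbb := hD.relations.bb
  have h0 := hr 0
  have h1 := hr 1
  have h2 := hr 2
  have h3 := hr 3
  have p0 := hc 0
  have p1 := hc 1
  have p2 := hc 2
  have p3 := hc 3
  simp only [Fin.sum_univ_four] at *
  generalize (D 0).curv = a, (D 1).curv = b, (D 2).curv = c, (D 3).curv = d at *
  set S := a + b + c + d
  have e0 : 0 ≤ a * (S - 2 * a) := mul_nonneg p0.le (by linarith)
  have e1 : 0 ≤ b * (S - 2 * b) := mul_nonneg p1.le (by linarith)
  have e2 : 0 ≤ c * (S - 2 * c) := mul_nonneg p2.le (by linarith)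
  have e3 : 0 ≤ d * (S - 2 * d) := mul_nonneg p3.le (by linarith)
  -- This is Descartes' relation. With nonnegative summands, all four curvatures would equal S/2, so
  -- 2S = S.
  have hS : a * (S - 2 * a) + b * (S - 2 * b) + c * (S - 2 * c) + d * (S - 2 * d) = 0 := by
    linear_combination -hbb
  have f0 : S - 2 * a = 0 := (mul_eq_zero.mp (by linarith)).resolve_left p0.ne'
  have f1 : S - 2 * b = 0 := (mul_eq_zero.mp (by linarith)).resolve_left p1.ne'
  have f2 : S - 2 * c = 0 := (mul_eq_zero.mp (by linarith)).resolve_left p2.ne'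
  have f3 : S - 2 * d = 0 := (mul_eq_zero.mp (by linarith)).resolve_left p3.ne'
  linarith

/-- A family of configurations with integral curvatures that is closed under exchanging the disks
with index in `I` contains one where none of these exchanges decreases the curvatures. -/
theorem exists_minimal (I : Set (Fin 4)) (C : (Fin 4 → Disk) → Prop) (D : Fin 4 → Disk) (hD : C D)
    (hdes : ∀ E, C E → IsDescartes E) (hint : ∀ E, C E → ∀ i, ∃ k : ℤ, (E i).curv = k)
    (hswap : ∀ E E', ∀ i ∈ I, C E → IsSwap i E E' → C E') :
    ∃ E, C E ∧ ∀ i ∈ I, 2 * (E i).curv ≤ ∑ j, (E j).curv := by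
  have hnat : ∀ E, C E → ∃ n : ℕ, ∑ j, (E j).curv = n := by
    intro E hE
    choose k hk using hint E hE
    have hpos := (hdes E hE).exists_pos
    have hs : ∑ j, (E j).curv = ((∑ j, k j : ℤ) : ℝ) := by push_cast; simp only [hk]
    rw [hs] at hpos ⊢
    refine ⟨(∑ j, k j).toNat, ?_⟩
    have : 0 ≤ ∑ j, k j := by exact_mod_cast hpos.le
    rw [← Int.cast_natCast, Int.toNat_of_nonneg this]
  -- The curvature sum is a positive integer; a configuration of the family minimizing it is the one
  -- sought.
  have hex : ∃ n : ℕ, ∃ E, C E ∧ ∑ j, (E j).curv = n := by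
    obtain ⟨n, hn⟩ := hnat D hD
    exact ⟨n, D, hD, hn⟩
  classical
  obtain ⟨E, hE, hn⟩ := Nat.find_spec hex
  refine ⟨E, hE, fun i hi => ?_⟩
  obtain ⟨E', hs⟩ := (hdes E hE).exists_swap i
  have hE' := hswap E E' i hi hE hs
  obtain ⟨n', hn'⟩ := hnat E' hE'
  have hle : ∑ j, (E j).curv ≤ ∑ j, (E' j).curv := by
    rw [hn, hn']
    exact_mod_cast Nat.find_min' hex ⟨E', hE', hn'⟩
  have hsum := sum_eq_add_of_ne (f := fun j => (E' j).curv) (g := fun j => (E j).curv) (i := i)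
    fun j hj => by rw [hs.1 j hj]
  have := hs.curv
  linarith

/-! ### Spinors -/

theorem exists_spinor (d e : Disk) : ∃ u, IsSpinor d e u :=
  IsAlgClosed.exists_pow_nat_eq _ two_pos

theorem IsSpinor.neg {d e : Disk} {u : ℂ} (h : IsSpinor d e u) : IsSpinor d e (-u) := by
  rw [IsSpinor, neg_sq]; exact h

theorem IsSpinor.eq_or_eq_neg {d e : Disk} {u v : ℂ} (h : IsSpinor d e u) (h' : IsSpinor d e v) :
    u = v ∨ u = -v := sq_eq_sq_iff_eq_or_eq_neg.mp (h.trans h'.symm)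

theorem IsSpinor.re_im {d e : Disk} {u : ℂ} (h : IsSpinor d e u) :
    u.re ^ 2 - u.im ^ 2 = d.curv * e.cen.re - e.curv * d.cen.re ∧
      2 * (u.re * u.im) = d.curv * e.cen.im - e.curv * d.cen.im := by
  have h1 := congrArg Complex.re h
  have h2 := congrArg Complex.im h
  simp only [pow_two, Complex.mul_re, Complex.mul_im, Complex.sub_re, Complex.sub_im,
    Complex.ofReal_re, Complex.ofReal_im, zero_mul, sub_zero, add_zero] at h1 h2
  constructor <;> linarith

theorem norm_sq_eq (u : ℂ) : ‖u‖ ^ 2 = u.re ^ 2 + u.im ^ 2 := by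
  rw [Complex.sq_norm, Complex.normSq_apply]; ring

/-- The norm of a spinor is the sum of the curvatures. -/
theorem IsSpinor.norm_sq {d e : Disk} {u : ℂ} (h : IsSpinor d e u) (ht : Tangent d e) :
    ‖u‖ ^ 2 = d.curv + e.curv := by
  have hd := d.norm_eq
  have he := e.norm_eq
  have hi := ht.1
  obtain ⟨h1, h2⟩ := h.re_im
  rw [← sq_eq_sq₀ (by positivity) ht.curv_add_nonneg]
  rw [norm_sq_eq] at *
  simp only [inversive, dot] at hi
  have : (u.re ^ 2 + u.im ^ 2) ^ 2 = (u.re ^ 2 - u.im ^ 2) ^ 2 + (2 * (u.re * u.im)) ^ 2 := by ring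
  rw [this, h1, h2]
  linear_combination d.curv ^ 2 * he + e.curv ^ 2 * hd - 2 * d.curv * e.curv * hi

/-- The symplectic product of the spinors to two tangent disks is the curvature up to sign. -/
theorem cross_sq_spinor {d e e' : Disk} {a b : ℂ} (h : IsSpinor d e a) (h' : IsSpinor d e' b)
    (ht : Tangent d e) (ht' : Tangent d e') (hee : Tangent e e') : cross a b ^ 2 = d.curv ^ 2 := by
  have hd := d.norm_eq
  have na := h.norm_sq ht
  have nb := h'.norm_sq ht'
  obtain ⟨h1, h2⟩ := h.re_im
  obtain ⟨h3, h4⟩ := h'.re_im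
  have i1 := ht.1
  have i2 := ht'.1
  have i3 := hee.1
  rw [norm_sq_eq] at *
  simp only [inversive, dot, cross] at *
  -- The identity 2(a × b)² = |a|²|b|² - Re(a² b̄²) involves the spinors only through norms and
  -- squares, which the disks determine.
  have key : 2 * (a.re * b.im - a.im * b.re) ^ 2 =
      (a.re ^ 2 + a.im ^ 2) * (b.re ^ 2 + b.im ^ 2) -
        ((a.re ^ 2 - a.im ^ 2) * (b.re ^ 2 - b.im ^ 2) +
          2 * (a.re * a.im) * (2 * (b.re * b.im))) := by ring
  rw [na, nb, h1, h2, h3, h4] at key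
  have : 2 * (a.re * b.im - a.im * b.re) ^ 2 = 2 * d.curv ^ 2 := by
    rw [key]
    linear_combination (-d.curv ^ 2) * i3 + d.curv * e'.curv * i1 + d.curv * e.curv * i2
      - e.curv * e'.curv * hd
  linarith

theorem dot_self (a : ℂ) : dot a a = ‖a‖ ^ 2 := by
  rw [norm_sq_eq, dot]; ring

theorem norm_sq_sub (a b : ℂ) : ‖a - b‖ ^ 2 = ‖a‖ ^ 2 + ‖b‖ ^ 2 - 2 * dot a b := by
  simp only [norm_sq_eq, dot, Complex.sub_re, Complex.sub_im]; ring

theorem norm_sq_add (a b : ℂ) : ‖a + b‖ ^ 2 = ‖a‖ ^ 2 + ‖b‖ ^ 2 + 2 * dot a b := by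
  simp only [norm_sq_eq, dot, Complex.add_re, Complex.add_im]; ring

theorem cross_sq_add_dot_sq (a b : ℂ) : cross a b ^ 2 + dot a b ^ 2 = ‖a‖ ^ 2 * ‖b‖ ^ 2 := by
  simp only [norm_sq_eq, cross, dot]; ring

/-- `a`, `b` and `a - b` are spinors from the first disk of `E` to the others. -/
structure IsSpinorTriple (E : Fin 4 → Disk) (a b : ℂ) : Prop where
  one : IsSpinor (E 0) (E 1) a
  two : IsSpinor (E 0) (E 2) b
  three : IsSpinor (E 0) (E 3) (a - b)

/-- Curvatures and complex reduced centres are both isotropic for 2Σvᵢ² - (Σvᵢ)², and orthogonal to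
each other. Hence their combination with entries b₀zᵢ - bᵢz₀, the squared spinors with first entry
0, is isotropic too. The relation factors as (c² - (a-b)²)(c² - (a+b)²) = 0, and the sign of b is
chosen accordingly. -/
theorem IsDescartes.exists_spinorTriple {E : Fin 4 → Disk} (hE : IsDescartes E) :
    ∃ a b, IsSpinorTriple E a b := by
  obtain ⟨a, ha⟩ := exists_spinor (E 0) (E 1)
  obtain ⟨b, hb⟩ := exists_spinor (E 0) (E 2)
  obtain ⟨c, hc⟩ := exists_spinor (E 0) (E 3)
  obtain ⟨bb, bx, yb, -, xx, xy, yy, -, -, -⟩ := hE.relations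
  have key : (c ^ 2 - (a - b) ^ 2) * (c ^ 2 - (a + b) ^ 2) = 0 := by
    have h : 2 * (a ^ 2 * a ^ 2 + b ^ 2 * b ^ 2 + c ^ 2 * c ^ 2) = (a ^ 2 + b ^ 2 + c ^ 2) ^ 2 := by
      unfold IsSpinor at ha hb hc
      rw [ha, hb, hc]
      simp only [Fin.sum_univ_four] at bb bx yb xx xy yy
      apply Complex.ext
      · simp only [pow_two, Complex.mul_re, Complex.mul_im, Complex.sub_re, Complex.sub_im,
          Complex.add_re, Complex.add_im, Complex.ofReal_re, Complex.ofReal_im, Complex.re_ofNat,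
          Complex.im_ofNat]
        linear_combination (E 0).curv ^ 2 * (xx - yy) - 2 * (E 0).curv * (E 0).cen.re * bx
          + 2 * (E 0).curv * (E 0).cen.im * yb
          + ((E 0).cen.re ^ 2 - (E 0).cen.im ^ 2) * bb
      · simp only [pow_two, Complex.mul_re, Complex.mul_im, Complex.sub_re, Complex.sub_im,
          Complex.add_re, Complex.add_im, Complex.ofReal_re, Complex.ofReal_im, Complex.re_ofNat,
          Complex.im_ofNat]
        linear_combination 2 * (E 0).curv ^ 2 * xy - 2 * (E 0).curv * (E 0).cen.im * bx
          - 2 * (E 0).curv * (E 0).cen.re * yb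
          + 2 * (E 0).cen.re * (E 0).cen.im * bb
    linear_combination h
  rcases mul_eq_zero.mp key with h | h
  · exact ⟨a, b, ha, hb, (sub_eq_zero.mp h).symm.trans hc⟩
  · refine ⟨a, -b, ha, hb.neg, ?_⟩
    rw [sub_neg_eq_add]
    exact (sub_eq_zero.mp h).symm.trans hc

/-! ### The corona of a disk -/

/-- The sum of the first disk of `E` and the disk of its corona with spinor coordinates `s`. -/
noncomputable def cone (E : Fin 4 → Disk) (s : ℤ × ℤ) : ℝ × ℂ × ℝ :=
  (s.1 ^ 2 : ℝ) • ((E 1).vec + (E 0).vec) + (s.2 ^ 2 : ℝ) • ((E 2).vec + (E 0).vec) +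
    (s.1 * s.2 : ℝ) • ((E 1).vec + (E 2).vec - (E 3).vec + (E 0).vec)

theorem cone_neg (E : Fin 4 → Disk) (s : ℤ × ℤ) : cone E (-s) = cone E s := by
  simp only [cone, Prod.fst_neg, Prod.snd_neg]
  push_cast
  module

/-- The law of a quadratic map. With F₀ fixed, the exchange formula 2Σ - 3Fᵢ, rewritten for the sums
Fⱼ + F₀, is exactly this identity. -/
theorem cone_parallelogram (E : Fin 4 → Disk) (s t : ℤ × ℤ) :
    cone E (s + t) + cone E (s - t) = (2 : ℝ) • cone E s + (2 : ℝ) • cone E t := by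
  simp only [cone, Prod.fst_add, Prod.snd_add, Prod.fst_sub, Prod.snd_sub]
  push_cast
  module

/-- `F` consists of the first disk of `E` and three disks of its corona, with spinor coordinates
`s`, `t` and `s - t`. -/
structure IsFan (E F : Fin 4 → Disk) (s t : ℤ × ℤ) : Prop where
  zero : F 0 = E 0
  one : (F 1).vec + (E 0).vec = cone E s
  two : (F 2).vec + (E 0).vec = cone E t
  three : (F 3).vec + (E 0).vec = cone E (s - t)

/-- The determinant of a pair of integral vectors. -/
def det (s t : ℤ × ℤ) : ℤ := s.1 * t.2 - s.2 * t.1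

theorem isFan_self (E : Fin 4 → Disk) : IsFan E E (1, 0) (0, 1) := by
  refine ⟨rfl, ?_, ?_, ?_⟩ <;> simp [cone]
  module

theorem IsFan.swap {E F F' : Fin 4 → Disk} {s t : ℤ × ℤ} {i : Fin 4} (h : IsFan E F s t)
    (hi : i ≠ 0) (hs : IsSwap i F F') : ∃ s' t', det s' t' ^ 2 = det s t ^ 2 ∧ IsFan E F' s' t' := by
  obtain ⟨h0, h1, h2, h3⟩ := h
  obtain ⟨hj, hv⟩ := hs
  rw [Fin.sum_univ_four, h0] at hv
  have e1 := eq_sub_of_add_eq h1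
  have e2 := eq_sub_of_add_eq h2
  have e3 := eq_sub_of_add_eq h3
  have h0' : F' 0 = E 0 := (hj 0 hi.symm).trans h0
  have hcases : ∀ i : Fin 4, i ≠ 0 → i = 1 ∨ i = 2 ∨ i = 3 := by decide
  obtain rfl | rfl | rfl := hcases i hi
  · refine ⟨t - (s - t), t, ?_, h0', ?_, ?_, ?_⟩
    · simp only [det, Prod.fst_sub, Prod.snd_sub]; ring
    · have hp := cone_parallelogram E t (s - t)
      rw [add_sub_cancel] at hp
      rw [hv, e1, e2, e3, eq_sub_of_add_eq' hp]
      module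
    · rw [hj 2 (by decide), h2]
    · rw [hj 3 (by decide), h3, ← cone_neg]
      congr 1; abel
  · refine ⟨s, s + (s - t), ?_, h0', ?_, ?_, ?_⟩
    · simp only [det, Prod.fst_sub, Prod.snd_sub, Prod.fst_add, Prod.snd_add]; ring
    · rw [hj 1 (by decide), h1]
    · have hp := cone_parallelogram E s (s - t)
      rw [sub_sub_cancel] at hp
      rw [hv, e1, e2, e3, eq_sub_of_add_eq hp]
      module
    · rw [hj 3 (by decide), h3, ← cone_neg]
      congr 1; abel
  · refine ⟨s, -t, ?_, h0', ?_, ?_, ?_⟩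
    · simp only [det, Prod.fst_neg, Prod.snd_neg]; ring
    · rw [hj 1 (by decide), h1]
    · rw [hj 2 (by decide), h2, cone_neg]
    · have hp := cone_parallelogram E s t
      rw [hv, e1, e2, e3, sub_neg_eq_add, eq_sub_of_add_eq hp]
      module

/-- While E₀ is kept, the configuration remains a fan. Exchanging E₀ produces a disk whose product
with E₀ is -7; thereafter the growth argument applies to the inversive products with E₀, with signs
reversed, so all later new disks have product below -1 and are not tangent to E₀. -/
theorem corona_aux {E F : Fin 4 → Disk} {o : Option (Fin 4)} (hE : IsDescartes E)
    (h : Reduced E o F) :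
    ((∃ s t, det s t ^ 2 = 1 ∧ IsFan E F s t) ∨
      ∃ i, o = some i ∧ (∀ j, inversive (E 0) (F i) ≤ inversive (E 0) (F j) ∧
        inversive (E 0) (F j) ≤ -1) ∧ inversive (E 0) (F i) < -1) ∧
    ∀ j, F j = E 0 ∨ (∃ s t, det s t ^ 2 = 1 ∧ (F j).vec + (E 0).vec = cone E s) ∨
      inversive (E 0) (F j) < -1 := by
  have fan : ∀ {F : Fin 4 → Disk} {s t : ℤ × ℤ}, det s t ^ 2 = 1 → IsFan E F s t →
      ∀ j, F j = E 0 ∨ (∃ s t, det s t ^ 2 = 1 ∧ (F j).vec + (E 0).vec = cone E s) ∨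
        inversive (E 0) (F j) < -1 := by
    intro F s t hdet hF j
    obtain rfl | rfl | rfl | rfl : j = 0 ∨ j = 1 ∨ j = 2 ∨ j = 3 := by revert j; decide
    · exact Or.inl hF.zero
    · exact Or.inr (Or.inl ⟨s, t, hdet, hF.one⟩)
    · refine Or.inr (Or.inl ⟨t, s, ?_, hF.two⟩)
      rw [← hdet, det, det]; ring
    · refine Or.inr (Or.inl ⟨s - t, t, ?_, hF.three⟩)
      rw [← hdet, det, det, Prod.fst_sub, Prod.snd_sub]; ring
  induction h with
  | base => exact ⟨Or.inl ⟨_, _, by simp [det], isFan_self E⟩, fan (by simp [det]) (isFan_self E)⟩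
  | step o i F F' h hi hs ih =>
    have hF := h.isDescartes hE
    have hv := mink_swap hs (E 0).vec
    simp only [← inversive_eq_mink] at hv
    have grow : ∀ k, (∀ j, inversive (E 0) (F' i) ≤ inversive (E 0) (F j)) →
        (∀ j, j ≠ i → inversive (E 0) (F j) ≤ -1) → inversive (E 0) (F' i) < -1 →
        (∃ i', some i = some i' ∧ (∀ j, inversive (E 0) (F' i') ≤ inversive (E 0) (F' j) ∧
          inversive (E 0) (F' j) ≤ -1) ∧ inversive (E 0) (F' i') < -1) ∧
        (F k = E 0 ∨ (∃ s t, det s t ^ 2 = 1 ∧ (F k).vec + (E 0).vec = cone E s) ∨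
          inversive (E 0) (F k) < -1 →
        F' k = E 0 ∨ (∃ s t, det s t ^ 2 = 1 ∧ (F' k).vec + (E 0).vec = cone E s) ∨
          inversive (E 0) (F' k) < -1) := by
      intro k h1 h2 h3
      refine ⟨⟨i, rfl, fun j => ?_, h3⟩, fun hk => ?_⟩
      · by_cases hj : j = i
        · rw [hj]; exact ⟨le_rfl, h3.le⟩
        · rw [hs.1 j hj]; exact ⟨h1 j, h2 j hj⟩
      · by_cases hk' : k = i
        · rw [hk']; exact Or.inr (Or.inr h3)
        · rw [hs.1 k hk']; exact hk
    rcases ih.1 with ⟨s, t, hdet, hfan⟩ | ⟨k, rfl, hk, hlt⟩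
    · by_cases hi0 : i = 0
      · subst hi0
        have hval : ∀ j, inversive (E 0) (F j) = if 0 = j then 1 else -1 := by
          intro j
          rw [← hfan.zero]
          exact hF.inversive_eq 0 j
        have h7 : inversive (E 0) (F' 0) = -7 := by
          rw [hv]
          simp [hval, Fin.sum_univ_four]
          norm_num
        have h1 : ∀ j, inversive (E 0) (F' 0) ≤ inversive (E 0) (F j) := by
          intro j; rw [h7, hval]; split_ifs <;> norm_num
        have h2 : ∀ j, j ≠ 0 → inversive (E 0) (F j) ≤ -1 := by
          intro j hj; rw [hval, if_neg hj.symm]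
        have h3 : inversive (E 0) (F' 0) < -1 := by rw [h7]; norm_num
        exact ⟨Or.inr (grow 0 h1 h2 h3).1, fun j => (grow j h1 h2 h3).2 (ih.2 j)⟩
      · obtain ⟨s', t', hdet', hfan'⟩ := hfan.swap hi0 hs
        rw [hdet] at hdet'
        exact ⟨Or.inl ⟨s', t', hdet', hfan'⟩, fan hdet' hfan'⟩
    · have hik : i ≠ k := fun hik => hi (by rw [hik])
      obtain ⟨l, m, hl, hm, hl', hm', hlm, hsum⟩ := exists_three k i hik
      rw [hsum] at hv
      have hi1 := hk i
      have hl1 := hk l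
      have hm1 := hk m
      have h1 : ∀ j, inversive (E 0) (F' i) ≤ inversive (E 0) (F j) := by
        intro j
        have := hk j
        linarith
      have h2 : ∀ j, j ≠ i → inversive (E 0) (F j) ≤ -1 := fun j _ => (hk j).2
      have h3 : inversive (E 0) (F' i) < -1 := by linarith
      exact ⟨Or.inr (grow 0 h1 h2 h3).1, fun j => (grow j h1 h2 h3).2 (ih.2 j)⟩

/-- The disks of the corona have primitive spinor coordinates. -/
theorem corona_cone {E : Fin 4 → Disk} (hE : IsDescartes E) {e : Disk}
    (he : e ∈ corona (packing E) (E 0)) :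
    ∃ s t, det s t ^ 2 = 1 ∧ e.vec + (E 0).vec = cone E s := by
  obtain ⟨⟨F, hF, j, rfl⟩, ht⟩ := he
  obtain ⟨o, ho⟩ := hF.reduced hE
  rcases (corona_aux hE ho).2 j with h | h | h
  · have := ht.1
    rw [h, inversive_self] at this
    norm_num at this
  · exact h
  · exact absurd ht.1 h.ne

/-- Every pair of integral vectors with determinant `±1` belongs to a configuration of the
packing. -/
theorem exists_fan {E : Fin 4 → Disk} (hE : IsDescartes E) {s t : ℤ × ℤ} (h : det s t ^ 2 = 1) :
    ∃ F, IsDescartes F ∧ packing F = packing E ∧ IsFan E F s t := by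
  -- Relabelling disks 1 and 2, relabelling 2 and 3, and exchanging disk 3 act on coordinates by (t,
  -- s), (s, s - t) and (s, -t); these generate all elementary operations.
  set good : ℤ × ℤ → ℤ × ℤ → Prop := fun s t =>
    ∃ F, IsDescartes F ∧ packing F = packing E ∧ IsFan E F s t
  have hperm : ∀ s t, good s t → good t s := by
    rintro s t ⟨F, hF, hP, h0, h1, h2, h3⟩
    refine ⟨F ∘ Equiv.swap 1 2, hF.perm _, (packing_perm F _).trans hP, ?_, ?_, ?_, ?_⟩
    · simpa [Equiv.swap_apply_of_ne_of_ne] using h0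
    · simpa using h2
    · simpa using h1
    · rw [← cone_neg, neg_sub, ← h3]
      simp [Equiv.swap_apply_of_ne_of_ne]
  have hneg : ∀ s t, good s t → good s (-t) := by
    rintro s t ⟨F, hF, hP, h0, h1, h2, h3⟩
    obtain ⟨F', hs⟩ := hF.exists_swap 3
    refine ⟨F', hs.isDescartes hF, (packing_swap hF hs).trans hP, ?_, ?_, ?_, ?_⟩
    · rw [hs.1 0 (by decide), h0]
    · rw [hs.1 1 (by decide), h1]
    · rw [hs.1 2 (by decide), h2, cone_neg]
    · have hp := cone_parallelogram E s t
      rw [hs.2, Fin.sum_univ_four, h0, eq_sub_of_add_eq h1, eq_sub_of_add_eq h2,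
        eq_sub_of_add_eq h3, sub_neg_eq_add, eq_sub_of_add_eq hp]
      module
  have hsub : ∀ s t, good s t → good s (s - t) := by
    rintro s t ⟨F, hF, hP, h0, h1, h2, h3⟩
    refine ⟨F ∘ Equiv.swap 2 3, hF.perm _, (packing_perm F _).trans hP, ?_, ?_, ?_, ?_⟩
    · simpa [Equiv.swap_apply_of_ne_of_ne] using h0
    · simpa [Equiv.swap_apply_of_ne_of_ne] using h1
    · simpa using h3
    · simpa using h2
  have hadd : ∀ s t, good s t → good s (t + s) := by
    intro s t hst
    have := hsub _ _ (hneg _ _ hst)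
    rwa [sub_neg_eq_add, add_comm] at this
  have hsub' : ∀ s t, good s t → good s (t - s) := by
    intro s t hst
    have := hneg _ _ (hsub _ _ hst)
    rwa [neg_sub] at this
  have hmul : ∀ (n : ℤ) s t, good s t → good s (t + n • s) := by
    intro n s t hst
    induction n using Int.induction_on with
    | zero => simpa using hst
    | succ n ih =>
      have := hadd _ _ ih
      rwa [add_assoc, ← add_one_zsmul] at this
    | pred n ih =>
      rw [sub_smul, one_smul, ← add_sub_assoc]
      exact hsub' _ _ ih
  -- Euclid's algorithm on the first coordinates: replace t by its remainder modulo s and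
  -- interchange. When s.1 = 0, the determinant forces s.2 and t.1 to be ±1.
  have key : ∀ (n : ℕ) (s t : ℤ × ℤ), s.1.natAbs = n → det s t ^ 2 = 1 → good s t := by
    intro n
    induction n using Nat.strong_induction_on with
    | _ n ih =>
      intro s t hn hdet
      by_cases h0 : s.1 = 0
      · have hd : (s.2 * t.1) ^ 2 = 1 := by rw [← hdet, det, h0]; ring
        have h1 : good (1, 0) (0, 1) := ⟨E, hE, rfl, isFan_self E⟩
        have hu : IsUnit (s.2 * t.1) := IsUnit.of_pow_eq_one hd two_ne_zero
        obtain ⟨s1, s2⟩ := s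
        obtain ⟨t1, t2⟩ := t
        simp only at h0 hu
        subst h0
        have h2 : good (0, s2) (t1, 0) := by
          rcases Int.isUnit_iff.mp (isUnit_of_mul_isUnit_left hu) with rfl | rfl <;>
          rcases Int.isUnit_iff.mp (isUnit_of_mul_isUnit_right hu) with rfl | rfl
          · exact hperm _ _ h1
          · simpa using hneg _ _ (hperm _ _ h1)
          · simpa using hperm _ _ (hneg _ _ h1)
          · simpa using hneg _ _ (hperm _ _ (hneg _ _ h1))
        have := hmul (s2 * t2) _ _ h2
        have hs2 : s2 * t2 * s2 = t2 := by
          rcases Int.isUnit_iff.mp (isUnit_of_mul_isUnit_left hu) with rfl | rfl <;> ring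
        simpa [hs2] using this
      · have hlt : (t.1 % s.1).natAbs < n := by
          rw [← hn]
          have h1 := Int.emod_nonneg t.1 h0
          have h2 := Int.emod_lt_abs t.1 h0
          zify
          rwa [abs_of_nonneg h1]
        have hr : t.1 % s.1 = t.1 - s.1 * (t.1 / s.1) := by
          rw [eq_sub_iff_add_eq]; exact Int.emod_add_mul_ediv _ _
        have := ih _ hlt (t - (t.1 / s.1) • s) s (by
          rw [hr]; simp [mul_comm]) (by
          rw [← hdet]; simp [det]; ring)
        have := hmul (t.1 / s.1) _ _ (hperm _ _ this)
        simpa using this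
  exact key _ s t rfl h

/-- Expanding (s₁a + s₂b)² in a², b² and (a - b)² gives the coefficients of E₁, E₂ and E₃ in `cone`;
multiples of E₀ do not matter, since the squared spinor is alternating in the two disks. -/
theorem IsSpinorTriple.cone {E : Fin 4 → Disk} {a b : ℂ} (h : IsSpinorTriple E a b) {e : Disk}
    {s : ℤ × ℤ} (he : e.vec + (E 0).vec = cone E s) : IsSpinor (E 0) e (s.1 * a + s.2 * b) := by
  obtain ⟨h1, h2, h3⟩ := h
  unfold IsSpinor at *
  have hb := congrArg (fun v => (v.1 : ℂ)) he
  have hz := congrArg (fun v => v.2.1) he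
  simp only [Apollonian.cone, Disk.vec, Prod.fst_add, Prod.snd_add, Prod.fst_sub, Prod.snd_sub,
    Prod.smul_fst, Prod.smul_snd, smul_eq_mul] at hb hz
  rw [eq_sub_of_add_eq hz]
  simp only [Complex.real_smul] at hz ⊢
  push_cast at hb hz ⊢
  rw [eq_sub_of_add_eq hb]
  linear_combination (s.1 ^ 2 + s.1 * s.2 : ℂ) * h1 + (s.2 ^ 2 + s.1 * s.2 : ℂ) * h2
    - (s.1 * s.2 : ℂ) * h3

theorem mem_lat {v w z : ℂ} : z ∈ lat v w ↔ ∃ m n : ℤ, z = m * v + n * w := by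
  rw [lat, AddSubgroup.mem_closure_pair]
  simp only [zsmul_eq_mul, eq_comm]

/-- The spinor lattice of a corona is generated by the spinors of a configuration. -/
theorem IsSpinorTriple.coronaLattice_eq {E : Fin 4 → Disk} {a b : ℂ} (hE : IsDescartes E)
    (h : IsSpinorTriple E a b) : coronaLattice (packing E) (E 0) = lat a b := by
  apply le_antisymm
  · rw [coronaLattice, AddSubgroup.closure_le]
    rintro u ⟨e, he, hu⟩
    obtain ⟨s, t, -, hs⟩ := corona_cone hE he
    have hm : (s.1 * a + s.2 * b : ℂ) ∈ lat a b := mem_lat.mpr ⟨_, _, rfl⟩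
    rcases hu.eq_or_eq_neg (h.cone hs) with rfl | rfl
    · exact hm
    · exact neg_mem hm
  · rw [lat, AddSubgroup.closure_le]
    rintro u (rfl | rfl)
    · exact AddSubgroup.subset_closure ⟨E 1, ⟨mem_packing E 1, hE 0 1 (by decide)⟩, h.one⟩
    · exact AddSubgroup.subset_closure ⟨E 2, ⟨mem_packing E 2, hE 0 2 (by decide)⟩, h.two⟩

/-! ### Planar lattices -/

/-- The integral combination of `a` and `b` with coefficients `s`. -/
def comb (a b : ℂ) (s : ℤ × ℤ) : ℂ := s.1 * a + s.2 * b

theorem mem_lat_iff_comb {v w z : ℂ} : z ∈ lat v w ↔ ∃ s, z = comb v w s := by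
  rw [mem_lat]
  exact ⟨fun ⟨m, n, h⟩ => ⟨(m, n), h⟩, fun ⟨s, h⟩ => ⟨s.1, s.2, h⟩⟩

theorem left_mem_lat (v w : ℂ) : v ∈ lat v w := AddSubgroup.subset_closure (Or.inl rfl)

theorem right_mem_lat (v w : ℂ) : w ∈ lat v w := AddSubgroup.subset_closure (Or.inr rfl)

theorem comb_re (a b : ℂ) (s : ℤ × ℤ) : (comb a b s).re = s.1 * a.re + s.2 * b.re := by
  simp [comb]

theorem comb_im (a b : ℂ) (s : ℤ × ℤ) : (comb a b s).im = s.1 * a.im + s.2 * b.im := by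
  simp [comb]

theorem norm_sq_comb (a b : ℂ) (s : ℤ × ℤ) :
    ‖comb a b s‖ ^ 2 = s.1 ^ 2 * ‖a‖ ^ 2 + 2 * s.1 * s.2 * dot a b + s.2 ^ 2 * ‖b‖ ^ 2 := by
  simp only [norm_sq_eq, comb_re, comb_im, dot]; ring

theorem cross_comb (a b : ℂ) (s t : ℤ × ℤ) :
    cross (comb a b s) (comb a b t) = det s t * cross a b := by
  simp only [cross, comb_re, comb_im, det]; push_cast; ring

theorem lat_le_lat {v w v' w' : ℂ} (hv : v ∈ lat v' w') (hw : w ∈ lat v' w') :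
    lat v w ≤ lat v' w' := by
  rw [lat, AddSubgroup.closure_le]
  rintro u (rfl | rfl)
  · exact hv
  · exact hw

theorem lat_comb (a b : ℂ) {s t : ℤ × ℤ} (h : det s t ^ 2 = 1) :
    lat (comb a b s) (comb a b t) = lat a b := by
  apply le_antisymm
  · exact lat_le_lat (mem_lat_iff_comb.mpr ⟨s, rfl⟩) (mem_lat_iff_comb.mpr ⟨t, rfl⟩)
  · have hc : ((s.1 : ℂ) * t.2 - s.2 * t.1) ^ 2 = 1 := by
      have := congrArg (Int.cast : ℤ → ℂ) h
      simpa [det] using this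
    apply lat_le_lat
    · refine mem_lat_iff_comb.mpr ⟨(det s t * t.2, -(det s t * s.2)), ?_⟩
      simp only [comb, det]
      push_cast
      linear_combination -a * hc
    · refine mem_lat_iff_comb.mpr ⟨(-(det s t * t.1), det s t * s.1), ?_⟩
      simp only [comb, det]
      push_cast
      linear_combination -b * hc

/-- Two bases are integral combinations of each other, so the determinants multiply to 1 unless the
cross product vanishes. Rank one is covered, so arbitrary generating pairs may be used in the
curvature formula. -/
theorem abs_cross_eq_of_lat_eq {v w v' w' : ℂ} (h : lat v w = lat v' w') :
    |cross v w| = |cross v' w'| := by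
  have key : ∀ {v w v' w' : ℂ}, lat v w = lat v' w' → |cross v w| ≤ |cross v' w'| := by
    intro v w v' w' h
    obtain ⟨s, rfl⟩ := mem_lat_iff_comb.mp (h ▸ left_mem_lat v w)
    obtain ⟨t, rfl⟩ := mem_lat_iff_comb.mp (h ▸ right_mem_lat _ w)
    obtain ⟨s', hs'⟩ := mem_lat_iff_comb.mp (h.symm ▸ left_mem_lat v' w')
    obtain ⟨t', ht'⟩ := mem_lat_iff_comb.mp (h.symm ▸ right_mem_lat v' w')
    have h1 := cross_comb v' w' s t
    have h2 := cross_comb (comb v' w' s) (comb v' w' t) s' t'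
    rw [← hs', ← ht', h1] at h2
    rw [h1]
    rcases eq_or_ne (cross v' w') 0 with h0 | h0
    · simp [h0]
    · have h3 : ((det s' t' * det s t : ℤ) : ℝ) = 1 := by
        push_cast
        exact mul_right_cancel₀ h0 (by linear_combination -h2)
      have h4 : det s' t' * det s t = 1 := by exact_mod_cast h3
      rw [abs_mul, ← Int.cast_abs, Int.isUnit_iff_abs_eq.mp (IsUnit.of_mul_eq_one_right _ h4)]
      simp
  exact le_antisymm (key h) (key h.symm)

theorem isReduced_iff (a b : ℂ) :
    IsReduced a b ↔ ‖a‖ ^ 2 ≤ ‖b‖ ^ 2 ∧ 2 * dot a b ≤ ‖a‖ ^ 2 ∧ 0 ≤ dot a b := by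
  have h1 : ‖a‖ ≤ ‖b‖ ↔ ‖a‖ ^ 2 ≤ ‖b‖ ^ 2 := (sq_le_sq₀ (norm_nonneg _) (norm_nonneg _)).symm
  have h2 : ‖b‖ ≤ ‖a + b‖ ↔ ‖b‖ ^ 2 ≤ ‖a + b‖ ^ 2 :=
    (sq_le_sq₀ (norm_nonneg _) (norm_nonneg _)).symm
  have h3 : ‖b‖ ≤ ‖a - b‖ ↔ ‖b‖ ^ 2 ≤ ‖a - b‖ ^ 2 :=
    (sq_le_sq₀ (norm_nonneg _) (norm_nonneg _)).symm
  rw [IsReduced, h1, h2, h3, norm_sq_add, norm_sq_sub]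
  constructor
  · rintro ⟨h, -, h', h''⟩; exact ⟨h, by linarith, h''⟩
  · rintro ⟨h, h', h''⟩; exact ⟨h, by nlinarith [sq_nonneg ‖a‖], by linarith, h''⟩

/-- Collinearity gives (a·b)² = |a|²|b|² ≥ |a|⁴, whereas reducedness gives a·b ≤ |a|²/2. -/
theorem IsReduced.eq_zero_of_cross {a b : ℂ} (h : IsReduced a b) (h0 : cross a b = 0) : a = 0 := by
  obtain ⟨h1, h2, h3⟩ := (isReduced_iff a b).mp h
  have := cross_sq_add_dot_sq a b
  rw [h0] at this
  have ha : 0 ≤ ‖a‖ ^ 2 := by positivity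
  have : ‖a‖ ^ 2 = 0 := by nlinarith
  simpa using this

/-- Two reduced bases of a lattice are related by an integral matrix of determinant `±1`. -/
theorem exists_comb_of_lat_eq {a b a' b' : ℂ} (h : IsReduced a b) (h' : IsReduced a' b')
    (hl : lat a b = lat a' b') :
    ∃ s t, det s t ^ 2 = 1 ∧ a' = comb a b s ∧ b' = comb a b t := by
  obtain ⟨s, hs⟩ := mem_lat_iff_comb.mp (hl.symm ▸ left_mem_lat a' b')
  obtain ⟨t, ht⟩ := mem_lat_iff_comb.mp (hl.symm ▸ right_mem_lat a' b')
  have hcr := abs_cross_eq_of_lat_eq hl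
  rcases eq_or_ne (cross a b) 0 with h0 | h0
  -- In rank one both first vectors are 0 and the second ones agree up to sign. The coefficients are
  -- not unique, so a diagonal matrix of determinant ±1 is selected.
  · have h0' : cross a' b' = 0 := by
      rw [h0, abs_zero] at hcr
      exact abs_eq_zero.mp hcr.symm
    obtain rfl := h.eq_zero_of_cross h0
    obtain rfl := h'.eq_zero_of_cross h0'
    obtain ⟨u, hu⟩ := mem_lat_iff_comb.mp (hl ▸ right_mem_lat 0 b)
    simp only [comb, mul_zero, zero_add] at ht hu ⊢
    rcases eq_or_ne b 0 with rfl | hb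
    · exact ⟨(1, 0), (0, 1), by simp [det], by simp, by simpa using ht⟩
    · refine ⟨(1, 0), (0, t.2), ?_, by simp, by simpa using ht⟩
      have h1 : ((u.2 * t.2 : ℤ) : ℂ) = 1 := by
        push_cast
        refine mul_right_cancel₀ hb ?_
        rw [mul_assoc, ← ht, ← hu, one_mul]
      have h2 : u.2 * t.2 = 1 := by exact_mod_cast h1
      have h3 := Int.isUnit_iff.mp (IsUnit.of_mul_eq_one_right _ h2)
      rcases h3 with h3 | h3 <;> simp [det, h3]
  · refine ⟨s, t, ?_, hs, ht⟩
    have h1 := cross_comb a b s t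
    rw [← hs, ← ht] at h1
    rw [h1, abs_mul] at hcr
    have h2 : |(det s t : ℝ)| = 1 :=
      (mul_right_cancel₀ (abs_ne_zero.mpr h0) (by rw [one_mul]; exact hcr)).symm
    have h3 : (det s t : ℝ) ^ 2 = 1 := by rw [← sq_abs, h2]; norm_num
    exact_mod_cast h3

/-- The Gram matrix of a reduced basis is determined by the lattice. -/
theorem gram_eq_of_lat_eq {a b a' b' : ℂ} (h : IsReduced a b) (h' : IsReduced a' b')
    (hl : lat a b = lat a' b') :
    ‖a‖ ^ 2 = ‖a'‖ ^ 2 ∧ ‖b‖ ^ 2 = ‖b'‖ ^ 2 ∧ dot a b = dot a' b' := by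
  have key : ∀ {a b a' b' : ℂ}, IsReduced a b → IsReduced a' b' → lat a b = lat a' b' →
      ‖a‖ ^ 2 ≤ ‖a'‖ ^ 2 ∧ ‖b‖ ^ 2 ≤ ‖b'‖ ^ 2 := by
    intro a b a' b' h h' hl
    obtain ⟨s, t, hdet, rfl, rfl⟩ := exists_comb_of_lat_eq h h' hl
    obtain ⟨h1, h2, h3⟩ := (isReduced_iff a b).mp h
    obtain ⟨h1', -, -⟩ := (isReduced_iff _ _).mp h'
    have ha : 0 ≤ ‖a‖ ^ 2 := by positivity
    -- With 0 ≤ 2 a·b ≤ |a|², the norm of xa + yb is at least |a|²(x² - |xy| + y²) + y²(|b|² -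
    -- |a|²), and x² - |xy| + y² ≥ 1.
    have big : ∀ s : ℤ × ℤ, s.2 ≠ 0 → ‖b‖ ^ 2 ≤ ‖comb a b s‖ ^ 2 := by
      intro s hs
      rw [norm_sq_comb]
      have hy : (1 : ℝ) ≤ (s.2 : ℝ) ^ 2 := by
        exact_mod_cast Int.add_one_le_iff.mpr (by positivity : (0 : ℤ) < s.2 ^ 2)
      have hq : (1 : ℝ) ≤ (s.1 : ℝ) ^ 2 - |(s.1 : ℝ) * s.2| + (s.2 : ℝ) ^ 2 := by
        have : 0 < s.1 ^ 2 - |s.1 * s.2| + s.2 ^ 2 := by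
          have hpos : 0 < s.2 ^ 2 := by positivity
          rcases abs_cases (s.1 * s.2) with ⟨h, -⟩ | ⟨h, -⟩ <;> rw [h] <;>
            nlinarith [sq_nonneg (s.1 - s.2), sq_nonneg (s.1 + s.2), sq_nonneg s.1]
        exact_mod_cast Int.add_one_le_iff.mpr this
      have hxy : -(|(s.1 : ℝ) * s.2| * ‖a‖ ^ 2) ≤ 2 * s.1 * s.2 * dot a b := by
        have h5 := neg_abs_le ((s.1 : ℝ) * s.2)
        have h6 := abs_nonneg ((s.1 : ℝ) * s.2)
        nlinarith
      nlinarith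
    have small : ∀ s : ℤ × ℤ, s ≠ 0 → ‖a‖ ^ 2 ≤ ‖comb a b s‖ ^ 2 := by
      intro s hs
      by_cases h0 : s.2 = 0
      · have hx : s.1 ≠ 0 := fun hx => hs (Prod.ext hx h0)
        have hx1 : (1 : ℝ) ≤ (s.1 : ℝ) ^ 2 := by
          exact_mod_cast Int.add_one_le_iff.mpr (by positivity : (0 : ℤ) < s.1 ^ 2)
        rw [norm_sq_comb, h0]
        push_cast
        nlinarith
      · exact h1.trans (big s h0)
    constructor
    · refine small s ?_
      rintro rfl
      simp [det] at hdet
    · by_cases ht : t.2 = 0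
      · refine (big s ?_).trans h1'
        intro hs
        simp [det, ht, hs] at hdet
      · exact big t ht
  obtain ⟨h1, h2⟩ := key h h' hl
  obtain ⟨h3, h4⟩ := key h' h hl.symm
  have e1 := le_antisymm h1 h3
  have e2 := le_antisymm h2 h4
  refine ⟨e1, e2, ?_⟩
  -- The norms and |a × b| fix (a·b)²; the convention a·b ≥ 0 then fixes the sign.
  have hcr := abs_cross_eq_of_lat_eq hl
  have g1 := cross_sq_add_dot_sq a b
  have g2 := cross_sq_add_dot_sq a' b'
  rw [← sq_abs] at g1 g2
  rw [← e1, ← e2, ← hcr, ← g1] at g2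
  have hd := h.2.2.2
  have hd' := h'.2.2.2
  exact (pow_left_inj₀ hd hd' two_ne_zero).mp (by linarith)

theorem isInt_iff {v : ℂ} : IsInt v ↔ ∃ z : GaussianInt, (z : ℂ) = v := by
  constructor
  · rintro ⟨m, n, rfl⟩
    exact ⟨⟨m, n⟩, by simp [GaussianInt.toComplex_def, Complex.ext_iff]⟩
  · rintro ⟨z, rfl⟩
    exact ⟨z.re, z.im, GaussianInt.toComplex_def₂ z⟩

theorem IsInt.comb {v w : ℂ} (hv : IsInt v) (hw : IsInt w) (s : ℤ × ℤ) :
    IsInt (comb v w s) := by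
  obtain ⟨z, rfl⟩ := isInt_iff.mp hv
  obtain ⟨z', rfl⟩ := isInt_iff.mp hw
  exact isInt_iff.mpr ⟨s.1 * z + s.2 * z', by simp [Apollonian.comb]⟩

theorem IsInt.of_mem_lat {v w z : ℂ} (hv : IsInt v) (hw : IsInt w) (hz : z ∈ lat v w) :
    IsInt z := by
  obtain ⟨s, rfl⟩ := mem_lat_iff_comb.mp hz
  exact hv.comb hw s

theorem IsInt.norm_sq {v : ℂ} (hv : IsInt v) : ∃ n : ℕ, ‖v‖ ^ 2 = n := by
  obtain ⟨m, n, rfl⟩ := hv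
  refine ⟨(m ^ 2 + n ^ 2).toNat, ?_⟩
  rw [norm_sq_eq, ← Int.cast_natCast, Int.toNat_of_nonneg (by positivity)]
  simp

theorem IsInt.dot {v w : ℂ} (hv : IsInt v) (hw : IsInt w) : ∃ n : ℤ, dot v w = n := by
  obtain ⟨m, n, rfl⟩ := hv
  obtain ⟨m', n', rfl⟩ := hw
  exact ⟨m * m' + n * n', by simp [Apollonian.dot]⟩

theorem IsInt.cross {v w : ℂ} (hv : IsInt v) (hw : IsInt w) : ∃ n : ℤ, cross v w = n := by
  obtain ⟨m, n, rfl⟩ := hv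
  obtain ⟨m', n', rfl⟩ := hw
  exact ⟨m * n' - n * m', by simp [Apollonian.cross, mul_comm]⟩

/-- Gauss reduction. -/
theorem exists_reduced {v w : ℂ} (hv : IsInt v) (hw : IsInt w) :
    ∃ a b, IsInt a ∧ IsInt b ∧ lat a b = lat v w ∧ IsReduced a b := by
  have hnat : ∀ a b, IsInt a → IsInt b → ∃ n : ℕ, ‖a‖ ^ 2 + ‖b‖ ^ 2 = n := by
    intro a b ha hb
    obtain ⟨m, hm⟩ := ha.norm_sq
    obtain ⟨n, hn⟩ := hb.norm_sq
    exact ⟨m + n, by rw [hm, hn]; push_cast; ring⟩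
  have hex : ∃ n : ℕ, ∃ a b, IsInt a ∧ IsInt b ∧ lat a b = lat v w ∧ ‖a‖ ^ 2 + ‖b‖ ^ 2 = n := by
    obtain ⟨n, hn⟩ := hnat v w hv hw
    exact ⟨n, v, w, hv, hw, rfl, hn⟩
  classical
  obtain ⟨a, b, ha, hb, hl, hn⟩ := Nat.find_spec hex
  have hmin : ∀ a' b', IsInt a' → IsInt b' → lat a' b' = lat v w →
      ‖a‖ ^ 2 + ‖b‖ ^ 2 ≤ ‖a'‖ ^ 2 + ‖b'‖ ^ 2 := by
    intro a' b' ha' hb' hl'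
    obtain ⟨n, hn'⟩ := hnat a' b' ha' hb'
    rw [hn, hn']
    exact_mod_cast Nat.find_min' hex ⟨a', b', ha', hb', hl', hn'⟩
  have hlat : ∀ s t, det s t ^ 2 = 1 → lat (comb a b s) (comb a b t) = lat v w :=
    fun s t h => (lat_comb a b h).trans hl
  -- Minimality of |a|² + |b|² against the pairs (a, a ± b) and (b, a ± b). What remains is to order
  -- the two vectors and choose a sign.
  have h1 : 2 * |dot a b| ≤ ‖a‖ ^ 2 ∧ 2 * |dot a b| ≤ ‖b‖ ^ 2 := by
    have f : ∀ s t, det s t ^ 2 = 1 →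
        ‖a‖ ^ 2 + ‖b‖ ^ 2 ≤ ‖comb a b s‖ ^ 2 + ‖comb a b t‖ ^ 2 := fun s t h =>
      hmin _ _ (ha.comb hb s) (ha.comb hb t) (hlat s t h)
    have f1 := f (1, 0) (1, 1) (by simp [det])
    have f2 := f (1, 0) (1, -1) (by simp [det])
    have f3 := f (0, 1) (1, 1) (by simp [det])
    have f4 := f (0, 1) (1, -1) (by simp [det])
    simp only [norm_sq_comb] at f1 f2 f3 f4
    push_cast at f1 f2 f3 f4
    rcases abs_cases (Apollonian.dot a b) with ⟨h, -⟩ | ⟨h, -⟩ <;> rw [h] <;>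
      constructor <;> linarith
  have build : ∀ s t, det s t ^ 2 = 1 → IsReduced (comb a b s) (comb a b t) →
      ∃ a b, IsInt a ∧ IsInt b ∧ lat a b = lat v w ∧ IsReduced a b := fun s t h hr =>
    ⟨_, _, ha.comb hb s, ha.comb hb t, hlat s t h, hr⟩
  have hdc : ∀ s t, Apollonian.dot (comb a b s) (comb a b t) = s.1 * t.1 * ‖a‖ ^ 2 +
      (s.1 * t.2 + s.2 * t.1) * Apollonian.dot a b + s.2 * t.2 * ‖b‖ ^ 2 := by
    intro s t
    simp only [norm_sq_eq, comb_re, comb_im, Apollonian.dot]; ring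
  rcases abs_cases (Apollonian.dot a b) with ⟨h, h0⟩ | ⟨h, h0⟩ <;> rw [h] at h1 <;>
    rcases le_total (‖a‖ ^ 2) (‖b‖ ^ 2) with hab | hab
  · refine build (1, 0) (0, 1) (by simp [det]) ((isReduced_iff _ _).mpr ?_)
    simp only [norm_sq_comb, hdc]
    push_cast
    refine ⟨?_, ?_, ?_⟩ <;> linarith
  · refine build (0, 1) (1, 0) (by simp [det]) ((isReduced_iff _ _).mpr ?_)
    simp only [norm_sq_comb, hdc]
    push_cast
    refine ⟨?_, ?_, ?_⟩ <;> linarith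
  · refine build (1, 0) (0, -1) (by simp [det]) ((isReduced_iff _ _).mpr ?_)
    simp only [norm_sq_comb, hdc]
    push_cast
    refine ⟨?_, ?_, ?_⟩ <;> linarith
  · refine build (0, 1) (-1, 0) (by simp [det]) ((isReduced_iff _ _).mpr ?_)
    simp only [norm_sq_comb, hdc]
    push_cast
    refine ⟨?_, ?_, ?_⟩ <;> linarith

/-! ### Isometries -/

theorem dot_map (g : ℂ ≃ₗᵢ[ℝ] ℂ) (a b : ℂ) : dot (g a) (g b) = dot a b := by
  have h1 := norm_sq_sub a b
  have h2 := norm_sq_sub (g a) (g b)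
  rw [← map_sub, g.norm_map, g.norm_map, g.norm_map] at h2
  linarith

theorem cross_sq_map (g : ℂ ≃ₗᵢ[ℝ] ℂ) (a b : ℂ) : cross (g a) (g b) ^ 2 = cross a b ^ 2 := by
  have h1 := cross_sq_add_dot_sq a b
  have h2 := cross_sq_add_dot_sq (g a) (g b)
  rw [dot_map, g.norm_map, g.norm_map] at h2
  linarith

theorem IsReduced.map {a b : ℂ} (h : IsReduced a b) (g : ℂ ≃ₗᵢ[ℝ] ℂ) : IsReduced (g a) (g b) := by
  rw [isReduced_iff] at *
  simpa only [g.norm_map, dot_map] using h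

theorem exists_mul_isometry {c : ℂ} (hc : ‖c‖ = 1) : ∃ g : ℂ ≃ₗᵢ[ℝ] ℂ, ∀ z, g z = c * z :=
  ⟨rotation ⟨c, mem_sphere_zero_iff_norm.mpr hc⟩, fun z => rotation_apply _ z⟩

/-- Two families of vectors with the same Gram matrix are related by an isometry. -/
theorem exists_isometry_of_dot_eq {ι : Type*} (p q : ι → ℂ)
    (h : ∀ i j, dot (p i) (p j) = dot (q i) (q j)) : ∃ g : ℂ ≃ₗᵢ[ℝ] ℂ, ∀ i, g (p i) = q i := by
  have hnorm : ∀ i, ‖p i‖ = ‖q i‖ := by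
    intro i
    have := h i i
    rw [dot_self, dot_self] at this
    exact (pow_left_inj₀ (norm_nonneg _) (norm_nonneg _) two_ne_zero).mp this
  by_cases hp : ∀ i, p i = 0
  · refine ⟨LinearIsometryEquiv.refl ℝ ℂ, fun i => ?_⟩
    have := hnorm i
    rw [hp i, norm_zero] at this
    simp [hp i, norm_eq_zero.mp this.symm]
  push Not at hp
  obtain ⟨k, hk⟩ := hp
  have hqk : q k ≠ 0 := by rw [← norm_ne_zero_iff, ← hnorm, norm_ne_zero_iff]; exact hk
  have hconj : ∀ a b : ℂ, (starRingEnd ℂ) a * b = ⟨dot a b, cross a b⟩ := by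
    intro a b
    apply Complex.ext <;> simp [dot, cross]; ring
  have hN : ∀ a b c : ℂ, dot a b * dot a c + cross a b * cross a c = ‖a‖ ^ 2 * dot b c := by
    intro a b c
    simp only [dot, cross, norm_sq_eq]; ring
  -- Dot products determine the cross products with a fixed nonzero vector up to one global sign:
  -- the two signs lead to a rotation and to a reflection.
  have hprod : ∀ i j, cross (p k) (p i) * cross (p k) (p j) =
      cross (q k) (q i) * cross (q k) (q j) := by
    intro i j
    have h1 := hN (p k) (p i) (p j)
    have h2 := hN (q k) (q i) (q j)
    rw [h, h, h, hnorm] at h1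
    linarith
  have hsign : (∀ i, cross (q k) (q i) = cross (p k) (p i)) ∨
      ∀ i, cross (q k) (q i) = -cross (p k) (p i) := by
    by_cases hz : ∀ i, cross (p k) (p i) = 0
    · left
      intro i
      have := hprod i i
      rw [hz, zero_mul] at this
      rw [hz]
      exact mul_self_eq_zero.mp this.symm
    push Not at hz
    obtain ⟨j, hj⟩ := hz
    rcases mul_self_eq_mul_self_iff.mp (hprod j j) with hs | hs
    · left
      intro i
      have := hprod i j
      rw [← hs] at this
      exact (mul_right_cancel₀ hj this).symm
    · right
      intro i
      have := hprod i j
      have h2 : cross (q k) (q j) = -cross (p k) (p j) := by linarith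
      rw [h2] at this
      exact mul_right_cancel₀ hj (by linarith)
  have hmul : (starRingEnd ℂ) (q k) * q k = (starRingEnd ℂ) (p k) * p k := by
    rw [hconj, hconj, h k k]
    congr 1
    simp [cross]
  have hck : (starRingEnd ℂ) (p k) ≠ 0 := by simpa using hk
  have hcq : (starRingEnd ℂ) (q k) ≠ 0 := by simpa using hqk
  rcases hsign with hs | hs
  · obtain ⟨g, hg⟩ := exists_mul_isometry (c := q k / p k)
      (by rw [norm_div, hnorm, div_self (norm_ne_zero_iff.mpr hqk)])
    refine ⟨g, fun i => ?_⟩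
    have h1 : (starRingEnd ℂ) (p k) * p i = (starRingEnd ℂ) (q k) * q i := by
      rw [hconj, hconj, h, hs]
    rw [hg]
    field_simp
    apply mul_left_cancel₀ hcq
    linear_combination (p i) * hmul + p k * h1
  · obtain ⟨g, hg⟩ := exists_mul_isometry (c := q k / (starRingEnd ℂ) (p k))
      (by rw [norm_div, RCLike.norm_conj, hnorm, div_self (norm_ne_zero_iff.mpr hqk)])
    refine ⟨Complex.conjLIE.trans g, fun i => ?_⟩
    have h1 : (starRingEnd ℂ) ((starRingEnd ℂ) (p k) * p i) = (starRingEnd ℂ) (q k) * q i := by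
      rw [hconj, hconj, h, hs]
      apply Complex.ext <;> simp
    rw [map_mul, Complex.conj_conj] at h1
    rw [LinearIsometryEquiv.trans_apply, hg, Complex.conjLIE_apply]
    field_simp
    apply mul_left_cancel₀ hcq
    linear_combination ((starRingEnd ℂ) (p i)) * hmul + (starRingEnd ℂ) (p k) * h1

theorem exists_isometry_of_gram_eq {a b a' b' : ℂ} (ha : ‖a‖ ^ 2 = ‖a'‖ ^ 2)
    (hb : ‖b‖ ^ 2 = ‖b'‖ ^ 2) (hab : dot a b = dot a' b') :
    ∃ g : ℂ ≃ₗᵢ[ℝ] ℂ, g a = a' ∧ g b = b' := by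
  have hcomm : ∀ u v, dot u v = dot v u := fun u v => by simp only [dot]; ring
  obtain ⟨g, hg⟩ := exists_isometry_of_dot_eq ![a, b] ![a', b'] (by
    intro i j
    fin_cases i <;> fin_cases j <;> simp [dot_self, ha, hb, hab, hcomm b, hcomm b'])
  exact ⟨g, hg 0, hg 1⟩

/-! ### Similarity and irreducible lattices -/

theorem similarBy_iff {r : ℝ} {v w : ℂ} {L : AddSubgroup ℂ} :
    SimilarBy r (lat v w) L ↔ ∃ g : ℂ ≃ₗᵢ[ℝ] ℂ, L = lat (r • g v) (r • g w) := by
  have key : ∀ g : ℂ ≃ₗᵢ[ℝ] ℂ, (fun z => r • g z) '' (lat v w : Set ℂ) =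
      (lat (r • g v) (r • g w) : Set ℂ) := by
    intro g
    have hc : ∀ s : ℤ × ℤ, r • g (comb v w s) = comb (r • g v) (r • g w) s := by
      intro s
      simp only [comb, ← zsmul_eq_mul, map_add, map_zsmul, smul_add]
      rw [smul_comm r s.1, smul_comm r s.2]
    ext z
    simp only [Set.mem_image, SetLike.mem_coe, mem_lat_iff_comb]
    constructor
    · rintro ⟨_, ⟨s, rfl⟩, rfl⟩
      exact ⟨s, hc s⟩
    · rintro ⟨s, rfl⟩
      exact ⟨_, ⟨s, rfl⟩, hc s⟩
  constructor
  · rintro ⟨g, hg⟩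
    exact ⟨g, SetLike.coe_injective (hg.trans (key g))⟩
  · rintro ⟨g, rfl⟩
    exact ⟨g, (key g).symm⟩

theorem similarBy_one_iff {v w : ℂ} {L : AddSubgroup ℂ} :
    SimilarBy 1 (lat v w) L ↔ ∃ g : ℂ ≃ₗᵢ[ℝ] ℂ, L = lat (g v) (g w) := by
  rw [similarBy_iff]
  simp only [one_smul]

theorem SimilarBy.similar {L M : AddSubgroup ℂ} (h : SimilarBy 1 L M) : Similar L M :=
  ⟨1, one_pos, h⟩

theorem SimilarBy.symm {r : ℝ} {L M : AddSubgroup ℂ} (hr : 0 < r) (h : SimilarBy r L M) :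
    SimilarBy r⁻¹ M L := by
  obtain ⟨g, hg⟩ := h
  refine ⟨g.symm, ?_⟩
  rw [hg, Set.image_image]
  have h : (fun z => r⁻¹ • g.symm (r • g z)) = id := by
    funext z
    rw [map_smul, smul_smul, inv_mul_cancel₀ hr.ne', one_smul, g.symm_apply_apply, id]
  rw [h, Set.image_id]

theorem SimilarBy.one_symm {L M : AddSubgroup ℂ} (h : SimilarBy 1 L M) : SimilarBy 1 M L := by
  simpa using h.symm one_pos

theorem SimilarBy.one_trans {L M N : AddSubgroup ℂ} (h : SimilarBy 1 L M) (h' : SimilarBy 1 M N) :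
    SimilarBy 1 L N := by
  obtain ⟨g, hg⟩ := h
  obtain ⟨k, hk⟩ := h'
  refine ⟨g.trans k, ?_⟩
  rw [hk, hg, Set.image_image]
  simp

/-- Similar irreducible lattices have the same size. -/
theorem Similar.similarBy_one {L M : AddSubgroup ℂ} (h : Similar L M)
    (hL : IsIrreducibleLattice L) (hM : IsIrreducibleLattice M) : SimilarBy 1 L M := by
  obtain ⟨r, hr, h⟩ := h
  rcases lt_trichotomy r 1 with hlt | rfl | hgt
  · exact absurd ⟨r⁻¹, M, (one_lt_inv₀ hr).mpr hlt, hM.1, h.symm hr⟩ hL.2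
  · exact h
  · exact absurd ⟨r, L, hgt, hL.1, h⟩ hM.2

theorem similarBy_one_of_gram_eq {a b a' b' : ℂ} (ha : ‖a‖ ^ 2 = ‖a'‖ ^ 2)
    (hb : ‖b‖ ^ 2 = ‖b'‖ ^ 2) (hab : dot a b = dot a' b') : SimilarBy 1 (lat a b) (lat a' b') := by
  obtain ⟨g, rfl, rfl⟩ := exists_isometry_of_gram_eq ha hb hab
  exact similarBy_one_iff.mpr ⟨g, rfl⟩

/-! ### Irreducibility via Gaussian integers -/

/-- The entries of the Gram matrix and the symplectic product have no common factor. -/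
def IsPrimitive (a b : ℂ) : Prop :=
  ∀ m : ℕ, (∃ k : ℤ, ‖a‖ ^ 2 = m * k) → (∃ k : ℤ, ‖b‖ ^ 2 = m * k) → (∃ k : ℤ, dot a b = m * k) →
    (∃ k : ℤ, cross a b = m * k) → m = 1

theorem IsPrimitive.lat_ne_bot {a b : ℂ} (h : IsPrimitive a b) : lat a b ≠ ⊥ := by
  intro h0
  have ha : a = 0 := by simpa [h0] using left_mem_lat a b
  have hb : b = 0 := by simpa [h0] using right_mem_lat a b
  subst ha hb
  have := h 2 ⟨0, by simp⟩ ⟨0, by simp⟩ ⟨0, by simp [dot]⟩ ⟨0, by simp [cross]⟩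
  omega

theorem dvd_of_mul_eq {s t : ℕ} (hst : s.Coprime t) {x : ℝ} {m n : ℤ} (hx : x = m)
    (h : t * x = s * n) : ∃ k : ℤ, x = s * k := by
  rw [hx] at h ⊢
  have h' : (t : ℤ) * m = s * n := by exact_mod_cast h
  obtain ⟨k, hk⟩ := (Int.isCoprime_iff_gcd_eq_one.mpr hst : IsCoprime (s : ℤ) t).dvd_of_dvd_mul_left
    (Dvd.intro _ h'.symm)
  exact ⟨k, by exact_mod_cast hk⟩

/-- A similarity of ratio r from an integral lattice multiplies Gram entries by r² and the cross
product by ±r². A nonzero norm shows r² = s/t in lowest terms; then s divides all four integers, so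
s = 1 and r ≤ 1. -/
theorem IsPrimitive.isIrreducibleLattice {v w : ℂ} (hv : IsInt v) (hw : IsInt w)
    (h : IsPrimitive v w) : IsIrreducibleLattice (lat v w) := by
  refine ⟨⟨h.lat_ne_bot, v, w, hv, hw, rfl⟩, ?_⟩
  rintro ⟨r, _, hr, ⟨-, v', w', hv', hw', rfl⟩, g, hg⟩
  obtain ⟨p, hp, hpv⟩ : v ∈ (fun z => r • g z) '' (lat v' w' : Set ℂ) := hg ▸ left_mem_lat v w
  obtain ⟨q, hq, hqw⟩ : w ∈ (fun z => r • g z) '' (lat v' w' : Set ℂ) := hg ▸ right_mem_lat v w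
  have hp' := hv'.of_mem_lat hw' hp
  have hq' := hv'.of_mem_lat hw' hq
  simp only at hpv hqw
  have hr0 : 0 < r := by linarith
  have nA : ‖v‖ ^ 2 = r ^ 2 * ‖p‖ ^ 2 := by
    rw [← hpv, norm_smul, g.norm_map, mul_pow, Real.norm_eq_abs, sq_abs]
  have nC : ‖w‖ ^ 2 = r ^ 2 * ‖q‖ ^ 2 := by
    rw [← hqw, norm_smul, g.norm_map, mul_pow, Real.norm_eq_abs, sq_abs]
  have nB : dot v w = r ^ 2 * dot p q := by
    have : ∀ a b, dot (r • a) (r • b) = r ^ 2 * dot a b := by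
      intro a b; simp only [dot, Complex.smul_re, Complex.smul_im, smul_eq_mul]; ring
    rw [← hpv, ← hqw, this, dot_map]
  have nD : cross v w = r ^ 2 * cross p q ∨ cross v w = r ^ 2 * -cross p q := by
    have : ∀ a b, cross (r • a) (r • b) = r ^ 2 * cross a b := by
      intro a b; simp only [cross, Complex.smul_re, Complex.smul_im, smul_eq_mul]; ring
    rw [← hpv, ← hqw, this]
    rcases sq_eq_sq_iff_eq_or_eq_neg.mp (cross_sq_map g p q) with h | h <;> simp [h]
  obtain ⟨A, hA⟩ := hv.norm_sq
  obtain ⟨C, hC⟩ := hw.norm_sq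
  obtain ⟨B, hB⟩ := hv.dot hw
  obtain ⟨D, hD⟩ := hv.cross hw
  obtain ⟨A', hA'⟩ := hp'.norm_sq
  obtain ⟨C', hC'⟩ := hq'.norm_sq
  obtain ⟨B', hB'⟩ := hp'.dot hq'
  obtain ⟨D', hD'⟩ := hp'.cross hq'
  have hrat : ∃ m n : ℕ, 0 < n ∧ r ^ 2 * n = m := by
    by_cases hA0 : A' = 0
    · by_cases hC0 : C' = 0
      · exfalso
        apply h.lat_ne_bot
        have h1 : v = 0 := by
          rw [hA', hA0] at nA
          simpa using nA
        have h2 : w = 0 := by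
          rw [hC', hC0] at nC
          simpa using nC
        rw [h1, h2, lat]
        simp
      · exact ⟨C, C', Nat.pos_of_ne_zero hC0, by rw [← hC', ← nC, hC]⟩
    · exact ⟨A, A', Nat.pos_of_ne_zero hA0, by rw [← hA', ← nA, hA]⟩
  obtain ⟨m, n, hn, hmn⟩ := hrat
  obtain ⟨s, t, hst, hm, hn'⟩ : ∃ s t : ℕ, s.Coprime t ∧ m = s * m.gcd n ∧ n = t * m.gcd n := by
    have hg : 0 < m.gcd n := Nat.gcd_pos_of_pos_right _ hn
    exact ⟨m / m.gcd n, n / m.gcd n, Nat.coprime_div_gcd_div_gcd hg,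
      (Nat.div_mul_cancel (Nat.gcd_dvd_left _ _)).symm,
      (Nat.div_mul_cancel (Nat.gcd_dvd_right _ _)).symm⟩
  have hg : (m.gcd n : ℝ) ≠ 0 := by exact_mod_cast (Nat.gcd_pos_of_pos_right _ hn).ne'
  have ht : 0 < t := by
    rcases Nat.eq_zero_or_pos t with rfl | ht
    · omega
    · exact ht
  have hrst : r ^ 2 * t = s := by
    have h1 : (m : ℝ) = s * m.gcd n := by exact_mod_cast hm
    have h2 : (n : ℝ) = t * m.gcd n := by exact_mod_cast hn'
    rw [h1, h2] at hmn
    exact mul_right_cancel₀ hg (by linarith)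
  have hs1 := h s
    (dvd_of_mul_eq hst (m := A) (n := A') (by simpa using hA) (by
      rw [nA, ← hrst, hA']; push_cast; ring))
    (dvd_of_mul_eq hst (m := C) (n := C') (by simpa using hC) (by
      rw [nC, ← hrst, hC']; push_cast; ring))
    (dvd_of_mul_eq hst hB (n := B') (by rw [nB, ← hrst, hB']; ring))
    (by
      rcases nD with h | h
      · exact dvd_of_mul_eq hst hD (n := D') (by rw [h, ← hrst, hD']; ring)
      · exact dvd_of_mul_eq hst hD (n := -D') (by rw [h, ← hrst, hD']; push_cast; ring))
  rw [hs1] at hrst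
  have ht1 : (1 : ℝ) ≤ t := by exact_mod_cast ht
  push_cast at hrst
  nlinarith

theorem conj_mul_eq (a b : ℂ) : (starRingEnd ℂ) a * b = ⟨dot a b, cross a b⟩ := by
  apply Complex.ext <;> simp [dot, cross]; ring

theorem norm_sq_gaussian (z : GaussianInt) : ‖(z : ℂ)‖ ^ 2 = z.norm := by
  rw [GaussianInt.intCast_real_norm, Complex.sq_norm]

/-- Let γ = gcd(v, w) in ℤ[i]. Division by γ is a similarity onto an integral lattice, so
irreducibility forces N(γ) = 1. A common factor m divides v̄v, v̄w and w̄w, hence γ̄γ = 1 by Bézout.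
-/
theorem IsIrreducibleLattice.isPrimitive {v w : ℂ} (hv : IsInt v) (hw : IsInt w)
    (h : IsIrreducibleLattice (lat v w)) : IsPrimitive v w := by
  obtain ⟨v, rfl⟩ := isInt_iff.mp hv
  obtain ⟨w, rfl⟩ := isInt_iff.mp hw
  rintro m ⟨A, hA⟩ ⟨C, hC⟩ ⟨B, hB⟩ ⟨D, hD⟩
  have hg0 : EuclideanDomain.gcd v w ≠ 0 := by
    intro h0
    rw [EuclideanDomain.gcd_eq_zero_iff] at h0
    apply h.1.1
    rw [h0.1, h0.2, lat]
    simp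
  obtain ⟨v', hv'⟩ := EuclideanDomain.gcd_dvd_left v w
  obtain ⟨w', hw'⟩ := EuclideanDomain.gcd_dvd_right v w
  have hbez := EuclideanDomain.gcd_eq_gcd_ab v w
  set γ := EuclideanDomain.gcd v w with hγ
  set x := EuclideanDomain.gcdA v w
  set y := EuclideanDomain.gcdB v w
  have hγn : (γ : ℂ) ≠ 0 := fun h0 => hg0 (GaussianInt.toComplex_eq_zero.mp h0)
  have hγpos : (0 : ℝ) < ‖(γ : ℂ)‖ := norm_pos_iff.mpr hγn
  have hγ1 : γ.norm = 1 := by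
    by_contra hne
    have hpos : 0 < γ.norm := GaussianInt.norm_pos.mpr hg0
    have h2 : (2 : ℤ) ≤ γ.norm := by omega
    have h2' : (2 : ℝ) ≤ ‖(γ : ℂ)‖ ^ 2 := by
      rw [norm_sq_gaussian]; exact_mod_cast h2
    apply h.2
    obtain ⟨g, hg⟩ := exists_mul_isometry (c := (γ : ℂ) / ‖(γ : ℂ)‖) (by
      rw [norm_div, Complex.norm_real, norm_norm, div_self hγpos.ne'])
    have hgs : ∀ z, ‖(γ : ℂ)‖ • g z = γ * z := by
      intro z
      have : ((‖(γ : ℂ)‖ : ℝ) : ℂ) ≠ 0 := by exact_mod_cast hγpos.ne'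
      rw [hg, Complex.real_smul]
      field_simp
    refine ⟨‖(γ : ℂ)‖, lat v' w', by nlinarith, ⟨?_, v', w', isInt_iff.mpr ⟨_, rfl⟩,
      isInt_iff.mpr ⟨_, rfl⟩, rfl⟩, similarBy_iff.mpr ⟨g, ?_⟩⟩
    · intro h0
      have h1 : (v' : ℂ) = 0 := by simpa [h0] using left_mem_lat (v' : ℂ) w'
      have h2 : (w' : ℂ) = 0 := by simpa [h0] using right_mem_lat (v' : ℂ) w'
      apply h.1.1
      rw [hv', hw', GaussianInt.toComplex_mul, GaussianInt.toComplex_mul, h1, h2, lat]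
      simp
    · rw [hgs, hgs, ← GaussianInt.toComplex_mul, ← GaussianInt.toComplex_mul, ← hv', ← hw']
  have hmC : ∀ {z : GaussianInt} {k l : ℤ} {a b : ℝ}, (z : ℂ) = ⟨a, b⟩ → a = m * k → b = m * l →
      (m : GaussianInt) ∣ z := by
    rintro z k l a b hz rfl rfl
    refine ⟨⟨k, l⟩, GaussianInt.toComplex_inj.mp ?_⟩
    rw [hz, GaussianInt.toComplex_mul, GaussianInt.toComplex_def₂]
    apply Complex.ext <;> simp
  have hself : ∀ z : ℂ, cross z z = 0 := fun z => by simp only [cross]; ring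
  have d1 : (m : GaussianInt) ∣ star v * v := hmC (k := A) (l := 0)
    (by rw [GaussianInt.toComplex_mul, GaussianInt.toComplex_star, conj_mul_eq])
    (by rw [dot_self, hA]) (by rw [hself]; simp)
  have d2 : (m : GaussianInt) ∣ star v * w := hmC (k := B) (l := D)
    (by rw [GaussianInt.toComplex_mul, GaussianInt.toComplex_star, conj_mul_eq]) hB hD
  have d3 : (m : GaussianInt) ∣ star w * v := hmC (k := B) (l := -D)
    (by rw [GaussianInt.toComplex_mul, GaussianInt.toComplex_star, conj_mul_eq])
    (by rw [← hB]; simp only [dot]; ring) (by push_cast; rw [mul_neg, ← hD]; simp only [cross]; ring)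
  have d4 : (m : GaussianInt) ∣ star w * w := hmC (k := C) (l := 0)
    (by rw [GaussianInt.toComplex_mul, GaussianInt.toComplex_star, conj_mul_eq])
    (by rw [dot_self, hC]) (by rw [hself]; simp)
  have e1 : (m : GaussianInt) ∣ star v * γ := by
    rw [hbez, mul_add, ← mul_assoc, ← mul_assoc]
    exact dvd_add (d1.mul_right x) (d2.mul_right y)
  have e2 : (m : GaussianInt) ∣ star w * γ := by
    rw [hbez, mul_add, ← mul_assoc, ← mul_assoc]
    exact dvd_add (d3.mul_right x) (d4.mul_right y)
  have hstar : ∀ {z : GaussianInt}, (m : GaussianInt) ∣ z → (m : GaussianInt) ∣ star z := by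
    rintro _ ⟨z, rfl⟩
    rw [star_mul, star_natCast]
    exact Dvd.intro_left _ rfl
  have f1 : (m : GaussianInt) ∣ star γ * γ := by
    have h1 := hstar e1
    have h2 := hstar e2
    rw [star_mul, star_star] at h1 h2
    have : star γ * γ = (star γ * v) * x + (star γ * w) * y := by
      linear_combination (star γ) * hbez
    rw [this]
    exact dvd_add (h1.mul_right x) (h2.mul_right y)
  have hγγ : star γ * γ = 1 := by
    rw [mul_comm, ← Zsqrtd.norm_eq_mul_conj, hγ1]; simp
  rw [hγγ] at f1
  obtain ⟨z, hz⟩ := f1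
  have hn := congrArg Zsqrtd.norm hz
  rw [Zsqrtd.norm_one, Zsqrtd.norm_mul, Zsqrtd.norm_natCast] at hn
  have hu : IsUnit (m : ℤ) := IsUnit.of_mul_eq_one (m * z.norm) (by linarith)
  have := Int.isUnit_iff.mp hu
  omega

/-- An integral Gram matrix whose determinant is a square is realized by integral vectors. -/
theorem exists_int_of_gram {A B C D : ℤ} (hA : 0 ≤ A) (hC : 0 ≤ C) (hdet : A * C = B ^ 2 + D ^ 2)
    (hgcd : ∀ m : ℕ, (m : ℤ) ∣ A → (m : ℤ) ∣ B → (m : ℤ) ∣ C → (m : ℤ) ∣ D → m = 1) :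
    ∃ v w : ℂ, IsInt v ∧ IsInt w ∧ ‖v‖ ^ 2 = A ∧ ‖w‖ ^ 2 = C ∧ dot v w = B := by
  rcases hA.eq_or_lt with rfl | hA
  · have hB : B = 0 := by nlinarith [sq_nonneg B, sq_nonneg D]
    have hD : D = 0 := by nlinarith [sq_nonneg B, sq_nonneg D]
    have hC1 : C = 1 := by
      have := hgcd C.natAbs (by simp) (by simp [hB]) (by simp) (by simp [hD])
      omega
    exact ⟨0, 1, ⟨0, 0, by apply Complex.ext <;> simp⟩, ⟨1, 0, by apply Complex.ext <;> simp⟩,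
      by simp, by simp [hC1], by simp [hB, dot]⟩
  -- The aim is v̄w = β := B + iD with |v|² = A, where β̄β = AC. The candidate is v = γ̄ and w = β/γ
  -- for γ = gcd(A, β), so that only N(γ) = A is to be shown.
  set β : GaussianInt := ⟨B, D⟩ with hβ
  set α : GaussianInt := (A : GaussianInt) with hα
  have hα0 : α ≠ 0 := by
    rw [hα]; exact_mod_cast hA.ne'
  have hββ : star β * β = α * C := by
    rw [hα, hβ]
    ext <;> simp <;> linarith
  have hg0 : EuclideanDomain.gcd α β ≠ 0 := fun h0 =>
    hα0 (EuclideanDomain.gcd_eq_zero_iff.mp h0).1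
  obtain ⟨a', ha'⟩ := EuclideanDomain.gcd_dvd_left α β
  obtain ⟨b', hb'⟩ := EuclideanDomain.gcd_dvd_right α β
  have hbez := EuclideanDomain.gcd_eq_gcd_ab α β
  set γ := EuclideanDomain.gcd α β with hγ
  set x := EuclideanDomain.gcdA α β
  set y := EuclideanDomain.gcdB α β
  have hsα : star α = α := by rw [hα]; simp
  have hγγ : (α : GaussianInt) ∣ star γ * γ := by
    refine ⟨star x * x * α + star x * y * β + star y * star β * x + star y * y * C, ?_⟩
    rw [hbez, star_add, star_mul, star_mul, hsα]
    linear_combination (star y * y) * hββ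
  have hnorm : ((γ.norm : ℤ) : GaussianInt) = star γ * γ := by
    rw [Zsqrtd.norm_eq_mul_conj, mul_comm]
  obtain ⟨m, hm⟩ : A ∣ γ.norm := by
    rw [← hnorm, hα] at hγγ
    exact (Zsqrtd.intCast_dvd_intCast _ _).mp hγγ
  have hγpos : 0 < γ.norm := GaussianInt.norm_pos.mpr hg0
  have hmpos : 0 < m := pos_of_mul_pos_right (hm ▸ hγpos) hA.le
  -- Here mA = N(γ). Applied to A·A, A·β and β̄β = AC, this shows that m divides A, B, C and D, so m
  -- = 1.
  have hstar : ∀ z z' : GaussianInt, γ ∣ z → γ ∣ z' → (m : GaussianInt) * α ∣ star z * z' := by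
    rintro _ _ ⟨z, rfl⟩ ⟨z', rfl⟩
    refine ⟨star z * z', ?_⟩
    have : (m : GaussianInt) * α = star γ * γ := by
      rw [← hnorm, hm, hα]; push_cast; ring
    rw [this, star_mul]; ring
  have hcancel : ∀ z, (m : GaussianInt) * α ∣ α * z → (m : GaussianInt) ∣ z := by
    intro z hz
    rw [mul_comm (m : GaussianInt)] at hz
    exact (mul_dvd_mul_iff_left hα0).mp hz
  have e1 : (m : GaussianInt) ∣ α :=
    hcancel _ (by simpa only [hsα] using hstar α α ⟨_, ha'⟩ ⟨_, ha'⟩)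
  have e2 : (m : GaussianInt) ∣ β :=
    hcancel _ (by simpa only [hsα] using hstar α β ⟨_, ha'⟩ ⟨_, hb'⟩)
  have e3 : (m : GaussianInt) ∣ (C : GaussianInt) :=
    hcancel _ (by rw [← hββ]; exact hstar β β ⟨_, hb'⟩ ⟨_, hb'⟩)
  rw [Zsqrtd.intCast_dvd] at e1 e2 e3
  have hm1 : m = 1 := by
    have := hgcd m.natAbs (by simpa [hα] using e1.1) (by simpa using e2.1) (by simpa using e3.1)
      (by simpa using e2.2)
    omega
  have hγn : ‖(γ : ℂ)‖ ^ 2 = A := by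
    rw [norm_sq_gaussian, hm, hm1]; push_cast; ring
  have hA0 : (A : ℝ) ≠ 0 := by exact_mod_cast hA.ne'
  have hdot : dot ((star γ : GaussianInt) : ℂ) b' = B ∧
      ‖(b' : ℂ)‖ ^ 2 = C := by
    have h1 : (γ : ℂ) * b' = ⟨B, D⟩ := by
      rw [← GaussianInt.toComplex_mul, ← hb', GaussianInt.toComplex_def₂]
    constructor
    · have h2 := conj_mul_eq ((star γ : GaussianInt) : ℂ) b'
      rw [GaussianInt.toComplex_star, Complex.conj_conj, h1] at h2
      rw [GaussianInt.toComplex_star]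
      exact (congrArg Complex.re h2).symm
    · have h3 := congrArg (fun z => ‖z‖ ^ 2) h1
      simp only [norm_mul, mul_pow, hγn, norm_sq_eq ⟨B, D⟩] at h3
      apply mul_left_cancel₀ hA0
      rw [h3]
      exact_mod_cast hdet.symm
  refine ⟨((star γ : GaussianInt) : ℂ), b', isInt_iff.mpr ⟨_, rfl⟩, isInt_iff.mpr ⟨_, rfl⟩, ?_,
    hdot.2, hdot.1⟩
  rw [GaussianInt.toComplex_star, RCLike.norm_conj, hγn]

/-! ### Principal configurations -/

/-- A Descartes configuration with sorted curvatures, starting with a major disk, in which no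
exchange decreases the curvatures. -/
structure IsPrincipal (E : Fin 4 → Disk) : Prop where
  descartes : IsDescartes E
  major : (E 0).curv ≤ 0
  le₁₂ : (E 1).curv ≤ (E 2).curv
  le₂₃ : (E 2).curv ≤ (E 3).curv
  le₃ : (E 3).curv ≤ (E 0).curv + (E 1).curv + (E 2).curv

theorem IsPrincipal.isRoot {E : Fin 4 → Disk} (h : IsPrincipal E) : IsRoot E := by
  obtain ⟨hE, h0, h1, h2, h3⟩ := h
  have h01 := (hE 0 1 (by decide)).curv_add_nonneg
  intro i
  rw [Fin.sum_univ_four]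
  fin_cases i <;> simp <;> linarith

theorem IsSpinorTriple.norm_sq {E : Fin 4 → Disk} {a b : ℂ} (hE : IsDescartes E)
    (h : IsSpinorTriple E a b) : ‖a‖ ^ 2 = (E 0).curv + (E 1).curv ∧
      ‖b‖ ^ 2 = (E 0).curv + (E 2).curv ∧ ‖a - b‖ ^ 2 = (E 0).curv + (E 3).curv :=
  ⟨h.one.norm_sq (hE 0 1 (by decide)), h.two.norm_sq (hE 0 2 (by decide)),
    h.three.norm_sq (hE 0 3 (by decide))⟩

theorem IsSpinorTriple.dot_eq {E : Fin 4 → Disk} {a b : ℂ} (hE : IsDescartes E)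
    (h : IsSpinorTriple E a b) :
    2 * dot a b = (E 0).curv + (E 1).curv + (E 2).curv - (E 3).curv := by
  obtain ⟨h1, h2, h3⟩ := h.norm_sq hE
  rw [norm_sq_sub] at h3
  linarith

theorem IsSpinorTriple.cross_sq {E : Fin 4 → Disk} {a b : ℂ} (hE : IsDescartes E)
    (h : IsSpinorTriple E a b) : cross a b ^ 2 = (E 0).curv ^ 2 :=
  cross_sq_spinor h.one h.two (hE 0 1 (by decide)) (hE 0 2 (by decide)) (hE 1 2 (by decide))

theorem IsSpinorTriple.curv_eq {E : Fin 4 → Disk} {a b : ℂ} (hE : IsDescartes E)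
    (h : IsSpinorTriple E a b) (h0 : (E 0).curv ≤ 0) : (E 0).curv = -|cross a b| := by
  rw [(sq_eq_sq_iff_abs_eq_abs _ _).mp (h.cross_sq hE), abs_of_nonpos h0, neg_neg]

/-- The dictionary for curvatures bᵢ: |a| ≤ |b| means b₁ ≤ b₂, 2 a·b ≤ |a|² means b₂ ≤ b₃, and a·b ≥
0 means b₃ ≤ b₀ + b₁ + b₂. -/
theorem IsSpinorTriple.isPrincipal {E : Fin 4 → Disk} {a b : ℂ} (hE : IsDescartes E)
    (h : IsSpinorTriple E a b) (h0 : (E 0).curv ≤ 0) (hr : IsReduced a b) : IsPrincipal E := by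
  obtain ⟨h1, h2, h3⟩ := h.norm_sq hE
  have hd := h.dot_eq hE
  obtain ⟨r1, r2, r3⟩ := (isReduced_iff a b).mp hr
  exact ⟨hE, h0, by linarith, by linarith, by linarith⟩

theorem IsPrincipal.isReduced {E : Fin 4 → Disk} {a b : ℂ} (hE : IsPrincipal E)
    (h : IsSpinorTriple E a b) : IsReduced a b := by
  obtain ⟨h1, h2, h3⟩ := h.norm_sq hE.descartes
  have hd := h.dot_eq hE.descartes
  obtain ⟨-, -, r1, r2, r3⟩ := hE
  exact (isReduced_iff a b).mpr ⟨by linarith, by linarith, by linarith⟩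

theorem IsPrincipal.isPrincipalBasis {E : Fin 4 → Disk} {a b : ℂ} (hE : IsPrincipal E)
    (h : IsSpinorTriple E a b) : IsPrincipalBasis (coronaLattice (packing E) (E 0)) a b :=
  ⟨h.coronaLattice_eq hE.descartes, hE.isReduced h⟩

theorem IsPrincipal.right_ne_zero {E : Fin 4 → Disk} {a b : ℂ} (hE : IsPrincipal E)
    (h : IsSpinorTriple E a b) : b ≠ 0 := by
  rintro rfl
  obtain ⟨h1, h2, h3⟩ := h.norm_sq hE.descartes
  have hc := h.cross_sq hE.descartes
  have hpos := hE.descartes.exists_pos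
  obtain ⟨-, -, r1, r2, r3⟩ := hE
  have h0 : (E 0).curv = 0 := by
    simp only [cross, Complex.zero_re, Complex.zero_im, mul_zero] at hc
    simpa using hc.symm
  rw [norm_zero] at h2
  rw [Fin.sum_univ_four] at hpos
  linarith

theorem IsSpinorTriple.of_isFan {E F : Fin 4 → Disk} {a b : ℂ} {s t : ℤ × ℤ}
    (h : IsSpinorTriple E a b) (hF : IsFan E F s t) :
    IsSpinorTriple F (comb a b s) (comb a b t) := by
  refine ⟨?_, ?_, ?_⟩
  · rw [hF.zero]; exact h.cone hF.one
  · rw [hF.zero]; exact h.cone hF.two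
  · rw [hF.zero]
    have := h.cone hF.three
    rw [Prod.fst_sub, Prod.snd_sub] at this
    convert this using 1
    simp only [comb]
    push_cast
    ring

/-- The spinor coordinates of the disks with the spinors of a principal basis form a basis. -/
theorem IsPrincipal.det_sq {E : Fin 4 → Disk} {a b : ℂ} (hE : IsPrincipal E)
    (h : IsSpinorTriple E a b) {s t s' : ℤ × ℤ} (hs : det s s' ^ 2 = 1)
    (hl : lat a b = lat (comb a b s) (comb a b t))
    (hr : IsReduced (comb a b s) (comb a b t)) : det s t ^ 2 = 1 := by
  have hcr := abs_cross_eq_of_lat_eq hl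
  rcases eq_or_ne (cross a b) 0 with h0 | h0
  -- For a strip a = 0, so spinors do not see the first coordinates and s, t are not determined.
  -- Still s.2 = 0, its companion s' forces s.1 = ±1, and t.2 = ±1.
  · obtain ⟨u, v, huv, hu, hv⟩ := exists_comb_of_lat_eq (hE.isReduced h) hr hl
    have hb := hE.right_ne_zero h
    have h0' : cross (comb a b s) (comb a b t) = 0 := by rw [cross_comb, h0, mul_zero]
    have ha := (hE.isReduced h).eq_zero_of_cross h0
    have ha' := hr.eq_zero_of_cross h0'
    subst ha
    rw [ha'] at hu
    simp only [comb, mul_zero, zero_add] at ha' hu hv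
    have hs2 : s.2 = 0 := by exact_mod_cast (mul_eq_zero.mp ha').resolve_right hb
    have hu2 : u.2 = 0 := by exact_mod_cast (mul_eq_zero.mp hu.symm).resolve_right hb
    have htv : t.2 = v.2 := by exact_mod_cast mul_right_cancel₀ hb hv
    have e1 : s.1 ^ 2 = 1 := by
      simp only [det, hs2, zero_mul, sub_zero] at hs
      have := Int.isUnit_iff.mp
        (isUnit_of_mul_isUnit_left (IsUnit.of_pow_eq_one hs two_ne_zero))
      rcases this with h | h <;> rw [h] <;> norm_num
    have e2 : v.2 ^ 2 = 1 := by
      simp only [det, hu2, zero_mul, sub_zero] at huv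
      have := Int.isUnit_iff.mp
        (isUnit_of_mul_isUnit_right (IsUnit.of_pow_eq_one huv two_ne_zero))
      rcases this with h | h <;> rw [h] <;> norm_num
    simp only [det, hs2, zero_mul, sub_zero, htv, mul_pow, e1, e2, mul_one]
  · rw [cross_comb, abs_mul] at hcr
    have h2 : |(det s t : ℝ)| = 1 :=
      (mul_right_cancel₀ (abs_ne_zero.mpr h0) (by rw [one_mul]; exact hcr)).symm
    have h3 : (det s t : ℝ) ^ 2 = 1 := by rw [← sq_abs, h2]; norm_num
    exact_mod_cast h3

theorem IsPrincipal.exists_disk {E : Fin 4 → Disk} {a b a' b' : ℂ} (hE : IsPrincipal E)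
    (h : IsSpinorTriple E a b) (h' : IsPrincipalBasis (lat a b) a' b') :
    (∃ d₁ ∈ corona (packing E) (E 0), IsSpinor (E 0) d₁ a') ∧
      ∃ d₂ ∈ corona (packing E) (E 0), IsSpinor (E 0) d₂ b' := by
  obtain ⟨s, t, hst, rfl, rfl⟩ := exists_comb_of_lat_eq (hE.isReduced h) h'.2 h'.1
  obtain ⟨F, hF, hP, hfan⟩ := exists_fan hE.descartes hst
  have ht := h.of_isFan hfan
  rw [← hP, ← hfan.zero]
  exact ⟨⟨F 1, ⟨mem_packing F 1, hF 0 1 (by decide)⟩, ht.one⟩,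
    ⟨F 2, ⟨mem_packing F 2, hF 0 2 (by decide)⟩, ht.two⟩⟩

/-- `cone` is even, so the sign of the coordinates can be adapted to the given spinor. -/
theorem corona_comb {E : Fin 4 → Disk} {a b u : ℂ} (hE : IsDescartes E) (h : IsSpinorTriple E a b)
    {e : Disk} (he : e ∈ corona (packing E) (E 0)) (hu : IsSpinor (E 0) e u) :
    ∃ s t, det s t ^ 2 = 1 ∧ e.vec + (E 0).vec = cone E s ∧ u = comb a b s := by
  obtain ⟨s, t, hst, hs⟩ := corona_cone hE he
  rcases hu.eq_or_eq_neg (h.cone hs) with rfl | rfl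
  · exact ⟨s, t, hst, hs, rfl⟩
  · refine ⟨-s, t, ?_, by rw [cone_neg, hs], ?_⟩
    · rw [← hst]; simp only [det, Prod.fst_neg, Prod.snd_neg]; ring
    · simp only [comb, Prod.fst_neg, Prod.snd_neg]; push_cast; ring

/-- The disks whose spinors form a principal basis belong to a principal configuration. -/
theorem IsPrincipal.exists_principal {E : Fin 4 → Disk} {a b a' b' : ℂ} (hE : IsPrincipal E)
    (h : IsSpinorTriple E a b) (h' : IsPrincipalBasis (lat a b) a' b') {d₁ d₂ : Disk}
    (h₁ : d₁ ∈ corona (packing E) (E 0)) (h₂ : d₂ ∈ corona (packing E) (E 0))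
    (s₁ : IsSpinor (E 0) d₁ a') (s₂ : IsSpinor (E 0) d₂ b') :
    ∃ d₃, IsPrincipal ![E 0, d₁, d₂, d₃] ∧ IsSpinorTriple ![E 0, d₁, d₂, d₃] a' b' ∧
      packing ![E 0, d₁, d₂, d₃] = packing E := by
  obtain ⟨s, s', hs, hds, rfl⟩ := corona_comb hE.descartes h h₁ s₁
  obtain ⟨t, t', -, hdt, rfl⟩ := corona_comb hE.descartes h h₂ s₂
  obtain ⟨F, hF, hP, hfan⟩ := exists_fan hE.descartes (hE.det_sq h hs h'.1 h'.2)
  have h1 : F 1 = d₁ := Disk.vec_injective (add_right_cancel (hfan.one.trans hds.symm))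
  have h2 : F 2 = d₂ := Disk.vec_injective (add_right_cancel (hfan.two.trans hdt.symm))
  have hFeq : ![E 0, d₁, d₂, F 3] = F := by
    funext i
    fin_cases i
    · exact hfan.zero.symm
    · exact h1.symm
    · exact h2.symm
    · rfl
  have ht := h.of_isFan hfan
  refine ⟨F 3, ?_⟩
  rw [hFeq]
  exact ⟨ht.isPrincipal hF (by rw [hfan.zero]; exact hE.major) h'.2, ht, hP⟩

/-- Only a disk of largest curvature can violate the root condition. After sorting this is the last
disk, which also dominates the major one because b₀ ≤ 0 ≤ b₀ + b₃. -/
theorem IsPrincipal.of_perm {D : Fin 4 → Disk} (hD : IsDescartes D)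
    (h : ∀ i, (∀ j, (D j).curv ≤ (D i).curv) → 2 * (D i).curv ≤ ∑ j, (D j).curv)
    {σ : Equiv.Perm (Fin 4)} (h0 : (D (σ 0)).curv ≤ 0) (h12 : (D (σ 1)).curv ≤ (D (σ 2)).curv)
    (h23 : (D (σ 2)).curv ≤ (D (σ 3)).curv) : IsPrincipal (D ∘ σ) := by
  refine ⟨hD.perm σ, h0, h12, h23, ?_⟩
  have h03 := (hD.perm σ 0 3 (by decide)).curv_add_nonneg
  simp only [Function.comp] at h03 ⊢
  have := h (σ 3) (fun j => by
    obtain ⟨i, rfl⟩ := σ.surjective j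
    fin_cases i <;> simp <;> linarith)
  rw [← Equiv.sum_comp σ, Fin.sum_univ_four] at this
  linarith

theorem exists_perm_sort (f : Fin 4 → ℝ) :
    ∃ σ : Equiv.Perm (Fin 4), σ 0 = 0 ∧ f (σ 1) ≤ f (σ 2) ∧ f (σ 2) ≤ f (σ 3) := by
  have hm := Tuple.monotone_sort (fun i : Fin 3 => f i.succ)
  set τ := Tuple.sort (fun i : Fin 3 => f i.succ)
  have hs : ∀ i : Fin 3, Equiv.Perm.decomposeFin.symm (0, τ) i.succ = (τ i).succ := by
    intro i; simp
  refine ⟨Equiv.Perm.decomposeFin.symm (0, τ), by simp, ?_, ?_⟩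
  · rw [show (1 : Fin 4) = Fin.succ 0 from rfl, show (2 : Fin 4) = Fin.succ 1 from rfl, hs, hs]
    exact hm (by decide)
  · rw [show (2 : Fin 4) = Fin.succ 1 from rfl, show (3 : Fin 4) = Fin.succ 2 from rfl, hs, hs]
    exact hm (by decide)

theorem exists_isMajor {P : Set Disk} (hP : IsPacking P) (hI : IsIntegralPacking P) :
    ∃ d₀, IsMajor P d₀ := by
  obtain ⟨D, hD, rfl⟩ := hP
  obtain ⟨E, ⟨hE, hPE⟩, hr⟩ := exists_minimal Set.univ
    (fun E => IsDescartes E ∧ packing E = packing D) D ⟨hD, rfl⟩ (fun E h => h.1)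
    (fun E h i => hI _ (h.2 ▸ mem_packing E i))
    (fun E E' i _ h hs => ⟨hs.isDescartes h.1, (packing_swap h.1 hs).trans h.2⟩)
  obtain ⟨i, hi⟩ := IsRoot.exists_nonpos hE fun i => hr i (Set.mem_univ i)
  exact ⟨E i, hPE ▸ mem_packing E i, hi⟩

/-- The curvature sum is minimized among configurations with d₀ in position 0, using exchanges of
the other three disks only; position 0 meets the root condition since its curvature is nonpositive
and the sum positive. -/
theorem exists_isPrincipal {P : Set Disk} (hP : IsPacking P) (hI : IsIntegralPacking P) {d₀ : Disk}
    (hd : IsMajor P d₀) : ∃ E, IsPrincipal E ∧ E 0 = d₀ ∧ packing E = P := by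
  obtain ⟨D, hD, rfl⟩ := hP
  obtain ⟨⟨F, hF, i, rfl⟩, h0⟩ := hd
  obtain ⟨E, ⟨hE, hPE, hE0⟩, hr⟩ := exists_minimal {0}ᶜ
    (fun E => IsDescartes E ∧ packing E = packing D ∧ E 0 = F i) (F ∘ Equiv.swap 0 i)
    ⟨(hF.isDescartes hD).perm _, (packing_perm _ _).trans (packing_eq_of_reach hD hF), by simp⟩
    (fun E h => h.1) (fun E h i => hI _ (h.2.1 ▸ mem_packing E i))
    (fun E E' i hi h hs => ⟨hs.isDescartes h.1, (packing_swap h.1 hs).trans h.2.1,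
      (hs.1 0 (Ne.symm hi)).trans h.2.2⟩)
  obtain ⟨σ, hσ, h12, h23⟩ := exists_perm_sort fun i => (E i).curv
  have h0' : (E 0).curv ≤ 0 := hE0 ▸ h0
  refine ⟨E ∘ σ, IsPrincipal.of_perm hE ?_ (by rw [hσ]; exact h0') h12 h23, by simp [hσ, hE0],
    (packing_perm _ _).trans hPE⟩
  intro i hi
  by_cases hi0 : i = 0
  · have hpos := hE.exists_pos
    rw [hi0]; linarith
  · exact hr i hi0

theorem IsMaximal.exists_isPrincipal {D : Fin 4 → Disk} (hD : IsDescartes D) (hm : IsMaximal D) :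
    ∃ σ : Equiv.Perm (Fin 4), IsPrincipal (D ∘ σ) := by
  have hr := hm.isRoot hD
  have hs := Tuple.monotone_sort fun i => (D i).curv
  set σ := Tuple.sort fun i => (D i).curv
  refine ⟨σ, IsPrincipal.of_perm hD (fun i _ => hr i) ?_ (hs (by decide : (1 : Fin 4) ≤ 2))
    (hs (by decide : (2 : Fin 4) ≤ 3))⟩
  obtain ⟨i, hi⟩ := hr.exists_nonpos hD
  obtain ⟨j, rfl⟩ := σ.surjective i
  exact (hs (Fin.zero_le j)).trans hi

/-- The principal bases of the spinor lattice of the corona of a major disk. -/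
theorem principal_basis_of_isMajor {P : Set Disk} (hP : IsPacking P) (hI : IsIntegralPacking P)
    {d₀ : Disk} (hd : IsMajor P d₀) :
    (∃ a b : ℂ, IsPrincipalBasis (coronaLattice P d₀) a b) ∧
      ∀ a b : ℂ, IsPrincipalBasis (coronaLattice P d₀) a b →
        (∃ d₁ ∈ corona P d₀, IsSpinor d₀ d₁ a) ∧
        (∃ d₂ ∈ corona P d₀, IsSpinor d₀ d₂ b) ∧
        ∀ d₁ ∈ corona P d₀, ∀ d₂ ∈ corona P d₀, IsSpinor d₀ d₁ a → IsSpinor d₀ d₂ b →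
          ∃ d₃ ∈ corona P d₀, IsSpinor d₀ d₃ (a - b) ∧
            IsDescartes ![d₀, d₁, d₂, d₃] ∧
            packing ![d₀, d₁, d₂, d₃] = P ∧
            IsMaximal ![d₀, d₁, d₂, d₃] ∧
            d₀.curv = -|cross a b| ∧
            d₁.curv = |cross a b| + ‖a‖ ^ 2 ∧
            d₂.curv = |cross a b| + ‖b‖ ^ 2 ∧
            d₃.curv = |cross a b| + ‖a - b‖ ^ 2 := by
  obtain ⟨E, hE, rfl, rfl⟩ := exists_isPrincipal hP hI hd
  obtain ⟨a, b, h⟩ := hE.descartes.exists_spinorTriple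
  refine ⟨⟨a, b, hE.isPrincipalBasis h⟩, fun a' b' h' => ?_⟩
  rw [h.coronaLattice_eq hE.descartes] at h'
  obtain ⟨e1, e2⟩ := hE.exists_disk h h'
  refine ⟨e1, e2, fun d₁ h₁ d₂ h₂ s₁ s₂ => ?_⟩
  obtain ⟨d₃, hp, ht, hpack⟩ := hE.exists_principal h h' h₁ h₂ s₁ s₂
  have hF := hp.descartes
  have hc := ht.curv_eq hF hp.major
  obtain ⟨n1, n2, n3⟩ := ht.norm_sq hF
  refine ⟨d₃, ⟨?_, hF 0 3 (by decide)⟩, ht.three, hF, hpack, hp.isRoot.isMaximal hF, hc, ?_, ?_, ?_⟩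
  · rw [← hpack]
    exact mem_packing ![E 0, d₁, d₂, d₃] 3
  · rw [n1, hc]
    simp
  · rw [n2, hc]
    simp
  · rw [n3, hc]
    simp

/-- Every maximal configuration arises from a principal basis. -/
theorem principal_basis_of_isMaximal {D : Fin 4 → Disk} (hD : IsDescartes D) (hm : IsMaximal D) :
    ∃ (σ : Equiv.Perm (Fin 4)) (a b : ℂ),
      IsMajor (packing D) (D (σ 0)) ∧
      IsPrincipalBasis (coronaLattice (packing D) (D (σ 0))) a b ∧
      IsSpinor (D (σ 0)) (D (σ 1)) a ∧
      IsSpinor (D (σ 0)) (D (σ 2)) b ∧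
      IsSpinor (D (σ 0)) (D (σ 3)) (a - b) := by
  obtain ⟨σ, hE⟩ := hm.exists_isPrincipal hD
  obtain ⟨a, b, h⟩ := hE.descartes.exists_spinorTriple
  have hb := hE.isPrincipalBasis h
  rw [packing_perm] at hb
  exact ⟨σ, a, b, ⟨mem_packing D _, hE.major⟩, hb, h.one, h.two, h.three⟩

end Apollonian

-- Provides the small steps t > 0 used to compare two regions along a ray from a boundary point.
open Filter Topology in
theorem exists_pos_of_continuous {f g : ℝ → ℝ} (hf : Continuous f) (hg : Continuous g)
    (hf0 : 0 < f 0) (hg0 : 0 < g 0) : ∃ t > 0, 0 < f t ∧ 0 < g t := by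
  have h1 : ∀ᶠ t in 𝓝[>] (0 : ℝ), 0 < f t :=
    (hf.continuousAt.eventually (lt_mem_nhds hf0)).filter_mono nhdsWithin_le_nhds
  have h2 : ∀ᶠ t in 𝓝[>] (0 : ℝ), 0 < g t :=
    (hg.continuousAt.eventually (lt_mem_nhds hg0)).filter_mono nhdsWithin_le_nhds
  obtain ⟨t, ⟨h1, h2⟩, ht⟩ := ((h1.and h2).and self_mem_nhdsWithin).exists
  exact ⟨t, ht, h1, h2⟩

namespace Apollonian

/-! ### Euclidean motions -/

theorem dot_comm (a b : ℂ) : dot a b = dot b a := by simp only [dot]; ring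

theorem dot_add_left (a b c : ℂ) : dot (a + b) c = dot a c + dot b c := by
  simp only [dot, Complex.add_re, Complex.add_im]; ring

theorem dot_add_right (a b c : ℂ) : dot a (b + c) = dot a b + dot a c := by
  simp only [dot, Complex.add_re, Complex.add_im]; ring

theorem dot_mul_left (r : ℝ) (a b : ℂ) : dot (r * a) b = r * dot a b := by
  simp only [dot, Complex.re_ofReal_mul, Complex.im_ofReal_mul]; ring

theorem dot_mul_right (r : ℝ) (a b : ℂ) : dot a (r * b) = r * dot a b := by
  simp only [dot, Complex.re_ofReal_mul, Complex.im_ofReal_mul]; ring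

theorem map_ofReal_mul (g : ℂ ≃ₗᵢ[ℝ] ℂ) (r : ℝ) (z : ℂ) : g (r * z) = r * g z := by
  rw [← Complex.real_smul, map_smul, Complex.real_smul]

/-- The image of a disk under the motion `z ↦ g z + t`. -/
noncomputable def Disk.move (g : ℂ ≃ₗᵢ[ℝ] ℂ) (t : ℂ) (d : Disk) : Disk where
  curv := d.curv
  cen := g d.cen + d.curv * t
  cocurv := d.cocurv + 2 * dot (g d.cen) t + d.curv * ‖t‖ ^ 2
  norm_eq := by
    have h := d.norm_eq
    rw [norm_sq_add, g.norm_map, norm_mul, mul_pow, Complex.norm_real, Real.norm_eq_abs, sq_abs,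
      dot_mul_right]
    linarith

theorem carrier_move (g : ℂ ≃ₗᵢ[ℝ] ℂ) (t : ℂ) (d : Disk) :
    (d.move g t).carrier = (fun z => g z + t) '' d.carrier := by
  have key : ∀ z, (d.move g t).curv * ‖g z + t‖ ^ 2 - 2 * dot (d.move g t).cen (g z + t) +
      (d.move g t).cocurv = d.curv * ‖z‖ ^ 2 - 2 * dot d.cen z + d.cocurv := by
    intro z
    simp only [Disk.move, norm_sq_add, g.norm_map, dot_add_left, dot_add_right, dot_mul_left,
      dot_map, dot_self]
    rw [dot_comm t]
    ring
  ext w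
  constructor
  · intro hw
    refine ⟨g.symm (w - t), ?_, by simp⟩
    have h := key (g.symm (w - t))
    rw [g.apply_symm_apply, sub_add_cancel] at h
    exact (h.symm.le.trans hw : _ ≤ (0 : ℝ))
  · rintro ⟨z, hz, rfl⟩
    exact ((key z).le.trans hz : _ ≤ (0 : ℝ))

theorem inversive_move (g : ℂ ≃ₗᵢ[ℝ] ℂ) (t : ℂ) (d d' : Disk) :
    inversive (d.move g t) (d'.move g t) = inversive d d' := by
  simp only [inversive, Disk.move, dot_add_left, dot_add_right, dot_mul_left, dot_mul_right,
    dot_map, dot_self]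
  rw [dot_comm t]
  ring

/-- The orientation condition contains cocurvatures, which motions change; its reformulation by
curvatures is invariant. If the curvatures cancel, the reduced centres are opposite and the sum of
the cocurvatures is preserved. -/
theorem Tangent.move {d d' : Disk} (h : Tangent d d') (g : ℂ ≃ₗᵢ[ℝ] ℂ) (t : ℂ) :
    Tangent (d.move g t) (d'.move g t) := by
  have hi := (inversive_move g t d d').trans h.1
  refine (tangent_iff_of_inversive hi).mpr ?_
  rcases (tangent_iff_of_inversive h.1).mp h with hp | ⟨h0, hp⟩
  · exact Or.inl hp
  · refine Or.inr ⟨h0, ?_⟩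
    have hn := tangent_null h.1
    rw [h0, zero_mul] at hn
    have hz : d.cen + d'.cen = 0 := by simpa using hn
    have h1 : dot (g d.cen) t + dot (g d'.cen) t = 0 := by
      rw [← dot_add_left, ← map_add, hz, map_zero]
      simp [dot]
    have h2 : d.curv * ‖t‖ ^ 2 + d'.curv * ‖t‖ ^ 2 = 0 := by rw [← add_mul, h0, zero_mul]
    simp only [Disk.move]
    linarith

theorem move_move (g g' : ℂ ≃ₗᵢ[ℝ] ℂ) (t t' : ℂ) (d : Disk) :
    (d.move g t).move g' t' = d.move (g.trans g') (g' t + t') := by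
  ext1
  · rfl
  · simp only [Disk.move, map_add, map_ofReal_mul, LinearIsometryEquiv.trans_apply]
    ring
  · simp only [Disk.move, map_add, map_ofReal_mul, LinearIsometryEquiv.trans_apply, norm_sq_add,
      dot_add_left, dot_add_right, dot_mul_left, dot_map, g'.norm_map]
    ring

theorem move_refl_zero (d : Disk) : d.move (LinearIsometryEquiv.refl ℝ ℂ) 0 = d := by
  ext1 <;> simp [Disk.move, dot]

theorem move_symm_move (g : ℂ ≃ₗᵢ[ℝ] ℂ) (t : ℂ) (d : Disk) :
    (d.move g t).move g.symm (-g.symm t) = d := by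
  rw [move_move, add_neg_cancel, LinearIsometryEquiv.self_trans_symm, move_refl_zero]

theorem IsDescartes.move {E : Fin 4 → Disk} (hE : IsDescartes E) (g : ℂ ≃ₗᵢ[ℝ] ℂ) (t : ℂ) :
    IsDescartes fun i => (E i).move g t :=
  fun i j hij => (hE i j hij).move g t

theorem Reach.move {D E : Fin 4 → Disk} (h : Reach D E) (g : ℂ ≃ₗᵢ[ℝ] ℂ) (t : ℂ) :
    Reach (fun i => (D i).move g t) fun i => (E i).move g t := by
  induction h with
  | base => exact .base
  | step E E' i hE hE' heq ih =>
    exact .step _ _ i ih (hE'.move g t) fun j hj => by simp only [heq j hj]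

theorem packing_move (D : Fin 4 → Disk) (g : ℂ ≃ₗᵢ[ℝ] ℂ) (t : ℂ) :
    packing (fun i => (D i).move g t) = Disk.move g t '' packing D := by
  apply Set.Subset.antisymm
  · rintro d ⟨E, hE, i, rfl⟩
    have h := hE.move g.symm (-g.symm t)
    simp only [move_symm_move] at h
    refine ⟨_, ⟨_, h, i, rfl⟩, ?_⟩
    have := move_symm_move g.symm (-g.symm t) (E i)
    simpa using this
  · rintro _ ⟨_, ⟨E, hE, i, rfl⟩, rfl⟩
    exact ⟨_, hE.move g t, i, rfl⟩

/-- At a boundary point w the vector ν = cen - curv·w is the inward unit normal. A step along -ν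
leaves the first region, so w is not interior to the second; if the normals differed, a step along ν
- ν' would enter one region and leave the other. -/
theorem carrier_boundary {d d' : Disk} (h : d.carrier = d'.carrier) {w : ℂ}
    (hw : d.curv * ‖w‖ ^ 2 - 2 * dot d.cen w + d.cocurv = 0) :
    d'.curv * ‖w‖ ^ 2 - 2 * dot d'.cen w + d'.cocurv = 0 ∧
      d.cen - d.curv * w = d'.cen - d'.curv * w := by
  have val : ∀ (d : Disk) (w u : ℂ) (t : ℝ), d.curv * ‖w + t * u‖ ^ 2 - 2 * dot d.cen (w + t * u) +
      d.cocurv = (d.curv * ‖w‖ ^ 2 - 2 * dot d.cen w + d.cocurv) +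
        t * (d.curv * ‖u‖ ^ 2 * t - 2 * dot (d.cen - d.curv * w) u) := by
    intro d w u t
    rw [sub_eq_add_neg d.cen, ← neg_mul, ← Complex.ofReal_neg]
    simp only [norm_sq_add, dot_add_left, dot_add_right, dot_mul_left, dot_mul_right, norm_mul,
      mul_pow, Complex.norm_real, Real.norm_eq_abs, sq_abs]
    ring
  have unit : ∀ (d : Disk) (w : ℂ), ‖d.cen - d.curv * w‖ ^ 2 =
      1 + d.curv * (d.curv * ‖w‖ ^ 2 - 2 * dot d.cen w + d.cocurv) := by
    intro d w
    have := d.norm_eq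
    rw [norm_sq_sub, norm_mul, mul_pow, Complex.norm_real, Real.norm_eq_abs, sq_abs, dot_mul_right]
    linarith
  have mem : ∀ z, d.curv * ‖z‖ ^ 2 - 2 * dot d.cen z + d.cocurv ≤ 0 ↔
      d'.curv * ‖z‖ ^ 2 - 2 * dot d'.cen z + d'.cocurv ≤ 0 := fun z =>
    (Set.ext_iff.mp h z : z ∈ d.carrier ↔ z ∈ d'.carrier)
  have u1 := unit d w
  have u2 := unit d' w
  have v1 := val d w
  have v2 := val d' w
  rw [hw] at u1 v1
  have hle := (mem w).mp hw.le
  set ν := d.cen - d.curv * w with hν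
  set ν' := d'.cen - d'.curv * w with hν'
  have hw' : d'.curv * ‖w‖ ^ 2 - 2 * dot d'.cen w + d'.cocurv = 0 := by
    by_contra hne
    have hlt := lt_of_le_of_ne hle hne
    set c := d'.curv * ‖w‖ ^ 2 - 2 * dot d'.cen w + d'.cocurv
    obtain ⟨t, ht, h1, h2⟩ := exists_pos_of_continuous
      (f := fun t => d.curv * ‖-ν‖ ^ 2 * t - 2 * dot ν (-ν))
      (g := fun t => -(c + t * (d'.curv * ‖-ν‖ ^ 2 * t - 2 * dot ν' (-ν))))
      (by fun_prop) (by fun_prop) (by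
        have : dot ν (-ν) = -1 := by
          rw [show -ν = ((-1 : ℝ) : ℂ) * ν by push_cast; ring, dot_mul_right, dot_self, u1]
          ring
        rw [this]; norm_num) (by simpa using hlt)
    have h3 := (mem (w + t * -ν)).mpr (by rw [v2]; linarith)
    rw [v1] at h3
    have := mul_pos ht h1
    linarith
  rw [hw'] at u2 v2
  have hc : 1 ≤ dot ν ν' := by
    by_contra! hlt
    have e1 : dot ν (ν - ν') = 1 - dot ν ν' := by
      rw [show ν - ν' = ν + ((-1 : ℝ) : ℂ) * ν' by push_cast; ring, dot_add_right, dot_mul_right,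
        dot_self, u1]
      ring
    have e2 : dot ν' (ν - ν') = dot ν ν' - 1 := by
      rw [show ν - ν' = ν + ((-1 : ℝ) : ℂ) * ν' by push_cast; ring, dot_add_right, dot_mul_right,
        dot_self, u2, dot_comm]
      ring
    obtain ⟨t, ht, h1, h2⟩ := exists_pos_of_continuous
      (f := fun t => -(d.curv * ‖ν - ν'‖ ^ 2 * t - 2 * dot ν (ν - ν')))
      (g := fun t => d'.curv * ‖ν - ν'‖ ^ 2 * t - 2 * dot ν' (ν - ν'))
      (by fun_prop) (by fun_prop) (by rw [e1]; linarith) (by rw [e2]; linarith)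
    have h3 := (mem (w + t * (ν - ν'))).mp (by
      rw [v1]
      have := mul_pos ht h1
      linarith)
    rw [v2] at h3
    have := mul_pos ht h2
    linarith
  have h0 : ‖ν - ν'‖ ^ 2 ≤ 0 := by
    rw [norm_sq_sub, u1, u2]; linarith
  have h1 : ‖ν - ν'‖ ^ 2 = 0 := le_antisymm h0 (by positivity)
  exact ⟨hw', sub_eq_zero.mp (by simpa using h1)⟩

/-- A disk is determined by the region that it occupies. -/
theorem carrier_injective : Function.Injective Disk.carrier := by
  intro d d' h
  have hn := d.norm_eq
  -- Comparing the normals at two distinct boundary points yields two linear equations, which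
  -- determine curvature and reduced centre.
  obtain ⟨w, w', hne, hw, hw'⟩ : ∃ w w' : ℂ, w ≠ w' ∧
      d.curv * ‖w‖ ^ 2 - 2 * dot d.cen w + d.cocurv = 0 ∧
      d.curv * ‖w'‖ ^ 2 - 2 * dot d.cen w' + d.cocurv = 0 := by
    by_cases hb : d.curv = 0
    · rw [hb, zero_mul, sub_zero] at hn
      have hc : d.cen ≠ 0 := by
        intro h0; rw [h0] at hn; norm_num at hn
      have hI : dot d.cen (Complex.I * d.cen) = 0 := by simp [dot]; ring
      refine ⟨((d.cocurv / 2 : ℝ) : ℂ) * d.cen,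
        ((d.cocurv / 2 : ℝ) : ℂ) * d.cen + Complex.I * d.cen, ?_, ?_, ?_⟩
      · intro h0
        simp [hc] at h0
      · rw [hb, dot_mul_right, dot_self, hn]; ring
      · rw [hb, dot_add_right, hI, dot_mul_right, dot_self, hn]; ring
    · have hval : ∀ ν : ℂ, ‖ν‖ ^ 2 = 1 → d.curv * ‖((1 / d.curv : ℝ) : ℂ) * (d.cen + ν)‖ ^ 2 -
          2 * dot d.cen (((1 / d.curv : ℝ) : ℂ) * (d.cen + ν)) + d.cocurv = 0 := by
        intro ν hν
        rw [norm_mul, mul_pow, Complex.norm_real, Real.norm_eq_abs, sq_abs, dot_mul_right,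
          norm_sq_add, dot_add_right, dot_self, hν]
        field_simp
        linarith
      refine ⟨_, _, ?_, hval 1 (by simp), hval (-1) (by simp)⟩
      intro h0
      have h1 : ((1 / d.curv : ℝ) : ℂ) ≠ 0 := by
        exact_mod_cast one_div_ne_zero hb
      have h2 := add_left_cancel (mul_left_cancel₀ h1 h0)
      norm_num [Complex.ext_iff] at h2
  obtain ⟨h1, e1⟩ := carrier_boundary h hw
  obtain ⟨-, e2⟩ := carrier_boundary h hw'
  have hb : d.curv = d'.curv := by
    have : ((d.curv : ℂ) - d'.curv) * (w - w') = 0 := by linear_combination e2 - e1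
    have := (mul_eq_zero.mp this).resolve_right (sub_ne_zero.mpr hne)
    exact_mod_cast sub_eq_zero.mp this
  have hc : d.cen = d'.cen := by
    rw [hb] at e1
    exact sub_left_injective e1
  refine Disk.ext hb hc ?_
  rw [hb, hc] at hw
  linarith

/-- Isometries of the plane are affine by Mazur–Ulam, and regions determine disks, so congruence
becomes an action on coordinates. -/
theorem congruent_iff {P Q : Set Disk} :
    Congruent P Q ↔ ∃ (g : ℂ ≃ₗᵢ[ℝ] ℂ) (t : ℂ), Q = Disk.move g t '' P := by
  constructor
  · rintro ⟨f, hf⟩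
    refine ⟨f.toRealLinearIsometryEquiv, f 0, ?_⟩
    apply carrier_injective.image_injective
    rw [← hf, Set.image_image]
    apply Set.image_congr
    intro d _
    rw [carrier_move]
    apply Set.image_congr
    intro z _
    simp
  · rintro ⟨g, t, rfl⟩
    refine ⟨g.toIsometryEquiv.trans (IsometryEquiv.addRight t), ?_⟩
    rw [Set.image_image]
    apply Set.image_congr
    intro d _
    rw [carrier_move]
    rfl

/-- Descartes configurations with the same curvatures are congruent. -/
theorem exists_move_of_curv_eq {E E' : Fin 4 → Disk} (hE : IsDescartes E) (hE' : IsDescartes E')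
    (h : ∀ i, (E i).curv = (E' i).curv) :
    ∃ (g : ℂ ≃ₗᵢ[ℝ] ℂ) (t : ℂ), ∀ i, E' i = (E i).move g t := by
  -- With a disk of positive curvature centred at 0, its products with the others fix their
  -- cocurvatures; the remaining products then fix all dot products of reduced centres.
  obtain ⟨k, hk⟩ : ∃ k, 0 < (E k).curv := by
    by_contra! hc
    exact absurd hE.exists_pos (not_lt.mpr (Finset.sum_nonpos fun i _ => hc i))
  set r := LinearIsometryEquiv.refl ℝ ℂ
  have centre : ∀ E : Fin 4 → Disk, IsDescartes E → 0 < (E k).curv → ∃ c : ℂ,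
      ((E k).move r c).cen = 0 ∧ ((E k).move r c).cocurv = -(1 / (E k).curv) := by
    intro E hE hk
    have hc : ((E k).curv : ℂ) ≠ 0 := by exact_mod_cast hk.ne'
    have h0 : ((E k).move r (-((E k).cen / (E k).curv))).cen = 0 := by
      simp only [Disk.move, r, LinearIsometryEquiv.coe_refl, id]
      field_simp
      ring
    refine ⟨_, h0, ?_⟩
    have hn := ((E k).move r (-((E k).cen / (E k).curv))).norm_eq
    rw [h0, norm_zero] at hn
    have hb : ((E k).move r (-((E k).cen / (E k).curv))).curv = (E k).curv := rfl
    rw [hb] at hn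
    field_simp
    linarith
  obtain ⟨c, hc, hco⟩ := centre E hE hk
  obtain ⟨c', hc', hco'⟩ := centre E' hE' (h k ▸ hk)
  set F := fun i => (E i).move r c with hF
  set F' := fun i => (E' i).move r c' with hF'
  have hFD : IsDescartes F := hE.move r c
  have hFD' : IsDescartes F' := hE'.move r c'
  have hcur : ∀ i, (F i).curv = (F' i).curv := h
  have hkk : (F k).cocurv = (F' k).cocurv := by
    simp only [hF, hF', hco, hco', h]
  have hk' : 0 < (F k).curv := hk
  have hcoc : ∀ i, (F i).cocurv = (F' i).cocurv := by
    intro i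
    have h1 := (hFD.inversive_eq k i).trans (hFD'.inversive_eq k i).symm
    have z1 : (F k).cen = 0 := hc
    have z2 : (F' k).cen = 0 := hc'
    simp only [inversive, z1, z2, ← hcur, ← hkk, dot, Complex.zero_re, Complex.zero_im] at h1
    apply mul_left_cancel₀ hk'.ne'
    linarith
  obtain ⟨g, hg⟩ := exists_isometry_of_dot_eq (fun i => (F i).cen) (fun i => (F' i).cen) (by
    intro i j
    have h1 := (hFD.inversive_eq i j).trans (hFD'.inversive_eq i j).symm
    simp only [inversive, hcur, hcoc] at h1
    linarith)
  have hFF : ∀ i, F' i = (F i).move g 0 := by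
    intro i
    ext1
    · exact (hcur i).symm
    · simp [Disk.move, hg]
    · simp [Disk.move, hcoc, dot]
  refine ⟨(r.trans g).trans r.symm, r.symm (g c + 0) + -r.symm c', fun i => ?_⟩
  rw [← move_move, ← move_move, ← hFF, hF', move_symm_move]

/-! ### The correspondence between packings and lattices -/

/-- The curvatures of a packing are integral combinations of those of a configuration. -/
theorem curv_mem_of_mem_packing {D : Fin 4 → Disk} (hD : IsDescartes D) (H : AddSubgroup ℝ)
    (h : ∀ i, (D i).curv ∈ H) {d : Disk} (hd : d ∈ packing D) : d.curv ∈ H := by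
  obtain ⟨E, hE, j, rfl⟩ := hd
  obtain ⟨o, ho⟩ := hE.reduced hD
  clear hE
  induction ho generalizing j with
  | base => exact h j
  | step o i E E' _ _ hs ih =>
    by_cases hj : j = i
    · have h2 : ∀ x : ℝ, 2 * x = (2 : ℤ) • x := fun x => by simp
      have h3 : ∀ x : ℝ, 3 * x = (3 : ℤ) • x := fun x => by simp
      rw [hj, hs.curv, h2, h3]
      exact H.sub_mem (H.zsmul_mem (H.sum_mem fun j _ => ih j) 2) (H.zsmul_mem (ih i) 3)
    · rw [hs.1 j hj]
      exact ih j

theorem mem_multiples_iff (m : ℕ) (x : ℝ) :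
    x ∈ AddSubgroup.zmultiples (m : ℝ) ↔ ∃ k : ℤ, x = m * k := by
  rw [AddSubgroup.mem_zmultiples_iff]
  simp only [zsmul_eq_mul, mul_comm, eq_comm]

theorem curv_dvd_of_mem_packing {D : Fin 4 → Disk} (hD : IsDescartes D) (m : ℕ)
    (h : ∀ i, ∃ k : ℤ, (D i).curv = m * k) : ∀ d ∈ packing D, ∃ k : ℤ, d.curv = m * k :=
  fun _ hd => (mem_multiples_iff m _).mp
    (curv_mem_of_mem_packing hD _ (fun i => (mem_multiples_iff m _).mpr (h i)) hd)

theorem IsSpinorTriple.gram_eq {E F : Fin 4 → Disk} {a b a' b' : ℂ} (hE : IsDescartes E)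
    (hF : IsDescartes F) (h : IsSpinorTriple E a b) (h' : IsSpinorTriple F a' b')
    (heq : ∀ i, (E i).curv = (F i).curv) :
    ‖a‖ ^ 2 = ‖a'‖ ^ 2 ∧ ‖b‖ ^ 2 = ‖b'‖ ^ 2 ∧ dot a b = dot a' b' := by
  obtain ⟨n1, n2, -⟩ := h.norm_sq hE
  obtain ⟨n1', n2', -⟩ := h'.norm_sq hF
  have hd := h.dot_eq hE
  have hd' := h'.dot_eq hF
  simp only [heq] at n1 n2 hd
  exact ⟨by linarith, by linarith, by linarith⟩

/-- The spinor lattice of an irreducible packing is a rotated irreducible integral lattice. -/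
theorem IsPrincipal.exists_irrLattice {E : Fin 4 → Disk} {a b : ℂ} (hE : IsPrincipal E)
    (h : IsSpinorTriple E a b) (hI : IsIntegralPacking (packing E))
    (hC : IsCoprimePacking (packing E)) :
    ∃ L, IsIrreducibleLattice L ∧ SimilarBy 1 (lat a b) L := by
  choose k hk using fun i => hI (E i) (mem_packing E i)
  obtain ⟨n1, n2, -⟩ := h.norm_sq hE.descartes
  have hd := h.dot_eq hE.descartes
  have hc := h.cross_sq hE.descartes
  have hg := cross_sq_add_dot_sq a b
  simp only [hk] at n1 n2 hd hc
  have hN : (k 0 + k 1 + k 2 - k 3) ^ 2 = 4 * ((k 0 + k 1) * (k 0 + k 2) - k 0 ^ 2) := by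
    have : ((k 0 + k 1 + k 2 - k 3 : ℝ)) ^ 2 = 4 * ((k 0 + k 1) * (k 0 + k 2) - k 0 ^ 2) := by
      rw [← hd, ← n1, ← n2, ← hg, hc]; ring
    exact_mod_cast this
  -- Here 2 a·b = k₀ + k₁ + k₂ - k₃ has a square divisible by 4, so a·b is an integer.
  obtain ⟨B, hB⟩ : (2 : ℤ) ∣ k 0 + k 1 + k 2 - k 3 :=
    Int.prime_two.dvd_of_dvd_pow (n := 2) ⟨2 * ((k 0 + k 1) * (k 0 + k 2) - k 0 ^ 2), by
      rw [hN]; ring⟩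
  have hBd : dot a b = B := by
    have : (k 0 + k 1 + k 2 - k 3 : ℝ) = 2 * B := by exact_mod_cast hB
    linarith
  have hdet : (k 0 + k 1) * (k 0 + k 2) = B ^ 2 + k 0 ^ 2 := by
    rw [hB] at hN
    linarith
  have hA0 : 0 ≤ k 0 + k 1 := by
    have : (0 : ℝ) ≤ k 0 + k 1 := n1 ▸ by positivity
    exact_mod_cast this
  have hC0 : 0 ≤ k 0 + k 2 := by
    have : (0 : ℝ) ≤ k 0 + k 2 := n2 ▸ by positivity
    exact_mod_cast this
  have hgcd : ∀ m : ℕ, (m : ℤ) ∣ k 0 + k 1 → (m : ℤ) ∣ B → (m : ℤ) ∣ k 0 + k 2 → (m : ℤ) ∣ k 0 →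
      m = 1 := by
    intro m h1 h2 h3 h0
    apply hC
    apply curv_dvd_of_mem_packing hE.descartes
    have hdvd : ∀ i, (m : ℤ) ∣ k i := by
      have e1 : (m : ℤ) ∣ k 1 := (dvd_add_right h0).mp h1
      have e2 : (m : ℤ) ∣ k 2 := (dvd_add_right h0).mp h3
      have e3 : (m : ℤ) ∣ k 3 := by
        have : k 3 = k 0 + k 1 + k 2 - 2 * B := by linarith
        rw [this]
        exact dvd_sub (dvd_add h1 e2) (h2.mul_left 2)
      intro i
      fin_cases i
      exacts [h0, e1, e2, e3]
    intro i
    obtain ⟨l, hl⟩ := hdvd i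
    exact ⟨l, by rw [hk, hl]; push_cast; ring⟩
  obtain ⟨v, w, hv, hw, nv, nw, hvw⟩ := exists_int_of_gram hA0 hC0 hdet hgcd
  refine ⟨lat v w, IsPrimitive.isIrreducibleLattice hv hw ?_, similarBy_one_of_gram_eq
    (by rw [n1, nv]; push_cast; ring) (by rw [n2, nw]; push_cast; ring) (by rw [hBd, hvw])⟩
  rintro m ⟨A', hA'⟩ ⟨C', hC'⟩ ⟨B', hB'⟩ ⟨D', hD'⟩
  have hcr : cross v w ^ 2 = (k 0 : ℝ) ^ 2 := by
    have h1 := cross_sq_add_dot_sq v w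
    have h2 : ((k 0 + k 1) * (k 0 + k 2) : ℝ) = B ^ 2 + k 0 ^ 2 := by exact_mod_cast hdet
    rw [nv, nw, hvw] at h1
    push_cast at h1
    linarith
  rw [nv] at hA'
  rw [nw] at hC'
  rw [hvw] at hB'
  rw [hD'] at hcr
  refine hgcd m ⟨A', by exact_mod_cast hA'⟩ ⟨B', by exact_mod_cast hB'⟩ ⟨C', by exact_mod_cast hC'⟩ ?_
  have : (m * D' : ℤ) ^ 2 = k 0 ^ 2 := by exact_mod_cast hcr
  exact (Int.pow_dvd_pow_iff two_ne_zero).mp (this ▸ pow_dvd_pow_of_dvd (Dvd.intro D' rfl) 2)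

/-- The spinors of a principal configuration of an irreducible strip. -/
theorem IsPrincipal.strip {E : Fin 4 → Disk} {a b : ℂ} (hE : IsPrincipal E)
    (h : IsSpinorTriple E a b) (hI : IsIntegralPacking (packing E))
    (hC : IsCoprimePacking (packing E)) (h0 : (E 0).curv = 0) : a = 0 ∧ ‖b‖ ^ 2 = 1 := by
  obtain ⟨n1, n2, -⟩ := h.norm_sq hE.descartes
  have hc := h.cross_sq hE.descartes
  have ha : a = 0 := (hE.isReduced h).eq_zero_of_cross (by simpa [h0] using hc)
  refine ⟨ha, ?_⟩
  obtain ⟨hD, -, r1, r2, r3⟩ := hE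
  rw [ha, norm_zero, h0] at n1
  rw [h0] at n2 r3
  have h1 : (E 1).curv = 0 := by linarith
  have h3 : (E 3).curv = (E 2).curv := by linarith
  obtain ⟨k, hk⟩ := hI (E 2) (mem_packing E 2)
  have hk0 : 0 ≤ k := by
    have : (0 : ℝ) ≤ k := by
      have : 0 ≤ ‖b‖ ^ 2 := by positivity
      linarith
    exact_mod_cast this
  lift k to ℕ using hk0
  -- The curvatures of the configuration are 0, 0, k, k, so coprimality gives k = 1.
  have := hC k (curv_dvd_of_mem_packing hD k (by
    intro i
    fin_cases i
    · exact ⟨0, by simpa using h0⟩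
    · exact ⟨0, by simpa using h1⟩
    · exact ⟨1, by simpa using hk⟩
    · exact ⟨1, by simpa [h3] using hk⟩))
  rw [n2, hk, this]
  simp

/-- Tangency to the outer disk makes b₁ positive, and b₁ bounds all remaining curvatures by sorting
and maximality. Thus several major disks occur only in strips. -/
theorem IsPrincipal.curv_pos {E : Fin 4 → Disk} (hE : IsPrincipal E) (h0 : (E 0).curv < 0)
    {d : Disk} (hd : d ∈ packing E) (hne : d ≠ E 0) : 0 < d.curv := by
  have h01 := (hE.descartes 0 1 (by decide)).curv_add_nonneg
  have hm := hE.isRoot.isMaximal hE.descartes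
  obtain ⟨-, -, r1, r2, -⟩ := hE
  by_cases hr : d ∈ Set.range E
  · obtain ⟨i, rfl⟩ := hr
    obtain rfl | rfl | rfl | rfl : i = 0 ∨ i = 1 ∨ i = 2 ∨ i = 3 := by clear hd hne; revert i; decide
    · exact absurd rfl hne
    all_goals linarith
  · linarith [hm d hd hr 1]

/-- The spinor lattices of the coronas of all major disks agree. -/
theorem coronaLattice_similar (P : IrrPacking) {d d' : Disk} (hd : IsMajor P.1 d)
    (hd' : IsMajor P.1 d') : SimilarBy 1 (coronaLattice P.1 d) (coronaLattice P.1 d') := by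
  obtain ⟨P, hP, hI, hC⟩ := P
  obtain ⟨E, hE, rfl, rfl⟩ := exists_isPrincipal hP hI hd
  obtain ⟨F, hF, rfl, hPF⟩ := exists_isPrincipal hP hI hd'
  obtain ⟨a, b, h⟩ := hE.descartes.exists_spinorTriple
  obtain ⟨a', b', h'⟩ := hF.descartes.exists_spinorTriple
  have l1 := h.coronaLattice_eq hE.descartes
  have l2 := h'.coronaLattice_eq hF.descartes
  rw [hPF] at l2
  by_cases heq : F 0 = E 0
  · rw [heq]
    exact ⟨LinearIsometryEquiv.refl ℝ ℂ, by simp⟩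
  · have e0 : (E 0).curv = 0 := by
      by_contra hne
      have := hE.curv_pos (lt_of_le_of_ne hE.major hne) hd'.1 heq
      linarith [hd'.2]
    have f0 : (F 0).curv = 0 := by
      by_contra hne
      have := hF.curv_pos (lt_of_le_of_ne hF.major hne) (hPF ▸ hd.1) (Ne.symm heq)
      linarith [hd.2]
    obtain ⟨rfl, hb⟩ := hE.strip h hI hC e0
    obtain ⟨rfl, hb'⟩ := hF.strip h' (hPF.symm ▸ hI) (hPF.symm ▸ hC) f0
    simp only at l1 l2 ⊢
    rw [l1, l2]
    exact similarBy_one_of_gram_eq rfl (by rw [hb, hb']) (by simp [dot])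

theorem exists_packingLattice (P : IrrPacking) :
    ∃ L : IrrLattice, ∀ d₀, IsMajor P.1 d₀ → SimilarBy 1 (coronaLattice P.1 d₀) L.1 := by
  obtain ⟨d, hd⟩ := exists_isMajor P.2.1 P.2.2.1
  obtain ⟨E, hE, hE0, hPE⟩ := exists_isPrincipal P.2.1 P.2.2.1 hd
  obtain ⟨a, b, h⟩ := hE.descartes.exists_spinorTriple
  obtain ⟨L, hL, hs⟩ := hE.exists_irrLattice h (hPE ▸ P.2.2.1) (hPE ▸ P.2.2.2)
  rw [← h.coronaLattice_eq hE.descartes, hPE, hE0] at hs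
  exact ⟨⟨L, hL⟩, fun d₀ hd₀ => (coronaLattice_similar P hd₀ hd).one_trans hs⟩

/-! ### The lattice of a packing as a complete invariant -/

/-- An integral lattice representing the spinor lattice of the major corona. -/
noncomputable def packingLattice (P : IrrPacking) : IrrLattice := (exists_packingLattice P).choose

theorem packingLattice_spec (P : IrrPacking) {d₀ : Disk} (hd : IsMajor P.1 d₀) :
    SimilarBy 1 (coronaLattice P.1 d₀) (packingLattice P).1 :=
  (exists_packingLattice P).choose_spec d₀ hd

theorem exists_principal_triple (P : IrrPacking) : ∃ (E : Fin 4 → Disk) (a b : ℂ), IsPrincipal E ∧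
    IsSpinorTriple E a b ∧ packing E = P.1 ∧ SimilarBy 1 (lat a b) (packingLattice P).1 := by
  obtain ⟨d, hd⟩ := exists_isMajor P.2.1 P.2.2.1
  obtain ⟨E, hE, hE0, hPE⟩ := exists_isPrincipal P.2.1 P.2.2.1 hd
  obtain ⟨a, b, h⟩ := hE.descartes.exists_spinorTriple
  refine ⟨E, a, b, hE, h, hPE, ?_⟩
  rw [← h.coronaLattice_eq hE.descartes, hPE, hE0]
  exact packingLattice_spec P hd

theorem packingLattice_similar_of_congruent {P Q : IrrPacking} (h : Congruent P.1 Q.1) :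
    Similar (packingLattice P).1 (packingLattice Q).1 := by
  obtain ⟨E, a, b, hE, hab, hPE, hs⟩ := exists_principal_triple P
  obtain ⟨g, t, hQ⟩ := congruent_iff.mp h
  set F : Fin 4 → Disk := fun i => (E i).move g t with hF
  have hFP : IsPrincipal F := ⟨hE.descartes.move g t, hE.major, hE.le₁₂, hE.le₂₃, hE.le₃⟩
  have hQF : packing F = Q.1 := by rw [hF, packing_move, hPE, hQ]
  obtain ⟨a', b', hab'⟩ := hFP.descartes.exists_spinorTriple
  obtain ⟨e1, e2, e3⟩ := hab.gram_eq hE.descartes hFP.descartes hab' fun i => rfl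
  have hs' := packingLattice_spec Q (d₀ := F 0) ⟨hQF ▸ mem_packing F 0, hFP.major⟩
  rw [← hQF, hab'.coronaLattice_eq hFP.descartes] at hs'
  exact (hs.one_symm.one_trans ((similarBy_one_of_gram_eq e1 e2 e3).one_trans hs')).similar

/-- Irreducibility makes the similarity an isometry; uniqueness of the reduced Gram matrix gives
equal curvatures, the sign of b₀ being fixed by b₀ ≤ 0, and equal curvatures give a motion. -/
theorem congruent_of_packingLattice_similar {P Q : IrrPacking}
    (h : Similar (packingLattice P).1 (packingLattice Q).1) : Congruent P.1 Q.1 := by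
  obtain ⟨E, a, b, hE, hab, hPE, hs⟩ := exists_principal_triple P
  obtain ⟨F, a', b', hF, hab', hQF, hs'⟩ := exists_principal_triple Q
  have hsim := hs.one_trans
    ((h.similarBy_one (packingLattice P).2 (packingLattice Q).2).one_trans hs'.one_symm)
  obtain ⟨g, hg⟩ := similarBy_one_iff.mp hsim
  obtain ⟨e1, e2, e3⟩ := gram_eq_of_lat_eq (hF.isReduced hab') ((hE.isReduced hab).map g) hg
  rw [g.norm_map] at e1 e2
  rw [dot_map] at e3
  obtain ⟨n1, n2, -⟩ := hab.norm_sq hE.descartes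
  obtain ⟨n1', n2', -⟩ := hab'.norm_sq hF.descartes
  have hd := hab.dot_eq hE.descartes
  have hd' := hab'.dot_eq hF.descartes
  have hc0 : (E 0).curv = (F 0).curv := by
    have h1 := hab.cross_sq hE.descartes
    have h2 := hab'.cross_sq hF.descartes
    have h3 := cross_sq_add_dot_sq a b
    have h4 := cross_sq_add_dot_sq a' b'
    rw [e1, e2, e3] at h4
    have h5 : (-(E 0).curv) ^ 2 = (-(F 0).curv) ^ 2 := by linarith
    have := (pow_left_inj₀ (neg_nonneg.mpr hE.major) (neg_nonneg.mpr hF.major) two_ne_zero).mp h5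
    linarith
  have hc : ∀ i, (E i).curv = (F i).curv := by
    intro i
    fin_cases i <;> simp <;> linarith
  obtain ⟨g, t, hgt⟩ := exists_move_of_curv_eq hE.descartes hF.descartes hc
  refine congruent_iff.mpr ⟨g, t, ?_⟩
  rw [← hPE, ← hQF, ← packing_move, ← funext hgt]

/-! ### Packings with a prescribed lattice -/

/-- The disk tangent to the outside of the circle of radius `1 / D` about the origin with spinor
`u`. -/
noncomputable def circleDisk (D : ℝ) (hD : D ≠ 0) (u : ℂ) : Disk where
  curv := D + ‖u‖ ^ 2
  -- Solves u² = -D·cen, the spinor equation for an outer disk centred at 0; tangency then forces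
  -- the cocurvature.
  cen := ((-1 / D : ℝ) : ℂ) * u ^ 2
  cocurv := (‖u‖ ^ 2 - D) / D ^ 2
  norm_eq := by
    rw [norm_mul, mul_pow, Complex.norm_real, Real.norm_eq_abs, sq_abs, norm_pow]
    field_simp
    ring

/-- The outside of the circle of radius `1 / D` about the origin. -/
noncomputable def outerDisk (D : ℝ) (hD : D ≠ 0) : Disk where
  curv := -D
  cen := 0
  cocurv := 1 / D
  norm_eq := by
    field_simp
    simp

theorem tangent_outerDisk {D : ℝ} (hD : 0 < D) {u : ℂ} (hu : u ≠ 0) :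
    Tangent (outerDisk D hD.ne') (circleDisk D hD.ne' u) := by
  refine (tangent_iff_of_inversive ?_).mpr (Or.inl ?_)
  · simp only [inversive, outerDisk, circleDisk, dot, Complex.zero_re, Complex.zero_im]
    field_simp
    ring
  · simp only [outerDisk, circleDisk]
    have := norm_pos_iff.mpr hu
    rw [neg_add_cancel_left]
    positivity

theorem tangent_circleDisk {D : ℝ} (hD : 0 < D) {u v : ℂ} (h : cross u v ^ 2 = D ^ 2) :
    Tangent (circleDisk D hD.ne' u) (circleDisk D hD.ne' v) := by
  refine (tangent_iff_of_inversive ?_).mpr (Or.inl ?_)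
  · have hdot : dot (u ^ 2) (v ^ 2) = ‖u‖ ^ 2 * ‖v‖ ^ 2 - 2 * D ^ 2 := by
      rw [← h]
      rw [norm_sq_eq, norm_sq_eq]
      simp only [dot, cross, pow_two, Complex.mul_re, Complex.mul_im]
      ring
    simp only [inversive, circleDisk]
    rw [dot_mul_left, dot_mul_right, hdot]
    field_simp
    ring
  · simp only [circleDisk]
    positivity

/-- Descartes configurations with prescribed spinors. -/
theorem exists_descartes_of_reduced {a b : ℂ} (hr : IsReduced a b)
    (h : cross a b = 0 → ‖b‖ ^ 2 = 1) : ∃ E, IsDescartes E ∧ (E 0).curv = -|cross a b| ∧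
      (E 1).curv = |cross a b| + ‖a‖ ^ 2 ∧ (E 2).curv = |cross a b| + ‖b‖ ^ 2 ∧
      (E 3).curv = |cross a b| + ‖a - b‖ ^ 2 := by
  have build : ∀ d₀ d₁ d₂ d₃ : Disk, Tangent d₀ d₁ → Tangent d₀ d₂ → Tangent d₀ d₃ →
      Tangent d₁ d₂ → Tangent d₁ d₃ → Tangent d₂ d₃ → IsDescartes ![d₀, d₁, d₂, d₃] := by
    intro d₀ d₁ d₂ d₃ h01 h02 h03 h12 h13 h23 i j hij
    fin_cases i <;> fin_cases j <;> first | exact absurd rfl hij | skip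
    exacts [h01, h02, h03, h01.symm, h12, h13, h02.symm, h12.symm, h23, h03.symm, h13.symm,
      h23.symm]
  by_cases h0 : cross a b = 0
  · have ha := hr.eq_zero_of_cross h0
    have hb := h h0
    -- The half-planes Im z ≥ 1 and Im z ≤ -1 with the unit disks centred at 0 and 2.
    let d₀ : Disk := ⟨0, Complex.I, 2, by simp⟩
    let d₁ : Disk := ⟨0, -Complex.I, 2, by simp⟩
    let d₂ : Disk := ⟨1, 0, -1, by simp⟩
    let d₃ : Disk := ⟨1, 2, 3, by norm_num⟩
    refine ⟨![d₀, d₁, d₂, d₃], build _ _ _ _ ?_ ?_ ?_ ?_ ?_ ?_, ?_, ?_, ?_, ?_⟩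
    rotate_left 6
    · simp [d₀, h0]
    · rw [h0]; simp [d₁, ha]
    · simp [d₂, h0, hb]
    · rw [h0]; simp [d₃, ha, hb]
    all_goals
      constructor <;> simp [inversive, dot, d₀, d₁, d₂, d₃] <;> norm_num
  · set D := |cross a b| with hDdef
    have hD : 0 < D := abs_pos.mpr h0
    have c1 : cross a b ^ 2 = D ^ 2 := (sq_abs _).symm
    have c2 : cross a (a - b) ^ 2 = D ^ 2 := by
      rw [← c1]; simp only [cross, Complex.sub_re, Complex.sub_im]; ring
    have c3 : cross b (a - b) ^ 2 = D ^ 2 := by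
      rw [← c1]; simp only [cross, Complex.sub_re, Complex.sub_im]; ring
    have ha : a ≠ 0 := by rintro rfl; simp [cross] at h0
    have hb : b ≠ 0 := by rintro rfl; simp [cross] at h0
    have hab : a - b ≠ 0 := by
      intro hab
      rw [hab] at c2
      have : D ^ 2 = 0 := by rw [← c2]; simp [cross]
      exact hD.ne' (by simpa using this)
    exact ⟨![outerDisk D hD.ne', circleDisk D hD.ne' a, circleDisk D hD.ne' b,
      circleDisk D hD.ne' (a - b)], build _ _ _ _ (tangent_outerDisk hD ha)
      (tangent_outerDisk hD hb) (tangent_outerDisk hD hab) (tangent_circleDisk hD c1)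
      (tangent_circleDisk hD c2) (tangent_circleDisk hD c3), rfl, rfl, rfl, rfl⟩

/-- Every irreducible integral lattice is the spinor lattice of an irreducible packing. -/
theorem exists_packing_of_lattice (L : IrrLattice) :
    ∃ P : IrrPacking, Similar (packingLattice P).1 L.1 := by
  obtain ⟨L, hL⟩ := L
  obtain ⟨-, v, w, hv, hw, hLvw⟩ := hL.1
  obtain ⟨a, b, ha, hb, hab, hr⟩ := exists_reduced hv hw
  have hLab : L = lat a b := hLvw.trans hab.symm
  subst hLab
  have hprim := hL.isPrimitive ha hb
  obtain ⟨A, hA⟩ := ha.norm_sq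
  obtain ⟨C, hC⟩ := hb.norm_sq
  obtain ⟨B, hB⟩ := ha.dot hb
  obtain ⟨D₀, hD₀⟩ := ha.cross hb
  have hD : |cross a b| = (|D₀| : ℤ) := by rw [hD₀, Int.cast_abs]
  set D := |D₀|
  have hstrip : cross a b = 0 → ‖b‖ ^ 2 = 1 := by
    intro h0
    have ha0 := hr.eq_zero_of_cross h0
    have := hprim C ⟨0, by simp [ha0]⟩ ⟨1, by simpa using hC⟩ ⟨0, by simp [ha0, dot]⟩
      ⟨0, by simp [h0]⟩
    rw [hC, this]
    simp
  obtain ⟨E, hE, c0, c1, c2, c3⟩ := exists_descartes_of_reduced hr hstrip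
  rw [norm_sq_sub, hB] at c3
  rw [hD] at c0 c1 c2 c3
  rw [hA] at c1 c3
  rw [hC] at c2 c3
  have hint : IsIntegralPacking (packing E) := by
    have := curv_dvd_of_mem_packing hE 1 (by
      intro i
      fin_cases i
      · exact ⟨-D, by simpa using c0⟩
      · exact ⟨D + A, by simpa using c1⟩
      · exact ⟨D + C, by simpa using c2⟩
      · exact ⟨D + (A + C - 2 * B), by simpa using c3⟩)
    simpa [IsIntegralPacking] using this
  have hcop : IsCoprimePacking (packing E) := by
    intro m hm
    obtain ⟨k0, h0⟩ := hm _ (mem_packing E 0)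
    obtain ⟨k1, h1⟩ := hm _ (mem_packing E 1)
    obtain ⟨k2, h2⟩ := hm _ (mem_packing E 2)
    rw [h0] at c0
    rw [h1] at c1
    rw [h2] at c2
    have dD : (D : ℤ) = m * -k0 := by
      have : (D : ℝ) = m * -k0 := by linarith
      exact_mod_cast this
    have dA : (A : ℤ) = m * (k1 + k0) := by
      have : (A : ℝ) = m * (k1 + k0) := by linarith
      exact_mod_cast this
    have dC : (C : ℤ) = m * (k2 + k0) := by
      have : (C : ℝ) = m * (k2 + k0) := by linarith
      exact_mod_cast this
    have hdet : D ^ 2 + B ^ 2 = A * C := by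
      have h1 := cross_sq_add_dot_sq a b
      rw [← sq_abs, hD, hB, hA, hC] at h1
      exact_mod_cast h1
    -- B² = AC - D² is divisible by m².
    have dB : (m : ℤ) ∣ B := by
      rw [← Int.pow_dvd_pow_iff two_ne_zero]
      refine ⟨(k1 + k0) * (k2 + k0) - k0 ^ 2, ?_⟩
      rw [dD, dA, dC] at hdet
      linarith
    obtain ⟨k3, h3⟩ := dB
    have dD0 : (m : ℤ) ∣ D₀ := (dvd_abs _ _).mp (Dvd.intro _ dD.symm)
    obtain ⟨k4, h4⟩ := dD0
    exact hprim m ⟨k1 + k0, by rw [hA]; exact_mod_cast dA⟩ ⟨k2 + k0, by rw [hC]; exact_mod_cast dC⟩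
      ⟨k3, by rw [hB, h3]; push_cast; ring⟩ ⟨k4, by rw [hD₀, h4]; push_cast; ring⟩
  obtain ⟨a', b', h'⟩ := hE.exists_spinorTriple
  obtain ⟨n1, n2, -⟩ := h'.norm_sq hE
  have hd := h'.dot_eq hE
  let P : IrrPacking := ⟨packing E, ⟨E, hE, rfl⟩, hint, hcop⟩
  have hmaj : IsMajor P.1 (E 0) := ⟨mem_packing E 0, by
    rw [c0, ← hD]; exact neg_nonpos.mpr (abs_nonneg _)⟩
  have hs := packingLattice_spec P hmaj
  rw [show coronaLattice P.1 (E 0) = lat a' b' from h'.coronaLattice_eq hE] at hs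
  have hs' : SimilarBy 1 (lat a' b') (lat a b) := by
    apply similarBy_one_of_gram_eq
    · rw [n1, c0, c1, hA]; ring
    · rw [n2, c0, c2, hC]; ring
    · rw [c0, c1, c2, c3] at hd
      rw [hB]
      linarith
  exact ⟨P, (hs.one_symm.one_trans hs').similar⟩

/-! ### The bijections between the classes -/

theorem curv_eq_of_similarBy {P : Set Disk} (hP : IsPacking P) (hI : IsIntegralPacking P)
    {d₀ : Disk} (hd : IsMajor P d₀) {v w : ℂ} (h : SimilarBy 1 (coronaLattice P d₀) (lat v w)) :
    d₀.curv = -|cross v w| := by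
  obtain ⟨E, hE, rfl, rfl⟩ := exists_isPrincipal hP hI hd
  obtain ⟨a, b, hab⟩ := hE.descartes.exists_spinorTriple
  rw [hab.coronaLattice_eq hE.descartes] at h
  obtain ⟨g, hg⟩ := similarBy_one_iff.mp h
  rw [hab.curv_eq hE.descartes hE.major, abs_cross_eq_of_lat_eq hg,
    (sq_eq_sq_iff_abs_eq_abs _ _).mp (cross_sq_map g a b)]

/-- Packings up to isometry correspond to lattices up to similarity. -/
noncomputable def packingEquiv : Quotient packingSetoid ≃ Quotient latticeSetoid :=
  Equiv.ofBijective (Quotient.map packingLattice fun _ _ h => packingLattice_similar_of_congruent h)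
    ⟨by
      rintro ⟨P⟩ ⟨Q⟩ h
      exact Quotient.sound (congruent_of_packingLattice_similar (Quotient.exact h)), by
      rintro ⟨L⟩
      obtain ⟨P, hP⟩ := exists_packing_of_lattice L
      exact ⟨Quotient.mk _ P, Quotient.sound hP⟩⟩

theorem packingEquiv_eq_iff (P : IrrPacking) (L : IrrLattice) {d₀ : Disk} (hd : IsMajor P.1 d₀) :
    packingEquiv (Quotient.mk _ P) = Quotient.mk _ L ↔ SimilarBy 1 (coronaLattice P.1 d₀) L.1 := by
  have hs := packingLattice_spec P hd
  constructor
  · intro h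
    have h' : Similar (packingLattice P).1 L.1 := Quotient.exact h
    exact hs.one_trans (h'.similarBy_one (packingLattice P).2 L.2)
  · intro h
    exact Quotient.sound (hs.one_symm.one_trans h).similar

/-- Reduced pairs up to isometry correspond to lattices up to similarity. -/
noncomputable def pairEquiv : Quotient pairSetoid ≃ Quotient latticeSetoid :=
  Equiv.ofBijective (Quotient.map ReducedPair.lattice (by
    rintro ⟨⟨a, b⟩, hp⟩ ⟨⟨a', b'⟩, hq⟩ ⟨g, h1, h2⟩
    simp only at h1 h2
    subst h1 h2
    exact (similarBy_one_iff.mpr ⟨g, rfl⟩).similar))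
    ⟨by
      rintro ⟨⟨⟨a, b⟩, hp⟩⟩ ⟨⟨⟨a', b'⟩, hq⟩⟩ h
      apply Quotient.sound
      have h' : Similar (lat a b) (lat a' b') := Quotient.exact h
      obtain ⟨g, hg⟩ := similarBy_one_iff.mp (h'.similarBy_one hp.2.2.2 hq.2.2.2)
      obtain ⟨e1, e2, e3⟩ := gram_eq_of_lat_eq hq.2.2.1 (hp.2.2.1.map g) hg
      simp only [g.norm_map, dot_map] at e1 e2 e3
      exact exists_isometry_of_gram_eq e1.symm e2.symm e3.symm, by
      rintro ⟨⟨L, hL⟩⟩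
      obtain ⟨-, v, w, hv, hw, hLvw⟩ := hL.1
      obtain ⟨a, b, ha, hb, hab, hr⟩ := exists_reduced hv hw
      have hLab : L = lat a b := hLvw.trans hab.symm
      subst hLab
      exact ⟨Quotient.mk _ ⟨(a, b), ha, hb, hr, hL⟩, rfl⟩⟩

end Apollonian

theorem mainTheorem2 :
    -- packings up to isometry, lattices up to similarity and reduced pairs correspond one-to-one
    (∃ (Φ : Quotient packingSetoid ≃ Quotient latticeSetoid)
        (Ψ : Quotient pairSetoid ≃ Quotient latticeSetoid),
      -- `Φ` sends a packing to the class of the spinor lattice of its major corona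
      (∀ (P : IrrPacking) (L : IrrLattice) (d₀ : Disk), IsMajor P.1 d₀ →
        (Φ (Quotient.mk _ P) = Quotient.mk _ L ↔ SimilarBy 1 (coronaLattice P.1 d₀) L.1)) ∧
      -- the discriminant of the lattice is the negative of the curvature of the major disk
      (∀ (P : IrrPacking) (L : IrrLattice) (d₀ : Disk), IsMajor P.1 d₀ →
        Φ (Quotient.mk _ P) = Quotient.mk _ L →
        ∀ v w : ℂ, L.1 = lat v w → d₀.curv = -|cross v w|) ∧
      -- `Ψ` sends a reduced pair to the class of the lattice that it spans
      (∀ p : ReducedPair, Ψ (Quotient.mk _ p) = Quotient.mk _ p.lattice)) ∧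
    -- the principal basis of the spinor lattice of the major corona and maximal configurations
    (∀ P : Set Disk, IsPacking P → IsIntegralPacking P →
      (∃ d₀, IsMajor P d₀) ∧
      (∀ d₀, IsMajor P d₀ →
        (∃ a b : ℂ, IsPrincipalBasis (coronaLattice P d₀) a b) ∧
        ∀ a b : ℂ, IsPrincipalBasis (coronaLattice P d₀) a b →
          (∃ d₁ ∈ corona P d₀, IsSpinor d₀ d₁ a) ∧
          (∃ d₂ ∈ corona P d₀, IsSpinor d₀ d₂ b) ∧
          ∀ d₁ ∈ corona P d₀, ∀ d₂ ∈ corona P d₀, IsSpinor d₀ d₁ a → IsSpinor d₀ d₂ b →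
            ∃ d₃ ∈ corona P d₀, IsSpinor d₀ d₃ (a - b) ∧
              IsDescartes ![d₀, d₁, d₂, d₃] ∧
              packing ![d₀, d₁, d₂, d₃] = P ∧
              IsMaximal ![d₀, d₁, d₂, d₃] ∧
              d₀.curv = -|cross a b| ∧
              d₁.curv = |cross a b| + ‖a‖ ^ 2 ∧
              d₂.curv = |cross a b| + ‖b‖ ^ 2 ∧
              d₃.curv = |cross a b| + ‖a - b‖ ^ 2) ∧
      -- conversely, every maximal configuration of the packing arises from a principal basis
      (∀ D : Fin 4 → Disk, IsDescartes D → packing D = P → IsMaximal D →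
        ∃ (σ : Equiv.Perm (Fin 4)) (a b : ℂ),
          IsMajor P (D (σ 0)) ∧
          IsPrincipalBasis (coronaLattice P (D (σ 0))) a b ∧
          IsSpinor (D (σ 0)) (D (σ 1)) a ∧
          IsSpinor (D (σ 0)) (D (σ 2)) b ∧
          IsSpinor (D (σ 0)) (D (σ 3)) (a - b))) := by
  refine ⟨⟨packingEquiv, pairEquiv, fun P L d₀ hd => packingEquiv_eq_iff P L hd, ?_, fun _ => rfl⟩,
    fun P hP hI => ⟨exists_isMajor hP hI, fun d₀ hd => principal_basis_of_isMajor hP hI hd, ?_⟩⟩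
  · intro P L d₀ hd h v w hL
    have hs := (packingEquiv_eq_iff P L hd).mp h
    rw [hL] at hs
    exact curv_eq_of_similarBy P.2.1 P.2.2.1 hd hs
  · rintro D hD rfl hm
    exact principal_basis_of_isMaximal hD hm
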